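/- For $f\in L^2(\mathbb R)$ let $\widehat f(\xi)=\int_{\mathbb R}e^{-ix\xi}f(x)\,dx$ be its Fourier transform, and let $$[\widetilde E_5]f(t,x)=\frac1{2\pi}\int_{\mathbb R}|\xi+\xi^3|^{1/6}\,e^{ix\xi+it(\xi^3+\xi^5)}\,\widehat f(\xi)\,d\xi ,\qquad (t,x)\in\mathbb R^2,$$ be the Fourier extension operator of the curve $(\xi,\xi^3+\xi^5)$, where for general $f\in L^2(\mathbb R)$ the integral is understood as the limit in $L^6_{t,x}(\mathbb R^2)$, as $R\to\infty$, of the absolutely convergent integrals over $|\xi|<R$. Let $\mathcal D$ be the set of all dyadic intervals $\tau=[k,k+1)2^j$ with $k,j\in\mathbb Z$; write $|\tau|$ for the length and $c_\tau$ for the center of $\tau$, and let $f_\tau\in L^2(\mathbb R)$ be given by $\widehat{f_\tau}=\mathbf 1_\tau\widehat f$. Then there are $\theta\in(0,1)$ and a constant $C<\infty$ such that for all $f\in L^2(\mathbb R)$ the function $[\widetilde E_5]f\in L^6_{t,x}(\mathbb R^2)$ exists and $$\big\|[\widetilde E_5]f\big\|_{L^6_{t,x}(\mathbb R^2)}\le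 C\Big[\sup_{\tau\in\mathcal D}|c_\tau+c_\tau^3|^{-1/6}\,|\tau|^{-1/2}\,\big\|[\widetilde E_5]f_\tau\big\|_{L^\infty_{t,x}(\mathbb R^2)}\Big]^{\theta}\,\|f\|_{L^2(\mathbb R)}^{1-\theta}.$$ -/

import Mathlib

open MeasureTheory Filter Topology FourierTransform
open scoped ENNReal NNReal

noncomputable section

namespace RefinedStrichartz

/-- The space `L²(ℝ)` of complex-valued square-integrable functions. -/
abbrev L2 : Type := Lp ℂ 2 (volume : Measure ℝ)

/-- The Fourier transform in angular frequency, `f̂(ξ) = ∫ e^{-ixξ} f(x) dx`, of `f ∈ L²(ℝ)`.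
Mathlib's `𝓕` is the extension to `L²` of `f ↦ ∫ e^{-2πixζ} f(x) dx`, so `f̂(ξ) = 𝓕 f (ξ / 2π)`. -/
def hat (f : L2) (ξ : ℝ) : ℂ :=
  (𝓕 f : L2) (ξ / (2 * Real.pi))

/-- The frequency localization of `f ∈ L²(ℝ)` to the interval `[a, b)`: the function whose
Fourier transform `f̂` is cut off to `[a, b)`.  The angular frequency of `ζ` is `2πζ`. -/
def freqCut (a b : ℝ) (f : L2) : L2 :=
  𝓕⁻ (MemLp.toLp _ ((Lp.memLp (𝓕 f : L2)).indicator
    (s := (fun ζ : ℝ => 2 * Real.pi * ζ) ⁻¹' Set.Ico a b)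
    ((measurable_const_mul (2 * Real.pi)) measurableSet_Ico)) : L2)

/-- The Fourier transform of `freqCut a b f` is `f̂` on `[a, b)` and `0` elsewhere. -/
theorem hat_freqCut (a b : ℝ) (f : L2) :
    hat (freqCut a b f) =ᵐ[volume] (Set.Ico a b).indicator (hat f) := by
  have hpi : (2 * Real.pi) ≠ 0 := by positivity
  have hq : Measure.QuasiMeasurePreserving (fun ξ : ℝ => ξ / (2 * Real.pi)) volume volume := by
    refine ⟨by fun_prop, ?_⟩
    have : (fun ξ : ℝ => ξ / (2 * Real.pi)) = fun ξ => (2 * Real.pi)⁻¹ * ξ := by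
      funext ξ; rw [div_eq_inv_mul]
    rw [this, Real.map_volume_mul_left (inv_ne_zero hpi)]
    exact Measure.smul_absolutelyContinuous
  have h1 : (𝓕 (freqCut a b f) : L2) =ᵐ[volume]
      ((fun ζ : ℝ => 2 * Real.pi * ζ) ⁻¹' Set.Ico a b).indicator (𝓕 f : L2) := by
    unfold freqCut
    rw [FourierTransform.fourier_fourierInv_eq]
    exact MemLp.coeFn_toLp _
  have h2 := hq.ae_eq_comp h1
  filter_upwards [h2] with ξ hξ
  simp only [Function.comp] at hξ
  rw [hat, hξ]
  have : 2 * Real.pi * (ξ / (2 * Real.pi)) = ξ := by field_simp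
  by_cases h : ξ ∈ Set.Ico a b
  · rw [Set.indicator_of_mem h, Set.indicator_of_mem (by simpa [this] using h)]; rfl
  · rw [Set.indicator_of_notMem h, Set.indicator_of_notMem (by simpa [this] using h)]

/-- The oscillatory integral of the Fourier extension operator for the curve `(ξ, ξ³ + ξ⁵)`, at
the space-time point `p = (t, x)`:
`(1/2π) ∫ |ξ + ξ³|^{1/6} e^{ixξ + it(ξ³ + ξ⁵)} f̂(ξ) dξ`.
It converges absolutely whenever `f̂` has bounded support. -/
def extIntegral (f : L2) (p : ℝ × ℝ) : ℂ :=
  (1 / (2 * Real.pi) : ℂ) * ∫ ξ : ℝ, ((|ξ + ξ ^ 3| ^ (1 / 6 : ℝ) : ℝ) : ℂ) *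
    Complex.exp (Complex.I * ((p.2 * ξ + p.1 * (ξ ^ 3 + ξ ^ 5) : ℝ) : ℂ)) * hat f ξ

/-- `F` is the function `Ẽ₅ f ∈ L⁶(ℝ²)`.  For a general `f ∈ L²(ℝ)` the oscillatory integral does
not converge absolutely, and it is understood as the limit in `L⁶_{t,x}(ℝ²)`, as `R → ∞`, of the
absolutely convergent integrals over `|ξ| < R`.  Such an `F` is unique almost everywhere. -/
def IsExtension (f : L2) (F : ℝ × ℝ → ℂ) : Prop :=
  MemLp F 6 volume ∧
    Tendsto (fun R : ℝ => eLpNorm (extIntegral (freqCut (-R) R f) - F) 6 volume) atTop (𝓝 0)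

/-- The dyadic interval `[k, k + 1) 2^j` with `k, j ∈ ℤ`. -/
structure DyadicInterval where
  /-- the position -/
  k : ℤ
  /-- the scale -/
  j : ℤ

namespace DyadicInterval

/-- The left end point `k 2^j`. -/
def left (τ : DyadicInterval) : ℝ := τ.k * (2 : ℝ) ^ τ.j

/-- The right end point `(k + 1) 2^j`. -/
def right (τ : DyadicInterval) : ℝ := (τ.k + 1) * (2 : ℝ) ^ τ.j

/-- The length `|τ|`. -/
def length (τ : DyadicInterval) : ℝ := τ.right - τ.left

/-- The center `c_τ`; it is never `0`. -/
def center (τ : DyadicInterval) : ℝ := (τ.left + τ.right) / 2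

end DyadicInterval

/-- The piece `f_τ` of `f`, whose Fourier transform is `f̂` cut off to `τ`. -/
def piece (f : L2) (τ : DyadicInterval) : L2 := freqCut τ.left τ.right f

/-- `sup_τ |c_τ + c_τ³|^{-1/6} |τ|^{-1/2} ‖Ẽ₅ f_τ‖_{L^∞(ℝ²)}` over all dyadic intervals. -/
def dyadicSup (f : L2) : ℝ≥0∞ :=
  ⨆ τ : DyadicInterval,
    ENNReal.ofReal (|τ.center + τ.center ^ 3| ^ (-(1 / 6) : ℝ) * τ.length ^ (-(1 / 2) : ℝ)) *
      eLpNorm (extIntegral (piece f τ)) ∞ volume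

end RefinedStrichartz

end

/-!
Let `w(ξ) = |ξ + ξ³|^{1/6}` and let `u` be a density on `(0, ∞)` with `‖u‖₂ ≤ 1`.  The square of the
extension of `w u` is twice the extension of `w u ⊗ w u` on the set of sums of two points of the
curve, parametrized injectively by the pairs `0 < ξ < η`, and the Jacobian of that parametrization
dominates `(η - ξ) w(ξ)³ w(η)³`.  Hence the `L⁶` norm of the extension of `u` is an `L³` norm in two
dimensions, to which the Hausdorff–Young inequality applies and leads to a double integral of
`(|u(ξ)| |u(η)|)^{3/2} (η - ξ)^{-1/2}`.

Decompose the pairs into Whitney squares about the diagonal.  Pairs for which `|u(ξ)|` or `|u(η)|`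
is not comparable, up to `L⁴`, to the inverse square root of the side length contribute `O(1/L)` to
that integral.  At a comparable pair each frequency is seen by only `O(log L)` scales, so
interpolating between the dyadic `L^∞` bound and the `L²` bound on each Whitney square makes the
squares sum as if they were orthogonal.  Choosing `L` as a power of the dyadic bound gives the
refined estimate for positive frequencies, and the reflection `ξ ↦ -ξ` gives the others.

Since the dyadic bound never exceeds a multiple of `‖f‖₂`, the refined estimate contains the
`L² → L⁶` bound, from which the truncated integrals converge; truncating at `|ξ| < 2^m` respects
the dyadic bound, so the refined estimate passes to the limit.
-/

noncomputable section

namespace RefinedStrichartz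

section Plancherel

open scoped SchwartzMap

variable {V : Type*} [NormedAddCommGroup V] [InnerProductSpace ℝ V] [FiniteDimensional ℝ V]
  [MeasurableSpace V] [BorelSpace V]
variable {F : Type*} [NormedAddCommGroup F] [InnerProductSpace ℂ F] [CompleteSpace F]

theorem fourier_toLp_ae_eq {f : V → F} (hf₁ : Integrable f) (hf₂ : MemLp f 2) :
    (𝓕 (hf₂.toLp f) : Lp F 2) =ᵐ[volume] 𝓕 f := by
  have hcont : Continuous (𝓕 f) :=
    VectorFourier.fourierIntegral_continuous Real.continuous_fourierChar continuous_inner hf₁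
  refine ae_eq_of_integral_contDiff_smul_eq ((Lp.memLp _).locallyIntegrable (by norm_num))
    hcont.locallyIntegrable fun g hg hgs => ?_
  let φ := (hgs.comp_left Complex.ofReal_zero).toSchwartzMap (Complex.ofRealCLM.contDiff.comp hg)
  have hφ (v : V) : φ v = (g v : ℂ) := rfl
  calc ∫ w, g w • (𝓕 (hf₂.toLp f) : Lp F 2 (volume : Measure V)) w
      = 𝓕 ((hf₂.toLp f : Lp F 2) : 𝓢'(V, F)) φ := by
        rw [Lp.fourier_toTemperedDistribution_eq, Lp.toTemperedDistribution_apply]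
        simp only [hφ, Complex.coe_smul]
    _ = ∫ v, 𝓕 φ v • f v := by
        rw [TemperedDistribution.fourier_apply, Lp.toTemperedDistribution_apply]
        refine integral_congr_ae ?_
        filter_upwards [hf₂.coeFn_toLp] with v hv using by rw [hv]
    _ = ∫ w, φ w • 𝓕 f w := by
        rw [SchwartzMap.fourier_coe]
        exact (VectorFourier.integral_fourierIntegral_smul_eq_flip Real.continuous_fourierChar
          continuous_inner φ.integrable hf₁).trans
            (by simp only [flip_innerₗ]; rfl)
    _ = ∫ w, g w • 𝓕 f w := by simp only [hφ, Complex.coe_smul]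

theorem lintegral_enorm_fourier_sq {f : V → F} (hf₁ : Integrable f) (hf₂ : MemLp f 2) :
    ∫⁻ w, ‖𝓕 f w‖ₑ ^ 2 = ∫⁻ v, ‖f v‖ₑ ^ 2 := by
  have hsq (g : V → F) : ∫⁻ v, ‖g v‖ₑ ^ 2 = eLpNorm g 2 volume ^ 2 := by
    simpa using (eLpNorm_nnreal_pow_eq_lintegral (f := g) (p := 2) two_ne_zero).symm
  rw [hsq, hsq, ← eLpNorm_congr_ae (fourier_toLp_ae_eq hf₁ hf₂),
    ← eLpNorm_congr_ae hf₂.coeFn_toLp, ← Lp.enorm_def, ← Lp.enorm_def, ← ofReal_norm,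
    Lp.norm_fourier_eq, ofReal_norm]

end Plancherel

section Oscillatory

variable {X : Type*} [MeasurableSpace X] {μ : Measure X}

theorem rpow_half_sq (x : ℝ≥0∞) : (x ^ (1 / 2 : ℝ)) ^ 2 = x := by
  rw [← ENNReal.rpow_natCast, ← ENNReal.rpow_mul]; norm_num

theorem sq_lintegral_mul_le {f g : X → ℝ≥0∞} (hf : AEMeasurable f μ) (hg : AEMeasurable g μ) :
    (∫⁻ z, f z * g z ∂μ) ^ 2 ≤ (∫⁻ z, f z ^ 2 ∂μ) * ∫⁻ z, g z ^ 2 ∂μ := by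
  calc (∫⁻ z, f z * g z ∂μ) ^ 2
      ≤ ((∫⁻ z, f z ^ (2 : ℝ) ∂μ) ^ (1 / 2 : ℝ) * (∫⁻ z, g z ^ (2 : ℝ) ∂μ) ^ (1 / 2 : ℝ)) ^ 2 := by
        gcongr
        exact ENNReal.lintegral_mul_le_Lp_mul_Lq μ .two_two hf hg
    _ = _ := by simp only [mul_pow, rpow_half_sq, ENNReal.rpow_two]

theorem sq_lintegral_mul_le_of_weight {f g w : X → ℝ≥0∞} (hf : AEMeasurable f μ)
    (hg : AEMeasurable g μ) (hw : AEMeasurable w μ) (hw₀ : ∀ᵐ z ∂μ, w z ≠ 0)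
    (hw_top : ∀ᵐ z ∂μ, w z ≠ ∞) :
    (∫⁻ z, f z * g z ∂μ) ^ 2 ≤ (∫⁻ z, f z ^ 2 / w z ∂μ) * ∫⁻ z, w z * g z ^ 2 ∂μ := by
  calc (∫⁻ z, f z * g z ∂μ) ^ 2
      = (∫⁻ z, f z / w z ^ (1 / 2 : ℝ) * (w z ^ (1 / 2 : ℝ) * g z) ∂μ) ^ 2 := by
        congr 1
        refine lintegral_congr_ae ?_
        filter_upwards [hw₀, hw_top] with z h₀ h_top
        rw [← mul_assoc, ENNReal.div_mul_cancel (by simp [h₀, h_top]) (by simp [h₀, h_top])]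
    _ ≤ (∫⁻ z, (f z / w z ^ (1 / 2 : ℝ)) ^ 2 ∂μ) * ∫⁻ z, (w z ^ (1 / 2 : ℝ) * g z) ^ 2 ∂μ :=
        sq_lintegral_mul_le (by fun_prop) (by fun_prop)
    _ = _ := by
        simp only [div_eq_mul_inv (_ : ℝ≥0∞), mul_pow, ← ENNReal.inv_pow, rpow_half_sq]

variable {V : Type*} [NormedAddCommGroup V] [InnerProductSpace ℝ V]

/-- The oscillatory integral `p ↦ ∫ e^{i⟨p, Φ(z)⟩} h(z) dμ(z)`, i.e. the Fourier extension
operator of the set parametrized by `Φ`, with the measure `μ` living on the parameter space. -/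
def oscInt (μ : Measure X) (Φ : X → V) (h : X → ℂ) (p : V) : ℂ :=
  ∫ z, Complex.exp (Complex.I * (inner ℝ p (Φ z) : ℝ)) * h z ∂μ

theorem enorm_exp_I_mul_ofReal (x : ℝ) : ‖Complex.exp (Complex.I * (x : ℂ))‖ₑ = 1 := by
  rw [← ofReal_norm, Complex.norm_exp_I_mul_ofReal, ENNReal.ofReal_one]

theorem enorm_oscInt_le (Φ : X → V) (h : X → ℂ) (p : V) :
    ‖oscInt μ Φ h p‖ₑ ≤ ∫⁻ z, ‖h z‖ₑ ∂μ := by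
  refine (enorm_integral_le_lintegral_enorm _).trans_eq (lintegral_congr fun z => ?_)
  rw [enorm_mul, enorm_exp_I_mul_ofReal, one_mul]

theorem oscInt_congr {Φ : X → V} {h₁ h₂ : X → ℂ} (h : h₁ =ᵐ[μ] h₂) :
    oscInt μ Φ h₁ = oscInt μ Φ h₂ :=
  funext fun _ => integral_congr_ae (h.mono fun z hz => by simp only [hz])

variable [FiniteDimensional ℝ V] [MeasurableSpace V] [BorelSpace V] {Φ : X → V}

theorem integrable_exp_mul (hΦ : Measurable Φ) {h : X → ℂ} (hh : Integrable h μ) (p : V) :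
    Integrable (fun z => Complex.exp (Complex.I * (inner ℝ p (Φ z) : ℝ)) * h z) μ :=
  hh.bdd_mul (c := 1) (Measurable.aestronglyMeasurable (by fun_prop))
    (ae_of_all _ fun _ => (Complex.norm_exp_I_mul_ofReal _).le)

theorem continuous_oscInt (hΦ : Measurable Φ) {h : X → ℂ} (hh : Integrable h μ) :
    Continuous (oscInt μ Φ h) :=
  continuous_of_dominated (bound := fun z => ‖h z‖)
    (fun p => (integrable_exp_mul hΦ hh p).aestronglyMeasurable)
    (fun p => ae_of_all _ fun z => by rw [norm_mul, Complex.norm_exp_I_mul_ofReal, one_mul])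
    hh.norm (ae_of_all _ fun z => by fun_prop)

theorem oscInt_add (hΦ : Measurable Φ) {h₁ h₂ : X → ℂ} (hh₁ : Integrable h₁ μ)
    (hh₂ : Integrable h₂ μ) : oscInt μ Φ (h₁ + h₂) = oscInt μ Φ h₁ + oscInt μ Φ h₂ := by
  funext p
  simp only [oscInt, Pi.add_apply, mul_add]
  exact integral_add (integrable_exp_mul hΦ hh₁ p) (integrable_exp_mul hΦ hh₂ p)

/-- The parametrization `Φ` maps `J dμ` to a measure dominated by Lebesgue measure on `V`; for an
injective `Φ` the Jacobian determinant is such a weight `J`. -/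
structure IsDominatedParam (μ : Measure X) (Φ : X → V) (J : X → ℝ) : Prop where
  measurable : Measurable Φ
  measurable_weight : Measurable J
  weight_pos : ∀ᵐ z ∂μ, 0 < J z
  map_withDensity_le : (μ.withDensity fun z => ENNReal.ofReal (J z)).map Φ ≤ volume

variable {J : X → ℝ}

theorem IsDominatedParam.lintegral_le (H : IsDominatedParam μ Φ J) {G : V → ℝ≥0∞}
    (hG : Measurable G) : ∫⁻ z, ENNReal.ofReal (J z) * G (Φ z) ∂μ ≤ ∫⁻ y, G y := by
  calc ∫⁻ z, ENNReal.ofReal (J z) * G (Φ z) ∂μ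
      = ∫⁻ y, G y ∂(μ.withDensity fun z => ENNReal.ofReal (J z)).map Φ := by
        rw [lintegral_map hG H.measurable]
        exact (lintegral_withDensity_eq_lintegral_mul _ H.measurable_weight.ennreal_ofReal
          (hG.comp H.measurable)).symm
    _ ≤ ∫⁻ y, G y := lintegral_mono' H.map_withDensity_le le_rfl

theorem integral_oscInt_mul [SFinite μ] (hΦ : Measurable Φ) {h : X → ℂ} (hh : Integrable h μ)
    {φ : V → ℂ} (hφ : Integrable φ) :
    ∫ p, oscInt μ Φ h p * φ p = ∫ z, h z * 𝓕 φ (-(2 * Real.pi)⁻¹ • Φ z) ∂μ := by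
  have hint : Integrable (Function.uncurry fun (p : V) (z : X) =>
      Complex.exp (Complex.I * (inner ℝ p (Φ z) : ℝ)) * h z * φ p) (volume.prod μ) := by
    refine (((hφ.mul_prod hh).bdd_mul (c := 1) (f := fun q : V × X =>
      Complex.exp (Complex.I * (inner ℝ q.1 (Φ q.2) : ℝ)))
      (Measurable.aestronglyMeasurable (by fun_prop))
      (ae_of_all _ fun _ => (Complex.norm_exp_I_mul_ofReal _).le))).congr
      (ae_of_all _ fun q => ?_)
    simp only [Function.uncurry]
    ring
  simp only [oscInt, ← integral_mul_const]
  rw [integral_integral_swap hint]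
  refine integral_congr_ae (ae_of_all _ fun z => ?_)
  simp only [Real.fourier_eq', ← integral_const_mul, smul_eq_mul]
  refine integral_congr_ae (ae_of_all _ fun p => ?_)
  have hphase : Complex.exp (Complex.I * (inner ℝ p (Φ z) : ℝ)) =
      Complex.exp (((-2 * Real.pi * inner ℝ p (-(2 * Real.pi)⁻¹ • Φ z) : ℝ) : ℂ) * Complex.I) := by
    rw [inner_smul_right, mul_comm Complex.I]
    congr 3
    field_simp
  simp only [hphase]
  ring

theorem lintegral_comp_smul {G : V → ℝ≥0∞} (hG : Measurable G) {r : ℝ} (hr : r ≠ 0) :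
    ∫⁻ y, G (r • y) = ENNReal.ofReal |(r ^ Module.finrank ℝ V)⁻¹| * ∫⁻ y, G y := by
  rw [← lintegral_map hG (measurable_const_smul r), Measure.map_addHaar_smul _ hr,
    lintegral_smul_measure, smul_eq_mul]

theorem enorm_integral_oscInt_mul_sq_le [SFinite μ] (H : IsDominatedParam μ Φ J) {h : X → ℂ}
    (hh : Integrable h μ) {φ : V → ℂ} (hφ₁ : Integrable φ) (hφ₂ : MemLp φ 2) :
    ‖∫ p, oscInt μ Φ h p * φ p‖ₑ ^ 2 ≤
      ENNReal.ofReal ((2 * Real.pi) ^ Module.finrank ℝ V) *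
        (∫⁻ z, ‖h z‖ₑ ^ 2 / ENNReal.ofReal (J z) ∂μ) * ∫⁻ p, ‖φ p‖ₑ ^ 2 := by
  set ψ : V → ℂ := fun y => 𝓕 φ (-(2 * Real.pi)⁻¹ • y)
  have hφm : Measurable (𝓕 φ) := (VectorFourier.fourierIntegral_continuous
    Real.continuous_fourierChar continuous_inner hφ₁).measurable
  have hψm : Measurable ψ := hφm.comp (measurable_const_smul _)
  have hψ : ∫⁻ y, ‖ψ y‖ₑ ^ 2 =
      ENNReal.ofReal ((2 * Real.pi) ^ Module.finrank ℝ V) * ∫⁻ p, ‖φ p‖ₑ ^ 2 := by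
    rw [lintegral_comp_smul (G := fun w => ‖𝓕 φ w‖ₑ ^ 2) (by fun_prop)
      (neg_ne_zero.2 (by positivity)), lintegral_enorm_fourier_sq hφ₁ hφ₂, abs_inv, abs_pow,
      abs_neg, abs_of_pos (by positivity), inv_pow, inv_inv]
  calc ‖∫ p, oscInt μ Φ h p * φ p‖ₑ ^ 2
      ≤ (∫⁻ z, ‖h z‖ₑ * ‖ψ (Φ z)‖ₑ ∂μ) ^ 2 := by
        rw [integral_oscInt_mul H.measurable hh hφ₁]
        gcongr
        exact (enorm_integral_le_lintegral_enorm _).trans_eq (by simp only [enorm_mul, ψ])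
    _ ≤ (∫⁻ z, ‖h z‖ₑ ^ 2 / ENNReal.ofReal (J z) ∂μ) *
        ∫⁻ z, ENNReal.ofReal (J z) * ‖ψ (Φ z)‖ₑ ^ 2 ∂μ :=
        sq_lintegral_mul_le_of_weight hh.aestronglyMeasurable.enorm
          (hψm.comp H.measurable).enorm.aemeasurable
          H.measurable_weight.ennreal_ofReal.aemeasurable
          (H.weight_pos.mono fun z hz => by simpa using hz) (ae_of_all _ fun _ => by simp)
    _ ≤ (∫⁻ z, ‖h z‖ₑ ^ 2 / ENNReal.ofReal (J z) ∂μ) * ∫⁻ y, ‖ψ y‖ₑ ^ 2 := by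
        gcongr
        exact H.lintegral_le (G := fun y => ‖ψ y‖ₑ ^ 2) (by fun_prop)
    _ = _ := by rw [hψ]; ring

theorem lintegral_enorm_sq_le_of_forall_integral_mul {G : V → ℂ} (hG : Continuous G) {B : ℝ≥0∞}
    (hB : ∀ φ : V → ℂ, Integrable φ → MemLp φ 2 →
      ‖∫ p, G p * φ p‖ₑ ^ 2 ≤ B * ∫⁻ p, ‖φ p‖ₑ ^ 2) :
    ∫⁻ p, ‖G p‖ₑ ^ 2 ≤ B := by
  have hball (r : ℝ) : ∫⁻ p in Metric.closedBall 0 r, ‖G p‖ₑ ^ 2 ≤ B := by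
    set S := Metric.closedBall (0 : V) r
    have hS : MeasurableSet S := measurableSet_closedBall
    have hSc : IsCompact S := isCompact_closedBall 0 r
    let φ : V → ℂ := S.indicator fun p => (starRingEnd ℂ) (G p)
    obtain ⟨C, hC⟩ := hSc.exists_bound_of_continuousOn (hG.star).continuousOn
    have hφ_mem (q : ℝ≥0∞) : MemLp φ q := by
      rw [memLp_indicator_iff_restrict hS]
      have : IsFiniteMeasure (volume.restrict S) := ⟨by simpa using hSc.measure_lt_top⟩
      exact MemLp.of_bound hG.star.aestronglyMeasurable C (ae_restrict_of_forall_mem hS hC)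
    have hφ_sq : ∫⁻ p, ‖φ p‖ₑ ^ 2 = ∫⁻ p in S, ‖G p‖ₑ ^ 2 := by
      rw [← lintegral_indicator hS]
      congr 1 with p
      by_cases hp : p ∈ S <;> simp [φ, hp]
    have hGφ : ‖∫ p, G p * φ p‖ₑ = ∫⁻ p in S, ‖G p‖ₑ ^ 2 := by
      have hre : ∀ p, G p * φ p = ((S.indicator (fun p => ‖G p‖ ^ 2) p : ℝ) : ℂ) := fun p => by
        by_cases hp : p ∈ S <;> simp [φ, hp, Complex.mul_conj']
      have hint : IntegrableOn (fun p => ‖G p‖ ^ 2) S :=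
        (hG.norm.pow 2).continuousOn.integrableOn_compact hSc
      simp only [hre]
      rw [integral_complex_ofReal, integral_indicator hS, ← ofReal_norm, Complex.norm_real,
        Real.norm_of_nonneg (integral_nonneg fun _ => by positivity),
        ofReal_integral_eq_lintegral_ofReal hint (ae_of_all _ fun _ => by positivity)]
      simp only [ENNReal.ofReal_pow (norm_nonneg _), ofReal_norm]
    have hsq := hB φ (memLp_one_iff_integrable.1 (hφ_mem 1)) (hφ_mem 2)
    rw [hφ_sq, hGφ, sq] at hsq
    rcases eq_or_ne (∫⁻ p in S, ‖G p‖ₑ ^ 2) 0 with h0 | h0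
    · simp [h0]
    · exact (ENNReal.mul_le_mul_iff_left h0 (by rw [← hGφ]; exact enorm_ne_top)).1 hsq
  exact le_of_tendsto' ((aecover_closedBall tendsto_id).lintegral_tendsto_of_countably_generated
    (by fun_prop)) hball

/-- Tested against `φ`, the oscillatory integral becomes an integral of `h` against `𝓕 φ ∘ Φ`, so
the inequality is dual to Plancherel's theorem for `φ`. -/
theorem lintegral_oscInt_sq_le [SFinite μ] (H : IsDominatedParam μ Φ J) {h : X → ℂ}
    (hh : Integrable h μ) :
    ∫⁻ p, ‖oscInt μ Φ h p‖ₑ ^ 2 ≤ ENNReal.ofReal ((2 * Real.pi) ^ Module.finrank ℝ V) *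
      ∫⁻ z, ‖h z‖ₑ ^ 2 / ENNReal.ofReal (J z) ∂μ :=
  lintegral_enorm_sq_le_of_forall_integral_mul (continuous_oscInt H.measurable hh)
    fun _ => enorm_integral_oscInt_mul_sq_le H hh

end Oscillatory

section Interpolation

variable {X : Type*} [MeasurableSpace X] {μ : Measure X}

variable {V : Type*} [NormedAddCommGroup V] [InnerProductSpace ℝ V]

theorem oscInt_restrict_indicator_of_subset (Φ : X → V) (h : X → ℂ) {Q E : Set X}
    (hQ : MeasurableSet Q) (hQE : Q ⊆ E) :
    oscInt (μ.restrict Q) Φ (E.indicator h) = oscInt (μ.restrict Q) Φ h :=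
  oscInt_congr ((ae_restrict_mem hQ).mono fun _ hz => Set.indicator_of_mem (hQE hz) h)

theorem oscInt_restrict_indicator_of_disjoint (Φ : X → V) (h : X → ℂ) {Q E : Set X}
    (hQ : MeasurableSet Q) (hQE : Disjoint Q E) :
    oscInt (μ.restrict Q) Φ (E.indicator h) = 0 := by
  rw [oscInt_congr (h₂ := 0) ((ae_restrict_mem hQ).mono fun _ hz =>
    Set.indicator_of_notMem (Set.disjoint_left.1 hQE hz) h)]
  funext p
  simp [oscInt]

theorem oscInt_eq_zero_of_lintegral_sq_div_eq_zero (Φ : X → V) {h : X → ℂ} {J : X → ℝ}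
    (hh : AEStronglyMeasurable h μ) (hJ : Measurable J)
    (h0 : ∫⁻ z, ‖h z‖ₑ ^ 2 / ENNReal.ofReal (J z) ∂μ = 0) : oscInt μ Φ h = 0 := by
  have hh₀ : h =ᵐ[μ] 0 := by
    rw [lintegral_eq_zero_iff' (by fun_prop)] at h0
    filter_upwards [h0] with z hz using by simpa using hz
  rw [oscInt_congr hh₀]
  funext p
  simp [oscInt]

variable [FiniteDimensional ℝ V] [MeasurableSpace V] [BorelSpace V]
  {Φ : X → V} {J : X → ℝ} {h : X → ℂ}

theorem IsDominatedParam.aemeasurable_sq_div (H : IsDominatedParam μ Φ J) (hh : Integrable h μ) :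
    AEMeasurable (fun z => ‖h z‖ₑ ^ 2 / ENNReal.ofReal (J z)) μ :=
  (hh.aestronglyMeasurable.enorm.pow_const 2).div H.measurable_weight.ennreal_ofReal.aemeasurable

theorem enorm_oscInt_restrict_le (H : IsDominatedParam μ Φ J) (hh : Integrable h μ) {Q : Set X}
    {p : V} {a b c : ℝ} (ha : 0 ≤ a) (hb : 0 ≤ b)
    (hQa : ‖oscInt (μ.restrict Q) Φ h p‖ₑ ≤ ENNReal.ofReal a)
    (hQb : ∫⁻ z in Q, ‖h z‖ₑ ^ 2 / ENNReal.ofReal (J z) ∂μ ≤ ENNReal.ofReal b)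
    (hc : √(a / b) ≤ c) :
    ‖oscInt (μ.restrict Q) Φ h p‖ₑ ≤ ENNReal.ofReal c * ENNReal.ofReal (√(a * b)) := by
  rcases hb.eq_or_lt with rfl | hb₀
  · have h0 : oscInt (μ.restrict Q) Φ h = 0 :=
      oscInt_eq_zero_of_lintegral_sq_div_eq_zero Φ hh.aestronglyMeasurable.restrict
        H.measurable_weight (by simpa using hQb)
    simp [h0]
  · rw [← ENNReal.ofReal_mul ((Real.sqrt_nonneg _).trans hc)]
    refine hQa.trans (ENNReal.ofReal_le_ofReal ?_)
    calc a = √(a / b) * √(a * b) := by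
          rw [← Real.sqrt_mul (by positivity), show a / b * (a * b) = a ^ 2 by field_simp,
            Real.sqrt_sq ha]
      _ ≤ c * √(a * b) := by gcongr

variable {ι : Type*} [Countable ι] {Q : ι → Set X}

theorem lintegral_eq_tsum_of_ae_mem_iUnion (hQm : ∀ i, MeasurableSet (Q i))
    (hQd : Pairwise (Function.onFun Disjoint Q)) (hQ : ∀ᵐ z ∂μ, z ∈ ⋃ i, Q i) (f : X → ℝ≥0∞) :
    ∫⁻ z, f z ∂μ = ∑' i, ∫⁻ z in Q i, f z ∂μ := by
  rw [← lintegral_iUnion hQm hQd, Measure.restrict_eq_self_of_ae_mem hQ]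

theorem enorm_oscInt_le_tsum (hΦ : Measurable Φ) (hh : Integrable h μ)
    (hQm : ∀ i, MeasurableSet (Q i)) (hQd : Pairwise (Function.onFun Disjoint Q))
    (hQ : ∀ᵐ z ∂μ, z ∈ ⋃ i, Q i) (p : V) :
    ‖oscInt μ Φ h p‖ₑ ≤ ∑' i, ‖oscInt (μ.restrict (Q i)) Φ h p‖ₑ := by
  have hsum : oscInt μ Φ h p = ∑' i, oscInt (μ.restrict (Q i)) Φ h p := by
    unfold oscInt
    rw [← integral_iUnion hQm hQd (integrable_exp_mul hΦ hh p).integrableOn,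
      Measure.restrict_eq_self_of_ae_mem hQ]
  exact hsum ▸ enorm_tsum_le_tsum_enorm

variable [SFinite μ]

theorem lintegral_rpow_le_of_meas_lt_le {Y : Type*} [MeasurableSpace Y] {ν : Measure Y}
    {f : Y → ℝ} (hf : AEMeasurable f ν) (hf₀ : 0 ≤ f) {Λ : X → ℝ} (hΛ : Measurable Λ)
    {D : X → ℝ≥0∞} (hD : AEMeasurable D μ) {p : ℝ} (hp : 0 < p)
    (hmeas : ∀ t, 0 < t →
      ν {y | t < f y} * ENNReal.ofReal (t ^ (p - 1)) ≤ ∫⁻ z in {z | t ≤ Λ z}, D z ∂μ) :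
    ∫⁻ y, ENNReal.ofReal (f y ^ p) ∂ν ≤
      ENNReal.ofReal p * ∫⁻ z, ENNReal.ofReal (Λ z) * D z ∂μ := by
  have hsub (t : ℝ) : MeasurableSet {z | t ≤ Λ z} := measurableSet_le measurable_const hΛ
  have hmeas₂ : AEMeasurable (Function.uncurry fun (t : ℝ) z => {z | t ≤ Λ z}.indicator D z)
      ((volume.restrict (Set.Ioi 0)).prod μ) :=
    (hD.comp_snd.indicator (measurableSet_le measurable_fst (hΛ.comp measurable_snd)) :)
  have hslice (z : X) : ∫⁻ t in Set.Ioi 0, {z | t ≤ Λ z}.indicator D z =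
      ENNReal.ofReal (Λ z) * D z := by
    change ∫⁻ t in Set.Ioi 0, (Set.Iic (Λ z)).indicator (fun _ => D z) t = _
    rw [lintegral_indicator_const measurableSet_Iic, Measure.restrict_apply measurableSet_Iic,
      Set.Iic_inter_Ioi, Real.volume_Ioc, sub_zero, mul_comm]
  rw [lintegral_rpow_eq_lintegral_meas_lt_mul ν (ae_of_all _ hf₀) hf hp]
  gcongr
  calc ∫⁻ t in Set.Ioi 0, ν {y | t < f y} * ENNReal.ofReal (t ^ (p - 1))
      ≤ ∫⁻ t in Set.Ioi 0, ∫⁻ z, {z | t ≤ Λ z}.indicator D z ∂μ :=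
        setLIntegral_mono' measurableSet_Ioi fun t ht =>
          (hmeas t ht).trans_eq (lintegral_indicator (hsub t) D).symm
    _ = ∫⁻ z, ENNReal.ofReal (Λ z) * D z ∂μ := by
        rw [lintegral_lintegral_swap hmeas₂]
        exact lintegral_congr hslice

theorem meas_lt_norm_oscInt_mul_le (H : IsDominatedParam μ Φ J) (hh : Integrable h μ) {E : Set X}
    (hE : MeasurableSet E) {t : ℝ} (ht : 0 < t)
    (hsmall : ∀ p, ‖oscInt μ Φ (E.indicator h) p‖ₑ ≤ ENNReal.ofReal (t / 2)) :
    volume {p | t < ‖oscInt μ Φ h p‖} * ENNReal.ofReal (t ^ 2) ≤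
      ∫⁻ z in Eᶜ, ENNReal.ofReal (4 * (2 * Real.pi) ^ Module.finrank ℝ V) *
        (‖h z‖ₑ ^ 2 / ENNReal.ofReal (J z)) ∂μ := by
  set k : X → ℂ := Eᶜ.indicator h
  have hk : Integrable k μ := hh.indicator hE.compl
  have hk_int : ∫⁻ z, ‖k z‖ₑ ^ 2 / ENNReal.ofReal (J z) ∂μ =
      ∫⁻ z in Eᶜ, ‖h z‖ₑ ^ 2 / ENNReal.ofReal (J z) ∂μ := by
    rw [← lintegral_indicator hE.compl]
    congr 1 with z
    by_cases hz : z ∈ E <;> simp [k, hz]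
  have hsplit : oscInt μ Φ h = oscInt μ Φ (E.indicator h) + oscInt μ Φ k := by
    rw [← oscInt_add H.measurable (hh.indicator hE) hk, Set.indicator_self_add_compl]
  have hlarge : {p | t < ‖oscInt μ Φ h p‖} ⊆
      {p | ENNReal.ofReal ((t / 2) ^ 2) ≤ ‖oscInt μ Φ k p‖ₑ ^ 2} := fun p hp => by
    have hsmall' := hsmall p
    rw [← ofReal_norm, ENNReal.ofReal_le_ofReal_iff (by positivity)] at hsmall'
    rw [Set.mem_ofPred_eq, hsplit] at hp
    have hp' : t / 2 ≤ ‖oscInt μ Φ k p‖ := by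
      linarith [hp.trans_le (norm_add_le (oscInt μ Φ (E.indicator h) p) (oscInt μ Φ k p))]
    rw [Set.mem_ofPred_eq, ← ofReal_norm, ← ENNReal.ofReal_pow (norm_nonneg _)]
    gcongr
  calc volume {p | t < ‖oscInt μ Φ h p‖} * ENNReal.ofReal (t ^ 2)
      ≤ volume {p | ENNReal.ofReal ((t / 2) ^ 2) ≤ ‖oscInt μ Φ k p‖ₑ ^ 2} *
          ENNReal.ofReal (t ^ 2) := by gcongr
    _ = 4 * (ENNReal.ofReal ((t / 2) ^ 2) *
          volume {p | ENNReal.ofReal ((t / 2) ^ 2) ≤ ‖oscInt μ Φ k p‖ₑ ^ 2}) := by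
        rw [show t ^ 2 = 4 * (t / 2) ^ 2 by ring, ENNReal.ofReal_mul (by norm_num)]
        norm_num
        ring
    _ ≤ 4 * ∫⁻ p, ‖oscInt μ Φ k p‖ₑ ^ 2 := by
        gcongr
        exact mul_meas_ge_le_lintegral₀
          ((continuous_oscInt H.measurable hk).measurable.enorm.pow_const 2).aemeasurable _
    _ ≤ _ := by
        rw [lintegral_const_mul' _ _ ENNReal.ofReal_ne_top, ← hk_int,
          ENNReal.ofReal_mul (by norm_num), ENNReal.ofReal_ofNat, mul_assoc]
        gcongr
        exact lintegral_oscInt_sq_le H hk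

/-- Interpolation between the trivial `L^∞` bound and the `L²` bound, in the layer-cake formula for
the `L³` norm: at height `t` only the part of `h` on `{t ≤ Λ}` matters. -/
theorem lintegral_oscInt_cube_le (H : IsDominatedParam μ Φ J) (hh : Integrable h μ)
    {Λ : X → ℝ} (hΛ : Measurable Λ)
    (hsmall : ∀ t, 0 < t → ∀ p,
      ‖oscInt μ Φ ({z | Λ z < t}.indicator h) p‖ₑ ≤ ENNReal.ofReal (t / 2)) :
    ∫⁻ p, ‖oscInt μ Φ h p‖ₑ ^ 3 ≤
      ENNReal.ofReal (12 * (2 * Real.pi) ^ Module.finrank ℝ V) *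
        ∫⁻ z, ENNReal.ofReal (Λ z) * (‖h z‖ₑ ^ 2 / ENNReal.ofReal (J z)) ∂μ := by
  set K : ℝ := (2 * Real.pi) ^ Module.finrank ℝ V
  have hlevel (t : ℝ) (ht : 0 < t) : volume {p | t < ‖oscInt μ Φ h p‖} *
      ENNReal.ofReal (t ^ ((3 : ℝ) - 1)) ≤ ∫⁻ z in {z | t ≤ Λ z}, ENNReal.ofReal (4 * K) *
        (‖h z‖ₑ ^ 2 / ENNReal.ofReal (J z)) ∂μ := by
    have hcompl : {z | t ≤ Λ z} = {z | Λ z < t}ᶜ := by ext; simp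
    rw [hcompl, show (3 : ℝ) - 1 = (2 : ℕ) by norm_num, Real.rpow_natCast]
    exact meas_lt_norm_oscInt_mul_le H hh (measurableSet_lt hΛ measurable_const) ht (hsmall t ht)
  calc ∫⁻ p, ‖oscInt μ Φ h p‖ₑ ^ 3
      = ∫⁻ p, ENNReal.ofReal (‖oscInt μ Φ h p‖ ^ (3 : ℝ)) := by
        refine lintegral_congr fun p => ?_
        rw [← ofReal_norm, ← ENNReal.ofReal_pow (norm_nonneg _)]
        norm_cast
    _ ≤ ENNReal.ofReal 3 * ∫⁻ z, ENNReal.ofReal (Λ z) * (ENNReal.ofReal (4 * K) *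
          (‖h z‖ₑ ^ 2 / ENNReal.ofReal (J z))) ∂μ :=
        lintegral_rpow_le_of_meas_lt_le
          (continuous_oscInt H.measurable hh).norm.measurable.aemeasurable
          (fun _ => norm_nonneg _) hΛ ((H.aemeasurable_sq_div hh).const_mul _) (by norm_num) hlevel
    _ = _ := by
        simp only [mul_left_comm _ (ENNReal.ofReal (4 * K))]
        rw [lintegral_const_mul' _ _ ENNReal.ofReal_ne_top, ← mul_assoc,
          ← ENNReal.ofReal_mul (by norm_num)]
        ring_nf

theorem sqrt_div_sqrt_mul_sq_div {x y : ℝ} (hx : 0 ≤ x) (hy : 0 ≤ y) :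
    √y / √x * (x ^ 2 / y) = x * √x / √y := by
  obtain ⟨a, ha, rfl⟩ : ∃ a, 0 ≤ a ∧ x = a ^ 2 := ⟨√x, by positivity, (Real.sq_sqrt hx).symm⟩
  obtain ⟨b, hb, rfl⟩ : ∃ b, 0 ≤ b ∧ y = b ^ 2 := ⟨√y, by positivity, (Real.sq_sqrt hy).symm⟩
  rw [Real.sqrt_sq ha, Real.sqrt_sq hb]
  rcases eq_or_ne a 0 with rfl | ha₀ <;> rcases eq_or_ne b 0 with rfl | hb₀ <;> field_simp

theorem le_mul_of_sqrt_div_sqrt_le {x y c : ℝ} (hx : 0 ≤ x) (hy : 0 < y) (h : √y / √x ≤ c) :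
    x ≤ c * (x * √x / √y) := by
  rcases hx.eq_or_lt with rfl | hx₀
  · simp
  have := Real.sqrt_pos.2 hx₀
  have := Real.sqrt_pos.2 hy
  calc x = √y / √x * (x * √x / √y) := by field_simp
    _ ≤ c * (x * √x / √y) := by gcongr

/-- The weighted Hausdorff–Young inequality from `L^{3/2}` to `L³`. -/
theorem lintegral_oscInt_cube_le_hausdorffYoung (H : IsDominatedParam μ Φ J) (hh : Integrable h μ)
    (hm : Measurable h) {N : ℝ} (hN : 0 < N)
    (hhN : ∫⁻ z, ENNReal.ofReal (‖h z‖ * √‖h z‖ / √(J z)) ∂μ ≤ ENNReal.ofReal N) :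
    ∫⁻ p, ‖oscInt μ Φ h p‖ₑ ^ 3 ≤
      ENNReal.ofReal (24 * (2 * Real.pi) ^ Module.finrank ℝ V * N ^ 2) := by
  have hJm := H.measurable_weight
  set Λ : X → ℝ := fun z => 2 * N * (√(J z) / √‖h z‖)
  have hsmall (t : ℝ) (ht : 0 < t) (p : V) :
      ‖oscInt μ Φ ({z | Λ z < t}.indicator h) p‖ₑ ≤ ENNReal.ofReal (t / 2) := by
    have hpt : ∀ᵐ z ∂μ, ‖({z | Λ z < t}.indicator h) z‖ₑ ≤
        ENNReal.ofReal (t / (2 * N)) * ENNReal.ofReal (‖h z‖ * √‖h z‖ / √(J z)) := by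
      filter_upwards [H.weight_pos] with z hz
      by_cases hzt : z ∈ {z | Λ z < t}
      · rw [Set.indicator_of_mem hzt, ← ofReal_norm, ← ENNReal.ofReal_mul (by positivity)]
        exact ENNReal.ofReal_le_ofReal (le_mul_of_sqrt_div_sqrt_le (norm_nonneg _) hz
          ((le_div_iff₀' (by positivity)).2 (le_of_lt hzt)))
      · simp [hzt]
    calc ‖oscInt μ Φ ({z | Λ z < t}.indicator h) p‖ₑ
        ≤ ∫⁻ z, ENNReal.ofReal (t / (2 * N)) *
            ENNReal.ofReal (‖h z‖ * √‖h z‖ / √(J z)) ∂μ :=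
          (enorm_oscInt_le _ _ p).trans (lintegral_mono_ae hpt)
      _ ≤ ENNReal.ofReal (t / (2 * N)) * ENNReal.ofReal N := by
          rw [lintegral_const_mul' _ _ ENNReal.ofReal_ne_top]
          gcongr
      _ = ENNReal.ofReal (t / 2) := by
          rw [← ENNReal.ofReal_mul (by positivity)]
          congr 1
          field_simp
  have hweight : ∀ᵐ z ∂μ, ENNReal.ofReal (Λ z) * (‖h z‖ₑ ^ 2 / ENNReal.ofReal (J z)) =
      ENNReal.ofReal (2 * N) * ENNReal.ofReal (‖h z‖ * √‖h z‖ / √(J z)) := by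
    filter_upwards [H.weight_pos] with z hz
    rw [← ofReal_norm, ← ENNReal.ofReal_pow (norm_nonneg _), ← ENNReal.ofReal_div_of_pos hz,
      ← ENNReal.ofReal_mul (by positivity), ← ENNReal.ofReal_mul (by positivity), mul_assoc,
      sqrt_div_sqrt_mul_sq_div (norm_nonneg _) hz.le]
  refine (lintegral_oscInt_cube_le H hh (by fun_prop) hsmall).trans ?_
  rw [lintegral_congr_ae hweight, lintegral_const_mul' _ _ ENNReal.ofReal_ne_top]
  grw [hhN]
  rw [← ENNReal.ofReal_mul (by positivity), ← ENNReal.ofReal_mul (by positivity)]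
  ring_nf
  exact le_rfl

theorem sqrt_div_mul_self {a b : ℝ} (hb : 0 ≤ b) : √(a / b) * b = √(a * b) := by
  rw [Real.sqrt_div' a hb, Real.sqrt_mul' a hb]
  rcases hb.eq_or_lt with rfl | hb₀
  · simp
  · have := Real.sq_sqrt hb
    field_simp
    rw [this]

/-- Pieces whose oscillatory integrals are bounded by `a` and whose weighted `L²` norms squared are
bounded by `b` contribute to `∫ |oscInt|³` as if they were orthogonal. -/
theorem lintegral_oscInt_cube_le_partition (H : IsDominatedParam μ Φ J) (hh : Integrable h μ)
    [Nonempty ι] (hQm : ∀ i, MeasurableSet (Q i)) (hQd : Pairwise (Function.onFun Disjoint Q))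
    (hQ : ∀ᵐ z ∂μ, z ∈ ⋃ i, Q i) {a b : ι → ℝ} (ha : ∀ i, 0 ≤ a i) (hb : ∀ i, 0 ≤ b i)
    (hQa : ∀ i p, ‖oscInt (μ.restrict (Q i)) Φ h p‖ₑ ≤ ENNReal.ofReal (a i))
    (hQb : ∀ i, ∫⁻ z in Q i, ‖h z‖ₑ ^ 2 / ENNReal.ofReal (J z) ∂μ ≤ ENNReal.ofReal (b i))
    {N : ℝ} (hN : 0 < N) (hab : ∑' i, ENNReal.ofReal (√(a i * b i)) ≤ ENNReal.ofReal N) :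
    ∫⁻ p, ‖oscInt μ Φ h p‖ₑ ^ 3 ≤
      ENNReal.ofReal (24 * (2 * Real.pi) ^ Module.finrank ℝ V * N ^ 2) := by
  obtain ⟨Λ, hΛm, hΛ⟩ := exists_measurable_piecewise Q hQm (fun i _ => 2 * N * √(a i / b i))
    (fun i => measurable_const) fun i j hij z hz =>
      (Set.disjoint_left.1 (hQd hij) hz.1 hz.2).elim
  have hpiece (t : ℝ) (p : V) (i : ι) :
      ‖oscInt (μ.restrict (Q i)) Φ ({z | Λ z < t}.indicator h) p‖ₑ ≤
        ENNReal.ofReal (t / (2 * N)) * ENNReal.ofReal (√(a i * b i)) := by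
    by_cases hit : 2 * N * √(a i / b i) < t
    · have hsub : Q i ⊆ {z | Λ z < t} := fun z hz => by simpa [hΛ i hz] using hit
      rw [oscInt_restrict_indicator_of_subset Φ h (hQm i) hsub]
      exact enorm_oscInt_restrict_le H hh (ha i) (hb i) (hQa i p) (hQb i)
        ((le_div_iff₀' (by positivity)).2 hit.le)
    · have hdisj : Disjoint (Q i) {z | Λ z < t} :=
        Set.disjoint_left.2 fun z hz => by simpa [hΛ i hz] using hit
      simp [oscInt_restrict_indicator_of_disjoint Φ h (hQm i) hdisj]
  have hmean (c : ℝ) (hc : 0 ≤ c) :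
      ∑' i, ENNReal.ofReal c * ENNReal.ofReal (√(a i * b i)) ≤ ENNReal.ofReal (c * N) := by
    rw [ENNReal.tsum_mul_left, ENNReal.ofReal_mul hc]
    gcongr
  have hsmall (t : ℝ) (ht : 0 < t) (p : V) :
      ‖oscInt μ Φ ({z | Λ z < t}.indicator h) p‖ₑ ≤ ENNReal.ofReal (t / 2) := by
    refine (enorm_oscInt_le_tsum H.measurable (hh.indicator (measurableSet_lt hΛm measurable_const))
      hQm hQd hQ p).trans ((ENNReal.tsum_le_tsum (hpiece t p)).trans ?_)
    refine (hmean (t / (2 * N)) (by positivity)).trans_eq ?_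
    congr 1
    field_simp
  have hweight : ∫⁻ z, ENNReal.ofReal (Λ z) * (‖h z‖ₑ ^ 2 / ENNReal.ofReal (J z)) ∂μ ≤
      ENNReal.ofReal (2 * N * N) := by
    rw [lintegral_eq_tsum_of_ae_mem_iUnion hQm hQd hQ]
    refine (ENNReal.tsum_le_tsum fun i => ?_).trans (hmean (2 * N) (by positivity))
    rw [setLIntegral_congr_fun (hQm i) fun z hz => by rw [hΛ i hz],
      lintegral_const_mul' _ _ ENNReal.ofReal_ne_top]
    grw [hQb i]
    rw [← ENNReal.ofReal_mul (by positivity), ← ENNReal.ofReal_mul (by positivity), mul_assoc,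
      sqrt_div_mul_self (hb i)]
  grw [lintegral_oscInt_cube_le H hh hΛm hsmall, hweight, ← ENNReal.ofReal_mul (by positivity)]
  ring_nf
  exact le_rfl

end Interpolation

section Curve

/-- The weight `|ξ + ξ³|^{1/6}`. -/
def wt (ξ : ℝ) : ℝ := |ξ + ξ ^ 3| ^ (1 / 6 : ℝ)

theorem wt_nonneg (ξ : ℝ) : 0 ≤ wt ξ := Real.rpow_nonneg (abs_nonneg _) _

theorem wt_pos {ξ : ℝ} (h : 0 < ξ) : 0 < wt ξ :=
  Real.rpow_pos_of_pos (abs_pos.2 (by positivity)) _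

theorem wt_neg (ξ : ℝ) : wt (-ξ) = wt ξ := by
  unfold wt
  rw [show -ξ + (-ξ) ^ 3 = -(ξ + ξ ^ 3) by ring, abs_neg]

@[fun_prop]
theorem measurable_wt : Measurable wt := by
  unfold wt
  fun_prop

theorem wt_pow_six (ξ : ℝ) : wt ξ ^ 6 = |ξ| + |ξ| ^ 3 := by
  have habs : |ξ + ξ ^ 3| = |ξ| + |ξ| ^ 3 := by
    rw [show ξ + ξ ^ 3 = ξ * (1 + ξ ^ 2) by ring, abs_mul,
      abs_of_pos (by positivity : 0 < 1 + ξ ^ 2), ← sq_abs]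
    ring
  rw [wt, ← Real.rpow_natCast, ← Real.rpow_mul (abs_nonneg _), habs]
  norm_num

theorem wt_le_wt {ξ η : ℝ} (h : |ξ| ≤ |η|) : wt ξ ≤ wt η := by
  refine le_of_pow_le_pow_left₀ (n := 6) (by norm_num) (wt_nonneg η) ?_
  rw [wt_pow_six, wt_pow_six]
  gcongr

theorem wt_le_two_mul {ξ η : ℝ} (h : |ξ| ≤ 2 * |η|) : wt ξ ≤ 2 * wt η := by
  refine le_of_pow_le_pow_left₀ (n := 6) (by norm_num) (by positivity [wt_nonneg η]) ?_
  rw [mul_pow, wt_pow_six, wt_pow_six]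
  calc |ξ| + |ξ| ^ 3 ≤ 2 * |η| + (2 * |η|) ^ 3 := by gcongr
    _ ≤ 2 ^ 6 * (|η| + |η| ^ 3) := by nlinarith [abs_nonneg η, pow_nonneg (abs_nonneg η) 3]

/-- Space-time with its Euclidean structure. -/
abbrev Plane : Type := WithLp 2 (ℝ × ℝ)

/-- The curve of frequencies, with the coordinates in the order `(t, x)` of `extIntegral`. -/
def curve (ξ : ℝ) : Plane := WithLp.toLp 2 (ξ ^ 3 + ξ ^ 5, ξ)

@[fun_prop]
theorem measurable_curve : Measurable curve :=
  (WithLp.measurable_toLp 2 (ℝ × ℝ)).comp (by fun_prop)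

/-- The Fourier extension of the density `wt • u` on the curve. -/
def curveExt (u : ℝ → ℂ) : Plane → ℂ := oscInt volume curve fun ξ => (wt ξ : ℂ) * u ξ

theorem extIntegral_eq (f : L2) (p : ℝ × ℝ) :
    extIntegral f p = (1 / (2 * Real.pi) : ℂ) * curveExt (hat f) (WithLp.toLp 2 p) := by
  unfold extIntegral curveExt oscInt curve
  congr 2 with ξ
  simp only [wt, WithLp.prod_inner_apply, Real.inner_apply]
  rw [add_comm (p.2 * ξ)]
  ring

/-- The pairs of frequencies `0 < ξ < η`. -/
def pairs : Set (ℝ × ℝ) := {z | 0 < z.1 ∧ z.1 < z.2}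

theorem measurableSet_pairs : MeasurableSet pairs :=
  (measurableSet_lt measurable_const measurable_fst).inter
    (measurableSet_lt measurable_fst measurable_snd)

/-- The sum of two points of the curve. -/
def curveSum (z : ℝ × ℝ) : Plane := curve z.1 + curve z.2

@[fun_prop]
theorem measurable_curveSum : Measurable curveSum := by
  unfold curveSum
  fun_prop

/-- The absolute value of the Jacobian determinant of `curveSum` on `pairs`. -/
def jac (z : ℝ × ℝ) : ℝ := (z.2 - z.1) * (z.2 + z.1) * (3 + 5 * (z.1 ^ 2 + z.2 ^ 2))

@[fun_prop]
theorem measurable_jac : Measurable jac := by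
  unfold jac
  fun_prop

theorem jac_pos {z : ℝ × ℝ} (hz : z ∈ pairs) : 0 < jac z := by
  obtain ⟨h₁, h₂⟩ := hz
  exact mul_pos (mul_pos (sub_pos.2 h₂) (by linarith)) (by positivity)

theorem mul_wt_pow_six_le_jac {z : ℝ × ℝ} (hz : z ∈ pairs) :
    (z.2 - z.1) * wt z.2 ^ 6 ≤ jac z := by
  obtain ⟨h₁, h₂⟩ := hz
  have hη : 0 < z.2 := h₁.trans h₂
  rw [wt_pow_six, abs_of_pos hη, jac, mul_assoc]
  refine mul_le_mul_of_nonneg_left ?_ (sub_nonneg.2 h₂.le)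
  calc z.2 + z.2 ^ 3 ≤ z.2 * (3 + 5 * (z.1 ^ 2 + z.2 ^ 2)) := by
        nlinarith [pow_pos hη 3, mul_nonneg hη.le (sq_nonneg z.1)]
    _ ≤ (z.2 + z.1) * (3 + 5 * (z.1 ^ 2 + z.2 ^ 2)) := by
        gcongr
        linarith

/-- On a fibre of the second coordinate `ξ + η` the first one determines `ξη`. -/
theorem injOn_curveSum : Set.InjOn curveSum pairs := by
  rintro ⟨a, b⟩ ⟨ha : 0 < a, hab : a < b⟩ ⟨c, d⟩ ⟨hc : 0 < c, hcd : c < d⟩ h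
  have hsum : a + b = c + d := congrArg WithLp.snd h
  have hphase : a ^ 3 + a ^ 5 + (b ^ 3 + b ^ 5) = c ^ 3 + c ^ 5 + (d ^ 3 + d ^ 5) :=
    congrArg WithLp.fst h
  obtain rfl : d = a + b - c := by linarith
  have hfactor : (a + b) * (a * b - c * (a + b - c)) *
      (3 + 5 * ((a + b) ^ 2 - a * b - c * (a + b - c))) =
        0 := by
    linear_combination (-1) * hphase
  have hpos : 0 < 3 + 5 * ((a + b) ^ 2 - a * b - c * (a + b - c)) := by
    nlinarith [sq_nonneg (a - b), sq_nonneg (c - (a + b - c))]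
  have hprod : a * b - c * (a + b - c) = 0 := by
    simpa [hpos.ne', (show 0 < a + b by linarith).ne'] using hfactor
  have hroots : (a - c) * (b - c) = 0 := by linear_combination hprod
  have hac : a = c := by
    rcases mul_eq_zero.1 hroots with h | h <;> linarith
  subst hac
  simp

theorem isDominatedParam_curveSum : IsDominatedParam (volume.restrict pairs) curveSum jac where
  measurable := measurable_curveSum
  measurable_weight := measurable_jac
  weight_pos := (ae_restrict_mem measurableSet_pairs).mono fun _ => jac_pos
  map_withDensity_le := by
    let f : ℝ × ℝ → ℝ × ℝ := fun z => (z.1 ^ 3 + z.1 ^ 5 + (z.2 ^ 3 + z.2 ^ 5), z.1 + z.2)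
    let D : ℝ × ℝ → ℝ × ℝ →L[ℝ] ℝ × ℝ := fun z =>
      LinearMap.toContinuousLinearMap (Matrix.toLin (.finTwoProd ℝ) (.finTwoProd ℝ)
        !![3 * z.1 ^ 2 + 5 * z.1 ^ 4, 3 * z.2 ^ 2 + 5 * z.2 ^ 4; 1, 1])
    have hf : curveSum = WithLp.toLp 2 ∘ f := rfl
    have hf_inj : Set.InjOn f pairs := (hf ▸ injOn_curveSum).of_comp
    have hD (z : ℝ × ℝ) : HasFDerivAt f (D z) z := by
      have hfst : HasFDerivAt Prod.fst (ContinuousLinearMap.fst ℝ ℝ ℝ) z := hasFDerivAt_fst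
      have hsnd : HasFDerivAt Prod.snd (ContinuousLinearMap.snd ℝ ℝ ℝ) z := hasFDerivAt_snd
      have h := (((hfst.pow 3).add (hfst.pow 5)).add ((hsnd.pow 3).add (hsnd.pow 5))).prodMk
        (hfst.add hsnd)
      refine h.congr_fderiv ?_
      simp only [D]
      rw [Matrix.toLin_finTwoProd_toContinuousLinearMap]
      ext <;> simp
    have hdet (z : ℝ × ℝ) : (D z).det = -jac z := by
      simp only [D, jac, LinearMap.det_toContinuousLinearMap, LinearMap.det_toLin,
        Matrix.det_fin_two_of]
      ring
    have hweight : (fun z => ENNReal.ofReal (jac z)) =ᵐ[volume.restrict pairs]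
        fun z => ENNReal.ofReal |(D z).det| :=
      (ae_restrict_mem measurableSet_pairs).mono fun z hz => by
        simp only [hdet, abs_neg, abs_of_pos (jac_pos hz)]
    rw [hf, ← Measure.map_map (WithLp.measurable_toLp 2 _) (by fun_prop),
      withDensity_congr_ae hweight, map_withDensity_abs_det_fderiv_eq_addHaar volume
        measurableSet_pairs.nullMeasurableSet (fun z _ => (hD z).hasFDerivWithinAt) hf_inj,
      ← (WithLp.volume_preserving_toLp ℝ ℝ).map_eq]
    exact Measure.map_mono Measure.restrict_le_self (WithLp.measurable_toLp 2 _)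

/-- The density `w u ⊗ w u` on pairs of frequencies, where `w` is the weight of the curve. -/
def pairDensity (u : ℝ → ℂ) (z : ℝ × ℝ) : ℂ := (wt z.1 * u z.1 : ℂ) * (wt z.2 * u z.2)

@[fun_prop]
theorem measurable_pairDensity {u : ℝ → ℂ} (hu : Measurable u) : Measurable (pairDensity u) := by
  unfold pairDensity
  fun_prop

theorem curveExt_indicator {S : Set ℝ} (hS : MeasurableSet S) (u : ℝ → ℂ) :
    curveExt (S.indicator u) = oscInt (volume.restrict S) curve fun ξ => (wt ξ : ℂ) * u ξ := by
  funext p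
  unfold curveExt oscInt
  rw [← integral_indicator hS]
  congr 1 with ξ
  by_cases h : ξ ∈ S <;> simp [h]

theorem oscInt_curveSum_prod {S T : Set ℝ} (hS : MeasurableSet S) (hT : MeasurableSet T)
    (u : ℝ → ℂ) (p : Plane) :
    oscInt (volume.restrict (S ×ˢ T)) curveSum (pairDensity u) p =
      curveExt (S.indicator u) p * curveExt (T.indicator u) p := by
  rw [curveExt_indicator hS, curveExt_indicator hT]
  unfold oscInt pairDensity
  rw [← integral_prod_mul, Measure.prod_restrict, ← Measure.volume_eq_prod]
  congr 1 with z
  simp only [curveSum, inner_add_right, Complex.ofReal_add, mul_add, Complex.exp_add]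
  ring

theorem ae_fst_ne_snd {ν : Measure ℝ} [SFinite ν] [NullSingletonClass ν] :
    ∀ᵐ z ∂ν.prod ν, z.1 ≠ z.2 := by
  have hdiag : MeasurableSet {z : ℝ × ℝ | z.1 = z.2} :=
    measurableSet_eq_fun measurable_fst measurable_snd
  have hslice (x : ℝ) : Prod.mk x ⁻¹' {z : ℝ × ℝ | z.1 = z.2} = {x} := by
    ext y
    simp [eq_comm]
  rw [ae_iff]
  simp only [ne_eq, not_not, Measure.measure_prod_null hdiag, hslice]
  exact ae_of_all _ fun x => measure_singleton x

theorem integral_prod_eq_two_mul_of_symm {ν : Measure ℝ} [SFinite ν] [NullSingletonClass ν]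
    {G : ℝ × ℝ → ℂ} (hG : Integrable G (ν.prod ν)) (hsymm : ∀ z, G z.swap = G z) :
    ∫ z, G z ∂ν.prod ν = 2 * ∫ z in {z | z.1 < z.2}, G z ∂ν.prod ν := by
  have hlt : MeasurableSet {z : ℝ × ℝ | z.1 < z.2} :=
    measurableSet_lt measurable_fst measurable_snd
  have hcompl : ({z | z.1 < z.2}ᶜ : Set (ℝ × ℝ)) =ᵐ[ν.prod ν] Prod.swap ⁻¹' {z | z.1 < z.2} := by
    filter_upwards [ae_fst_ne_snd] with z hz
    exact propext (not_lt.trans (Ne.le_iff_lt hz.symm))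
  have hswap : ∫ z in Prod.swap ⁻¹' {z | z.1 < z.2}, G z ∂ν.prod ν =
      ∫ z in {z | z.1 < z.2}, G z ∂ν.prod ν := by
    simpa only [hsymm] using Measure.measurePreserving_swap.setIntegral_preimage_emb
      MeasurableEquiv.prodComm.measurableEmbedding G {z : ℝ × ℝ | z.1 < z.2}
  rw [← integral_add_compl hlt hG, setIntegral_congr_set hcompl, hswap, two_mul]

/-- The bilinear reduction: `curveExt u ^ 2` is the extension of the density `w u ⊗ w u` on the set
of sums of two points of the curve, by symmetry twice the part over `pairs`. -/
theorem curveExt_sq {u : ℝ → ℂ} (hu : ∀ ξ ≤ 0, u ξ = 0)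
    (hi : Integrable fun ξ => (wt ξ : ℂ) * u ξ) (p : Plane) :
    curveExt u p ^ 2 = 2 * oscInt (volume.restrict pairs) curveSum (pairDensity u) p := by
  set G : ℝ × ℝ → ℂ := fun z => Complex.exp (Complex.I * (inner ℝ p (curveSum z) : ℝ)) *
    pairDensity u z
  have hG : Integrable G := integrable_exp_mul measurable_curveSum (hi.mul_prod hi) p
  have hsymm (z : ℝ × ℝ) : G z.swap = G z := by
    simp only [G, pairDensity, Prod.fst_swap, Prod.snd_swap, curveSum, add_comm (curve z.2),
      mul_comm ((wt z.2 : ℂ) * u z.2)]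
  calc curveExt u p ^ 2 = ∫ z, G z := by
        have h := oscInt_curveSum_prod .univ .univ u p
        rw [Set.univ_prod_univ, Measure.restrict_univ, Set.indicator_univ, ← sq] at h
        exact h.symm
    _ = 2 * ∫ z in {z : ℝ × ℝ | z.1 < z.2}, G z := integral_prod_eq_two_mul_of_symm hG hsymm
    _ = 2 * ∫ z in pairs, G z := by
        congr 1
        refine setIntegral_eq_of_subset_of_forall_sdiff_eq_zero
          (measurableSet_lt measurable_fst measurable_snd) (fun z hz => hz.2) fun z hz => ?_
        have hz₁ : z.1 ≤ 0 := not_lt.1 fun h => hz.2 ⟨h, hz.1⟩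
        simp [G, pairDensity, hu _ hz₁]

end Curve

section Whitney

/-- The dyadic interval `[k 2^j, (k + 1) 2^j)` as a set of real numbers. -/
def cell (j k : ℤ) : Set ℝ := Set.Ico (k * (2 : ℝ) ^ j) ((k + 1) * (2 : ℝ) ^ j)

theorem measurableSet_cell (j k : ℤ) : MeasurableSet (cell j k) := measurableSet_Ico

theorem mem_cell_iff {j k : ℤ} {x : ℝ} : x ∈ cell j k ↔ ⌊x / (2 : ℝ) ^ j⌋ = k := by
  have h : (0 : ℝ) < 2 ^ j := by positivity
  rw [Int.floor_eq_iff, le_div_iff₀ h, div_lt_iff₀ h]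
  rfl

theorem volume_cell (j k : ℤ) : volume (cell j k) = ENNReal.ofReal ((2 : ℝ) ^ j) := by
  rw [cell, Real.volume_Ico]
  congr 1
  ring

theorem floor_div_zpow_add (x : ℝ) (j : ℤ) (n : ℕ) :
    ⌊x / (2 : ℝ) ^ (j + n)⌋ = ⌊x / (2 : ℝ) ^ j⌋ / 2 ^ n := by
  have h : x / (2 : ℝ) ^ (j + n) = x / (2 : ℝ) ^ j / (2 ^ n : ℕ) := by
    rw [zpow_add₀ two_ne_zero, ← div_div, zpow_natCast, Nat.cast_pow, Nat.cast_ofNat]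
  rw [h, Int.floor_div_natCast, Nat.cast_pow, Nat.cast_ofNat]

theorem floor_div_zpow_succ (x : ℝ) (j : ℤ) :
    ⌊x / (2 : ℝ) ^ (j + 1)⌋ = ⌊x / (2 : ℝ) ^ j⌋ / 2 := by
  simpa using floor_div_zpow_add x j 1

theorem floor_div_zpow_natCast_eq_zero {x : ℝ} {n : ℕ} (hx : 0 ≤ x) (hxn : x < 2 ^ n) :
    ⌊x / (2 : ℝ) ^ (n : ℤ)⌋ = 0 := by
  rw [Int.floor_eq_zero_iff, zpow_natCast]
  exact ⟨by positivity, (div_lt_one (by positivity)).2 hxn⟩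

/-- The dyadic interval of length `2^j` containing `z.1` lies to the left of the one containing
`z.2`, and the two are not adjacent. -/
def Separated (j : ℤ) (z : ℝ × ℝ) : Prop := ⌊z.1 / (2 : ℝ) ^ j⌋ + 2 ≤ ⌊z.2 / (2 : ℝ) ^ j⌋

theorem Separated.of_le {i j : ℤ} {z : ℝ × ℝ} (h : Separated j z) (hij : i ≤ j) :
    Separated i z := by
  induction i, hij using Int.leInductionDown with
  | base => exact h
  | pred i _ ih =>
    unfold Separated at *
    rw [← sub_add_cancel i 1, floor_div_zpow_succ, floor_div_zpow_succ] at ih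
    omega

theorem exists_separated {z : ℝ × ℝ} (hz : z.1 < z.2) : ∃ j, Separated j z := by
  have hd : 0 < z.2 - z.1 := sub_pos.2 hz
  obtain ⟨m, hm⟩ := pow_unbounded_of_one_lt (3 / (z.2 - z.1)) (one_lt_two : (1 : ℝ) < 2)
  refine ⟨-m, ?_⟩
  unfold Separated
  simp only [zpow_neg, zpow_natCast, div_inv_eq_mul]
  rw [← Int.floor_add_ofNat, Int.le_floor]
  rw [div_lt_iff₀ hd] at hm
  refine (Int.floor_le _).trans ?_
  linarith

theorem exists_not_separated {z : ℝ × ℝ} (hz : z ∈ pairs) : ∃ j, ¬ Separated j z := by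
  obtain ⟨hpos, hlt⟩ := hz
  obtain ⟨n, hn⟩ := pow_unbounded_of_one_lt z.2 (one_lt_two : (1 : ℝ) < 2)
  refine ⟨n, ?_⟩
  rw [Separated, floor_div_zpow_natCast_eq_zero hpos.le (hlt.trans hn),
    floor_div_zpow_natCast_eq_zero (hpos.trans hlt).le hn]
  decide

theorem exists_separated_not_succ {z : ℝ × ℝ} (hz : z ∈ pairs) :
    ∃ j, Separated j z ∧ ¬ Separated (j + 1) z := by
  obtain ⟨n, hn⟩ := exists_not_separated hz
  obtain ⟨j, hj, hmax⟩ := Int.exists_greatest_of_bdd (P := fun j => Separated j z)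
    ⟨n, fun i hi => le_of_not_ge fun hni => hn (hi.of_le hni)⟩ (exists_separated hz.2)
  exact ⟨j, hj, fun h => (lt_add_one j).not_ge (hmax _ h)⟩

/-- The distance, in cells, between the two sides of a Whitney square. -/
def offset (b : Bool) : ℤ := cond b 3 2

/-- The Whitney squares: `[k, k + 1) 2^j × [k + 2, k + 3) 2^j` for all `k`, and
`[k, k + 1) 2^j × [k + 3, k + 4) 2^j` for even `k`.  The index is `(j, k, b)`, where `b` says which
of the two families is meant; the indices with `b` true and `k` odd give the empty set. -/
def whitney (i : ℤ × ℤ × Bool) : Set (ℝ × ℝ) :=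
  {z | z ∈ cell i.1 i.2.1 ×ˢ cell i.1 (i.2.1 + offset i.2.2) ∧ (i.2.2 = true → Even i.2.1)}

theorem whitney_eq {i : ℤ × ℤ × Bool} (h : i.2.2 = true → Even i.2.1) :
    whitney i = cell i.1 i.2.1 ×ˢ cell i.1 (i.2.1 + offset i.2.2) := by
  ext z
  simp only [whitney, Set.mem_ofPred_eq, and_iff_left h]

theorem whitney_eq_empty {i : ℤ × ℤ × Bool} (h : ¬ (i.2.2 = true → Even i.2.1)) :
    whitney i = ∅ :=
  Set.eq_empty_of_forall_notMem fun _ hz => h hz.2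

theorem measurableSet_whitney (i : ℤ × ℤ × Bool) : MeasurableSet (whitney i) := by
  by_cases h : i.2.2 = true → Even i.2.1
  · rw [whitney_eq h]
    exact (measurableSet_cell _ _).prod (measurableSet_cell _ _)
  · rw [whitney_eq_empty h]
    exact MeasurableSet.empty

theorem mem_whitney_iff {j k : ℤ} {b : Bool} {z : ℝ × ℝ} :
    z ∈ whitney (j, k, b) ↔ (⌊z.1 / (2 : ℝ) ^ j⌋ = k ∧ ⌊z.2 / (2 : ℝ) ^ j⌋ = k + offset b) ∧
      (b = true → Even k) := by
  simp only [whitney, Set.mem_ofPred_eq, Set.mem_prod, mem_cell_iff]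

theorem not_separated_succ_iff {j : ℤ} {z : ℝ × ℝ} :
    ¬ Separated (j + 1) z ↔ ⌊z.2 / (2 : ℝ) ^ j⌋ / 2 < ⌊z.1 / (2 : ℝ) ^ j⌋ / 2 + 2 := by
  rw [Separated, floor_div_zpow_succ, floor_div_zpow_succ, not_le]

theorem separated_of_mem_whitney {j k : ℤ} {b : Bool} {z : ℝ × ℝ} (hz : z ∈ whitney (j, k, b)) :
    Separated j z ∧ ¬ Separated (j + 1) z := by
  obtain ⟨⟨hfst, hsnd⟩, heven⟩ := mem_whitney_iff.1 hz
  rw [not_separated_succ_iff, Separated, hfst, hsnd]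
  cases b with
  | false =>
    simp only [offset, cond_false]
    omega
  | true =>
    have := heven rfl
    simp only [offset, cond_true, Int.even_iff] at *
    omega

theorem exists_mem_whitney {z : ℝ × ℝ} (hz : z ∈ pairs) : ∃ i, z ∈ whitney i := by
  obtain ⟨j, hsep, hsucc⟩ := exists_separated_not_succ hz
  rw [not_separated_succ_iff] at hsucc
  unfold Separated at hsep
  by_cases htwo : ⌊z.2 / (2 : ℝ) ^ j⌋ = ⌊z.1 / (2 : ℝ) ^ j⌋ + 2
  · exact ⟨(j, ⌊z.1 / (2 : ℝ) ^ j⌋, false), mem_whitney_iff.2 ⟨⟨rfl, htwo⟩, nofun⟩⟩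
  · refine ⟨(j, ⌊z.1 / (2 : ℝ) ^ j⌋, true), mem_whitney_iff.2 ⟨⟨rfl, ?_⟩, fun _ => ?_⟩⟩
    · simp only [offset, cond_true]
      omega
    · rw [Int.even_iff]
      omega

theorem offset_injective : Function.Injective offset := by decide

theorem pairwise_disjoint_whitney : Pairwise (Function.onFun Disjoint whitney) := by
  rintro ⟨j, k, b⟩ ⟨j', k', b'⟩ hne
  refine Set.disjoint_left.2 fun z hz hz' => hne ?_
  obtain ⟨hsep, hsucc⟩ := separated_of_mem_whitney hz
  obtain ⟨hsep', hsucc'⟩ := separated_of_mem_whitney hz'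
  obtain rfl : j = j' := le_antisymm
    (not_lt.1 fun hlt => hsucc' (hsep.of_le hlt)) (not_lt.1 fun hlt => hsucc (hsep'.of_le hlt))
  obtain ⟨⟨rfl, hsnd⟩, -⟩ := mem_whitney_iff.1 hz
  obtain ⟨⟨rfl, hsnd'⟩, -⟩ := mem_whitney_iff.1 hz'
  rw [offset_injective (add_left_cancel (hsnd.symm.trans hsnd'))]

theorem sub_mem_Icc_of_mem_whitney {j k : ℤ} {b : Bool} {z : ℝ × ℝ} (hz : z ∈ whitney (j, k, b)) :
    z.2 - z.1 ∈ Set.Icc ((2 : ℝ) ^ j) (4 * (2 : ℝ) ^ j) := by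
  obtain ⟨⟨⟨hk, hk'⟩, ⟨hl, hl'⟩⟩, -⟩ := hz
  have h : (0 : ℝ) < 2 ^ j := by positivity
  cases b <;> simp only [offset, cond_true, cond_false] at * <;> push_cast at * <;>
    constructor <;> nlinarith

end Whitney

section Incomparable

/-- The function `min (p⁵, p³)`, which controls `p³ q³` when `p` is far from `1` but `p q` is not
large. -/
def profile (p : ℝ) : ℝ := min (p ^ 5) (p ^ 3)

theorem profile_nonneg {p : ℝ} (hp : 0 ≤ p) : 0 ≤ profile p :=
  le_min (by positivity) (by positivity)

@[fun_prop]
theorem measurable_profile : Measurable profile := by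
  unfold profile
  fun_prop

theorem profile_of_le_one {p : ℝ} (hp : 0 ≤ p) (hp1 : p ≤ 1) : profile p = p ^ 5 :=
  min_eq_left (pow_le_pow_of_le_one hp hp1 (by norm_num))

theorem profile_of_one_le {p : ℝ} (hp : 1 ≤ p) : profile p = p ^ 3 :=
  min_eq_right (pow_le_pow_right₀ hp (by norm_num))

theorem cube_mul_cube_mul_le_of_sq_le {p q L : ℝ} (hq : 0 ≤ q) (hL : 1 ≤ L) (hp : L ^ 2 ≤ p) :
    p ^ 3 * q ^ 3 * L ≤ p ^ 4 * q ^ 4 + profile p := by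
  have hp1 : 1 ≤ p := (one_le_pow₀ hL).trans hp
  rw [profile_of_one_le hp1]
  rcases le_total L (p * q) with hpq | hpq
  · calc p ^ 3 * q ^ 3 * L ≤ p ^ 3 * q ^ 3 * (p * q) := by gcongr
      _ = p ^ 4 * q ^ 4 := by ring
      _ ≤ p ^ 4 * q ^ 4 + p ^ 3 := le_add_of_nonneg_right (by positivity)
  · calc p ^ 3 * q ^ 3 * L = (p * q) ^ 3 * L := by rw [mul_pow]
      _ ≤ L ^ 3 * L := by gcongr
      _ ≤ (L ^ 2) ^ 3 := by
        rw [← pow_mul, ← pow_succ]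
        exact pow_le_pow_right₀ hL (by norm_num)
      _ ≤ p ^ 3 := by gcongr
      _ ≤ p ^ 4 * q ^ 4 + p ^ 3 := le_add_of_nonneg_left (by positivity)

theorem sq_mul_cube_le_profile_add {p q : ℝ} (hp : 0 ≤ p) (hp1 : p ≤ 1) (hq : 0 ≤ q) :
    p ^ 2 * q ^ 3 ≤ profile p + profile q := by
  rcases le_total q p with hqp | hqp
  · calc p ^ 2 * q ^ 3 ≤ p ^ 2 * p ^ 3 := by gcongr
      _ = profile p := by rw [profile_of_le_one hp hp1, ← pow_add]
      _ ≤ profile p + profile q := le_add_of_nonneg_right (profile_nonneg hq)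
  · refine le_add_of_nonneg_of_le (profile_nonneg hp) (le_min ?_ ?_)
    · calc p ^ 2 * q ^ 3 ≤ q ^ 2 * q ^ 3 := by gcongr
        _ = q ^ 5 := by rw [← pow_add]
    · exact mul_le_of_le_one_left (by positivity) (pow_le_one₀ hp hp1)

theorem cube_mul_cube_mul_le {p q L : ℝ} (hp : 0 ≤ p) (hq : 0 ≤ q) (hL : 1 ≤ L)
    (hpL : p ∉ Set.Icc L⁻¹ (L ^ 2)) :
    p ^ 3 * q ^ 3 * L ≤ p ^ 4 * q ^ 4 + profile p + profile q := by
  have hL0 : 0 < L := one_pos.trans_le hL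
  rw [Set.mem_Icc, not_and_or, not_le, not_le, ← one_div, lt_div_iff₀ hL0] at hpL
  rcases hpL with hsmall | hlarge
  · have hp1 : p ≤ 1 := (le_mul_of_one_le_right hp hL).trans hsmall.le
    calc p ^ 3 * q ^ 3 * L = p ^ 2 * q ^ 3 * (p * L) := by ring
      _ ≤ p ^ 2 * q ^ 3 := mul_le_of_le_one_right (by positivity) hsmall.le
      _ ≤ profile p + profile q := sq_mul_cube_le_profile_add hp hp1 hq
      _ ≤ p ^ 4 * q ^ 4 + profile p + profile q := by
        rw [add_assoc]
        exact le_add_of_nonneg_left (by positivity)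
  · exact (cube_mul_cube_mul_le_of_sq_le hq hL hlarge.le).trans
      (le_add_of_nonneg_right (profile_nonneg hq))

theorem lintegral_Ioc_rpow {c r : ℝ} (hc : 0 ≤ c) (hr : -1 < r) :
    ∫⁻ t in Set.Ioc 0 c, ENNReal.ofReal (t ^ r) = ENNReal.ofReal (c ^ (r + 1) / (r + 1)) := by
  rw [← ofReal_integral_eq_lintegral_ofReal, ← intervalIntegral.integral_of_le hc,
    integral_rpow (Or.inl hr), Real.zero_rpow (by linarith), sub_zero]
  · exact (intervalIntegrable_iff_integrableOn_Ioc_of_le hc).1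
      (intervalIntegral.intervalIntegrable_rpow' hr)
  · filter_upwards [ae_restrict_mem measurableSet_Ioc] with t ht
    exact Real.rpow_nonneg ht.1.le _

theorem lintegral_Ioi_rpow {c r : ℝ} (hc : 0 < c) (hr : r < -1) :
    ∫⁻ t in Set.Ioi c, ENNReal.ofReal (t ^ r) = ENNReal.ofReal (-c ^ (r + 1) / (r + 1)) := by
  rw [← ofReal_integral_eq_lintegral_ofReal, integral_Ioi_rpow_of_lt hr hc]
  · exact integrableOn_Ioi_rpow_of_lt hr hc
  · filter_upwards [ae_restrict_mem measurableSet_Ioi] with t ht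
    exact Real.rpow_nonneg (hc.trans ht).le _

theorem setLIntegral_sqrt_pow_div_sq {a : ℝ} (ha : 0 ≤ a) {s : Set ℝ} (hs : MeasurableSet s)
    (hs0 : s ⊆ Set.Ioi 0) (n : ℕ) :
    ∫⁻ t in s, ENNReal.ofReal (√(a * √t) ^ n / t ^ 2) =
      ENNReal.ofReal (a ^ (n / 2 : ℝ)) * ∫⁻ t in s, ENNReal.ofReal (t ^ (n / 4 - 2 : ℝ)) := by
  rw [← lintegral_const_mul' _ _ ENNReal.ofReal_ne_top]
  refine setLIntegral_congr_fun hs fun t ht => ?_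
  have ht : 0 < t := hs0 ht
  have hsqrt : √(a * √t) = a ^ (1 / 2 : ℝ) * t ^ (1 / 4 : ℝ) := by
    rw [Real.sqrt_eq_rpow, Real.sqrt_eq_rpow, Real.mul_rpow ha (by positivity),
      ← Real.rpow_mul ht.le]
    norm_num
  rw [← ENNReal.ofReal_mul (by positivity), hsqrt, mul_pow, ← Real.rpow_natCast,
    ← Real.rpow_natCast, ← Real.rpow_mul ha, ← Real.rpow_mul ht.le, Real.rpow_sub ht,
    mul_div_assoc, Real.rpow_two]
  ring_nf

theorem lintegral_profile_le (a : ℝ) :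
    ∫⁻ t in Set.Ioi 0, ENNReal.ofReal (profile √(a * √t) / t ^ 2) ≤ ENNReal.ofReal (8 * a ^ 2) := by
  rcases le_or_gt a 0 with ha | ha
  · have hzero (t : ℝ) : √(a * √t) = 0 :=
      Real.sqrt_eq_zero_of_nonpos (mul_nonpos_of_nonpos_of_nonneg ha (Real.sqrt_nonneg t))
    simp [profile, hzero]
  -- The two powers in the profile agree where `a √t = 1`.
  set c : ℝ := a ^ (-2 : ℝ)
  have hc : 0 < c := by positivity
  have hnear : ∫⁻ t in Set.Ioc 0 c, ENNReal.ofReal (√(a * √t) ^ 5 / t ^ 2) =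
      ENNReal.ofReal (4 * a ^ 2) := by
    rw [setLIntegral_sqrt_pow_div_sq ha.le measurableSet_Ioc (fun t ht => ht.1),
      lintegral_Ioc_rpow hc.le (by norm_num), ← ENNReal.ofReal_mul (by positivity)]
    congr 1
    rw [← Real.rpow_mul ha.le, mul_div_assoc', ← Real.rpow_add ha]
    norm_num
    ring
  have hfar : ∫⁻ t in Set.Ioi c, ENNReal.ofReal (√(a * √t) ^ 3 / t ^ 2) =
      ENNReal.ofReal (4 * a ^ 2) := by
    rw [setLIntegral_sqrt_pow_div_sq ha.le measurableSet_Ioi (fun t ht => hc.trans ht),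
      lintegral_Ioi_rpow hc (by norm_num), ← ENNReal.ofReal_mul (by positivity)]
    congr 1
    rw [← Real.rpow_mul ha.le, mul_div_assoc', mul_neg, ← Real.rpow_add ha]
    norm_num
    ring
  calc ∫⁻ t in Set.Ioi 0, ENNReal.ofReal (profile √(a * √t) / t ^ 2)
    _ ≤ (∫⁻ t in Set.Ioc 0 c, ENNReal.ofReal (profile √(a * √t) / t ^ 2)) +
        ∫⁻ t in Set.Ioi c, ENNReal.ofReal (profile √(a * √t) / t ^ 2) := by
      rw [← Set.Ioc_union_Ioi_eq_Ioi hc.le]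
      exact lintegral_union_le _ _ _
    _ ≤ ENNReal.ofReal (4 * a ^ 2) + ENNReal.ofReal (4 * a ^ 2) := by
      refine add_le_add (le_trans ?_ hnear.le) (le_trans ?_ hfar.le) <;> gcongr
      · exact min_le_left _ _
      · exact min_le_right _ _
    _ = ENNReal.ofReal (8 * a ^ 2) := by
      rw [← ENNReal.ofReal_add (by positivity) (by positivity)]
      ring_nf

theorem measurable_indicator_Ioi_sub {F : ℝ → ℝ → ℝ≥0∞} (hF : Measurable (Function.uncurry F))
    {g : ℝ × ℝ → ℝ} (hg : Measurable g) :
    Measurable fun z : ℝ × ℝ => (Set.Ioi 0).indicator (F (g z)) (z.2 - z.1) :=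
  (hF.indicator (measurable_snd measurableSet_Ioi)).comp
    (hg.prodMk (measurable_snd.sub measurable_fst))

theorem setLIntegral_pairs_le (F : ℝ × ℝ → ℝ → ℝ≥0∞) :
    ∫⁻ z in pairs, F z (z.2 - z.1) ≤ ∫⁻ z, (Set.Ioi 0).indicator (F z) (z.2 - z.1) := by
  rw [← lintegral_indicator measurableSet_pairs]
  refine lintegral_mono (Set.indicator_le fun z hz => ?_)
  rw [Set.indicator_of_mem (Set.mem_Ioi.2 (sub_pos.2 hz.2))]

theorem setLIntegral_pairs_fst_le {F : ℝ → ℝ → ℝ≥0∞} (hF : Measurable (Function.uncurry F)) :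
    ∫⁻ z in pairs, F z.1 (z.2 - z.1) ≤ ∫⁻ ξ, ∫⁻ t in Set.Ioi 0, F ξ t := by
  refine (setLIntegral_pairs_le fun z => F z.1).trans_eq ?_
  rw [Measure.volume_eq_prod,
    lintegral_prod _ (measurable_indicator_Ioi_sub hF measurable_fst).aemeasurable]
  simp only [lintegral_sub_right_eq_self (μ := volume) ((Set.Ioi (0 : ℝ)).indicator (F _)),
    lintegral_indicator measurableSet_Ioi]

theorem setLIntegral_pairs_snd_le {F : ℝ → ℝ → ℝ≥0∞} (hF : Measurable (Function.uncurry F)) :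
    ∫⁻ z in pairs, F z.2 (z.2 - z.1) ≤ ∫⁻ ξ, ∫⁻ t in Set.Ioi 0, F ξ t := by
  refine (setLIntegral_pairs_le fun z => F z.2).trans_eq ?_
  rw [Measure.volume_eq_prod,
    lintegral_prod_symm _ (measurable_indicator_Ioi_sub hF measurable_snd).aemeasurable]
  simp only [lintegral_sub_left_eq_self (μ := volume) ((Set.Ioi (0 : ℝ)).indicator (F _)),
    lintegral_indicator measurableSet_Ioi]

/-- The size `√(a √(η - ξ))` of a value `a` relative to the distance of the pair `(ξ, η)`; it is
`1` when `a` is the normalized height of a function spread over an interval of that length. -/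
def height (a : ℝ) (z : ℝ × ℝ) : ℝ := √(a * √(z.2 - z.1))

theorem height_nonneg (a : ℝ) (z : ℝ × ℝ) : 0 ≤ height a z := Real.sqrt_nonneg _

theorem measurable_height {g : ℝ × ℝ → ℝ} (hg : Measurable g) :
    Measurable fun z => height (g z) z := by
  unfold height
  fun_prop

theorem height_sq {a : ℝ} (ha : 0 ≤ a) (z : ℝ × ℝ) : height a z ^ 2 = a * √(z.2 - z.1) :=
  Real.sq_sqrt (by positivity)

theorem height_pow_four {a : ℝ} (ha : 0 ≤ a) {z : ℝ × ℝ} (hz : z.1 ≤ z.2) :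
    height a z ^ 4 = a ^ 2 * (z.2 - z.1) := by
  rw [show height a z ^ 4 = (height a z ^ 2) ^ 2 by ring, height_sq ha, mul_pow,
    Real.sq_sqrt (sub_nonneg.2 hz)]

theorem lintegral_lintegral_profile_le {v : ℝ → ℝ} (hv : Measurable v) :
    ∫⁻ ξ, ∫⁻ t in Set.Ioi 0, ENNReal.ofReal (profile √(v ξ * √t) / t ^ 2) ≤
      8 * ∫⁻ ξ, ENNReal.ofReal (v ξ ^ 2) := by
  rw [← lintegral_const_mul _ (by fun_prop)]
  refine lintegral_mono fun ξ => (lintegral_profile_le (v ξ)).trans_eq ?_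
  rw [ENNReal.ofReal_mul (by norm_num), ENNReal.ofReal_ofNat]

theorem lintegral_pairs_profile_fst_le {v : ℝ → ℝ} (hv : Measurable v) :
    ∫⁻ z in pairs, ENNReal.ofReal (profile (height (v z.1) z) / (z.2 - z.1) ^ 2) ≤
      8 * ∫⁻ ξ, ENNReal.ofReal (v ξ ^ 2) :=
  (setLIntegral_pairs_fst_le
    (F := fun ξ t => ENNReal.ofReal (profile √(v ξ * √t) / t ^ 2)) (by fun_prop)).trans
    (lintegral_lintegral_profile_le hv)

theorem lintegral_pairs_profile_snd_le {v : ℝ → ℝ} (hv : Measurable v) :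
    ∫⁻ z in pairs, ENNReal.ofReal (profile (height (v z.2) z) / (z.2 - z.1) ^ 2) ≤
      8 * ∫⁻ ξ, ENNReal.ofReal (v ξ ^ 2) :=
  (setLIntegral_pairs_snd_le
    (F := fun ξ t => ENNReal.ofReal (profile √(v ξ * √t) / t ^ 2)) (by fun_prop)).trans
    (lintegral_lintegral_profile_le hv)

/-- The frequencies at which `|u|` is comparable to `2^{-j/2}`, up to a factor `K`. -/
def mid (u : ℝ → ℂ) (K : ℝ) (j : ℤ) : Set ℝ := {ξ | ‖u ξ‖ * √((2 : ℝ) ^ j) ∈ Set.Icc K⁻¹ K}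

theorem measurableSet_mid {u : ℝ → ℂ} (hu : Measurable u) (K : ℝ) (j : ℤ) :
    MeasurableSet (mid u K j) :=
  measurableSet_Icc.preimage (by fun_prop)

/-- The pairs of frequencies at which both values of `u` are comparable to the inverse square root
of the size of the Whitney square. -/
def midPairs (u : ℝ → ℂ) (K : ℝ) : Set (ℝ × ℝ) :=
  ⋃ i : ℤ × ℤ × Bool, whitney i ∩ mid u K i.1 ×ˢ mid u K i.1

theorem measurableSet_midPairs {u : ℝ → ℂ} (hu : Measurable u) (K : ℝ) :
    MeasurableSet (midPairs u K) :=
  MeasurableSet.iUnion fun i => (measurableSet_whitney i).inter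
    ((measurableSet_mid hu K i.1).prod (measurableSet_mid hu K i.1))

theorem mem_midPairs_iff {u : ℝ → ℂ} {K : ℝ} {i : ℤ × ℤ × Bool} {z : ℝ × ℝ}
    (hz : z ∈ whitney i) : z ∈ midPairs u K ↔ z ∈ mid u K i.1 ×ˢ mid u K i.1 := by
  refine ⟨fun h => ?_, fun h => Set.mem_iUnion.2 ⟨i, hz, h⟩⟩
  obtain ⟨i', hi', hmid⟩ := Set.mem_iUnion.1 h
  obtain rfl : i = i' := of_not_not fun hne =>
    Set.disjoint_left.1 (pairwise_disjoint_whitney hne) hz hi'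
  exact hmid

theorem norm_pairDensity (u : ℝ → ℂ) (z : ℝ × ℝ) :
    ‖pairDensity u z‖ = wt z.1 * wt z.2 * (‖u z.1‖ * ‖u z.2‖) := by
  simp only [pairDensity, norm_mul, Complex.norm_real, Real.norm_of_nonneg (wt_nonneg _)]
  ring

theorem norm_pairDensity_le {z : ℝ × ℝ} (hz : z ∈ pairs) (u : ℝ → ℂ) :
    ‖pairDensity u z‖ ≤ wt z.2 ^ 2 * (‖u z.1‖ * ‖u z.2‖) := by
  have hwt : wt z.1 ≤ wt z.2 := wt_le_wt (abs_le_abs_of_nonneg hz.1.le hz.2.le)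
  rw [norm_pairDensity, sq]
  gcongr
  exact wt_nonneg z.2

theorem height_mul_height {a b : ℝ} (ha : 0 ≤ a) (hb : 0 ≤ b) {z : ℝ × ℝ} (hz : z.1 ≤ z.2) :
    height a z * height b z = √(a * b) * √(z.2 - z.1) := by
  unfold height
  rw [← Real.sqrt_mul (by positivity), ← Real.sqrt_mul (by positivity), mul_mul_mul_comm,
    Real.mul_self_sqrt (sub_nonneg.2 hz)]

theorem pairDensity_hausdorffYoung_le {z : ℝ × ℝ} (hz : z ∈ pairs) (u : ℝ → ℂ) :
    ‖pairDensity u z‖ * √‖pairDensity u z‖ / √(jac z) ≤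
      height ‖u z.1‖ z ^ 3 * height ‖u z.2‖ z ^ 3 / (z.2 - z.1) ^ 2 := by
  have hdist : 0 < z.2 - z.1 := sub_pos.2 hz.2
  have hW : 0 < wt z.2 := wt_pos (hz.1.trans hz.2)
  rw [← mul_pow, height_mul_height (norm_nonneg _) (norm_nonneg _) hz.2.le]
  set ab := ‖u z.1‖ * ‖u z.2‖
  set W := wt z.2
  set t := z.2 - z.1
  have hab0 : 0 ≤ ab := by positivity
  calc ‖pairDensity u z‖ * √‖pairDensity u z‖ / √(jac z)
    _ ≤ W ^ 2 * ab * √(W ^ 2 * ab) / √(t * W ^ 6) := by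
      gcongr
      · exact norm_pairDensity_le hz u
      · exact norm_pairDensity_le hz u
      · exact mul_wt_pow_six_le_jac hz
    _ = ab * √ab / √t := by
      rw [Real.sqrt_mul (by positivity), Real.sqrt_sq hW.le, Real.sqrt_mul hdist.le,
        show W ^ 6 = (W ^ 3) ^ 2 by ring, Real.sqrt_sq (by positivity)]
      field_simp
    _ = (√ab * √t) ^ 3 / t ^ 2 := by
      nth_rewrite 1 [← Real.sq_sqrt hab0]
      nth_rewrite 3 [← Real.sq_sqrt hdist.le]
      field_simp

theorem height_notMem_Icc_of_notMem_mid {u : ℝ → ℂ} {L : ℝ} (hL : 2 ≤ L) {j k : ℤ} {b : Bool}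
    {z : ℝ × ℝ} (hz : z ∈ whitney (j, k, b)) {ξ : ℝ} (hξ : ξ ∉ mid u (L ^ 4) j) :
    height ‖u ξ‖ z ∉ Set.Icc L⁻¹ (L ^ 2) := by
  obtain ⟨hlow, hupp⟩ := sub_mem_Icc_of_mem_whitney hz
  refine fun hmem => hξ ⟨?_, ?_⟩
  · have hsqrt : √(z.2 - z.1) ≤ 2 * √((2 : ℝ) ^ j) := by
      calc √(z.2 - z.1) ≤ √(2 ^ 2 * 2 ^ j) := Real.sqrt_le_sqrt (hupp.trans_eq (by norm_num))
        _ = 2 * √(2 ^ j) := by rw [Real.sqrt_mul (by norm_num), Real.sqrt_sq (by norm_num)]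
    have hL2 : 2 * (L ^ 4)⁻¹ ≤ L⁻¹ ^ 2 := by
      rw [inv_pow, ← div_eq_mul_inv, div_le_iff₀ (by positivity), ← div_eq_inv_mul,
        le_div_iff₀ (by positivity)]
      nlinarith [mul_nonneg (sq_nonneg L) (sub_nonneg.2 (pow_le_pow_left₀ zero_le_two hL 2))]
    have hheight : 2 * (L ^ 4)⁻¹ ≤ 2 * (‖u ξ‖ * √((2 : ℝ) ^ j)) := by
      calc 2 * (L ^ 4)⁻¹ ≤ L⁻¹ ^ 2 := hL2
        _ ≤ height ‖u ξ‖ z ^ 2 := pow_le_pow_left₀ (by positivity) hmem.1 2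
        _ = ‖u ξ‖ * √(z.2 - z.1) := height_sq (norm_nonneg _) z
        _ ≤ ‖u ξ‖ * (2 * √((2 : ℝ) ^ j)) := by gcongr
        _ = 2 * (‖u ξ‖ * √((2 : ℝ) ^ j)) := by ring
    linarith
  · calc ‖u ξ‖ * √((2 : ℝ) ^ j) ≤ ‖u ξ‖ * √(z.2 - z.1) := by gcongr
      _ = height ‖u ξ‖ z ^ 2 := (height_sq (norm_nonneg _) z).symm
      _ ≤ (L ^ 2) ^ 2 := pow_le_pow_left₀ (height_nonneg _ _) hmem.2 2
      _ = L ^ 4 := by ring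

theorem pairDensity_hausdorffYoung_le_of_notMem_midPairs {z : ℝ × ℝ} (hz : z ∈ pairs) {u : ℝ → ℂ}
    {L : ℝ} (hL : 2 ≤ L) (hmid : z ∉ midPairs u (L ^ 4)) :
    ‖pairDensity u z‖ * √‖pairDensity u z‖ / √(jac z) ≤
      L⁻¹ * (‖u z.1‖ ^ 2 * ‖u z.2‖ ^ 2 + profile (height ‖u z.1‖ z) / (z.2 - z.1) ^ 2 +
        profile (height ‖u z.2‖ z) / (z.2 - z.1) ^ 2) := by
  have hdist : 0 < z.2 - z.1 := sub_pos.2 hz.2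
  have hL0 : 0 < L := two_pos.trans_le hL
  have hL1 : 1 ≤ L := one_le_two.trans hL
  obtain ⟨⟨j, k, b⟩, hi⟩ := exists_mem_whitney hz
  rw [mem_midPairs_iff hi, Set.mem_prod, not_and_or] at hmid
  set p := height ‖u z.1‖ z with hp
  set q := height ‖u z.2‖ z with hq
  have hcube : p ^ 3 * q ^ 3 * L ≤ p ^ 4 * q ^ 4 + profile p + profile q := by
    have hp0 : 0 ≤ p := height_nonneg _ _
    have hq0 : 0 ≤ q := height_nonneg _ _
    rcases hmid with hfst | hsnd
    · exact cube_mul_cube_mul_le hp0 hq0 hL1 (height_notMem_Icc_of_notMem_mid hL hi hfst)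
    · have h := cube_mul_cube_mul_le hq0 hp0 hL1 (height_notMem_Icc_of_notMem_mid hL hi hsnd)
      linarith
  calc ‖pairDensity u z‖ * √‖pairDensity u z‖ / √(jac z)
    _ ≤ p ^ 3 * q ^ 3 / (z.2 - z.1) ^ 2 := pairDensity_hausdorffYoung_le hz u
    _ ≤ L⁻¹ * (p ^ 4 * q ^ 4 + profile p + profile q) / (z.2 - z.1) ^ 2 := by
      refine div_le_div_of_nonneg_right ?_ (by positivity)
      rwa [← div_eq_inv_mul, le_div_iff₀ hL0]
    _ = _ := by
      rw [hp, hq, height_pow_four (norm_nonneg _) hz.2.le, height_pow_four (norm_nonneg _) hz.2.le]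
      field_simp

theorem ofReal_norm_sq (x : ℂ) : ENNReal.ofReal (‖x‖ ^ 2) = ‖x‖ₑ ^ 2 := by
  rw [ENNReal.ofReal_pow (norm_nonneg _), ofReal_norm]

theorem ofReal_pairDensity_compl_midPairs_le {u : ℝ → ℂ} {L : ℝ} (hL : 2 ≤ L) {z : ℝ × ℝ}
    (hz : z ∈ pairs) :
    ENNReal.ofReal (‖(midPairs u (L ^ 4))ᶜ.indicator (pairDensity u) z‖ *
        √‖(midPairs u (L ^ 4))ᶜ.indicator (pairDensity u) z‖ / √(jac z)) ≤
      ENNReal.ofReal L⁻¹ * (‖u z.1‖ₑ ^ 2 * ‖u z.2‖ₑ ^ 2 +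
        ENNReal.ofReal (profile (height ‖u z.1‖ z) / (z.2 - z.1) ^ 2) +
        ENNReal.ofReal (profile (height ‖u z.2‖ z) / (z.2 - z.1) ^ 2)) := by
  by_cases hmid : z ∈ midPairs u (L ^ 4)
  · simp [hmid]
  have hp := profile_nonneg (height_nonneg ‖u z.1‖ z)
  have hq := profile_nonneg (height_nonneg ‖u z.2‖ z)
  rw [Set.indicator_of_mem hmid, ← ofReal_norm_sq, ← ofReal_norm_sq,
    ← ENNReal.ofReal_mul (by positivity), ← ENNReal.ofReal_add (by positivity) (by positivity),
    ← ENNReal.ofReal_add (by positivity) (by positivity), ← ENNReal.ofReal_mul (by positivity)]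
  exact ENNReal.ofReal_le_ofReal (pairDensity_hausdorffYoung_le_of_notMem_midPairs hz hL hmid)

/-- Off the comparable pairs the bilinear density gains a factor `L⁻¹` in the weighted `L^{3/2}`
norm of the Hausdorff-Young inequality. -/
theorem lintegral_compl_midPairs_le {u : ℝ → ℂ} (hu : Measurable u) (hu1 : ∫⁻ ξ, ‖u ξ‖ₑ ^ 2 ≤ 1)
    {L : ℝ} (hL : 2 ≤ L) :
    ∫⁻ z in pairs, ENNReal.ofReal (‖(midPairs u (L ^ 4))ᶜ.indicator (pairDensity u) z‖ *
        √‖(midPairs u (L ^ 4))ᶜ.indicator (pairDensity u) z‖ / √(jac z)) ≤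
      ENNReal.ofReal (17 / L) := by
  set P₁ : ℝ × ℝ → ℝ≥0∞ := fun z =>
    ENNReal.ofReal (profile (height ‖u z.1‖ z) / (z.2 - z.1) ^ 2)
  set P₂ : ℝ × ℝ → ℝ≥0∞ := fun z =>
    ENNReal.ofReal (profile (height ‖u z.2‖ z) / (z.2 - z.1) ^ 2)
  have hprod : ∫⁻ z in pairs, ‖u z.1‖ₑ ^ 2 * ‖u z.2‖ₑ ^ 2 ≤ 1 := by
    refine (setLIntegral_le_lintegral _ _).trans ?_
    rw [Measure.volume_eq_prod, lintegral_prod_mul (f := fun ξ => ‖u ξ‖ₑ ^ 2)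
      (g := fun ξ => ‖u ξ‖ₑ ^ 2) (by fun_prop) (by fun_prop)]
    exact mul_le_one' hu1 hu1
  have hsq : ∫⁻ ξ, ENNReal.ofReal (‖u ξ‖ ^ 2) ≤ 1 := by simpa only [ofReal_norm_sq] using hu1
  have hP₁ : Measurable P₁ :=
    ((measurable_profile.comp (measurable_height (by fun_prop))).div (by fun_prop)).ennreal_ofReal
  have hP₂ : Measurable P₂ :=
    ((measurable_profile.comp (measurable_height (by fun_prop))).div (by fun_prop)).ennreal_ofReal
  calc _ ≤ ∫⁻ z in pairs, ENNReal.ofReal L⁻¹ * (‖u z.1‖ₑ ^ 2 * ‖u z.2‖ₑ ^ 2 + P₁ z + P₂ z) :=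
        setLIntegral_mono' measurableSet_pairs fun _ => ofReal_pairDensity_compl_midPairs_le hL
    _ = ENNReal.ofReal L⁻¹ * ((∫⁻ z in pairs, ‖u z.1‖ₑ ^ 2 * ‖u z.2‖ₑ ^ 2) +
          (∫⁻ z in pairs, P₁ z) + ∫⁻ z in pairs, P₂ z) := by
        rw [lintegral_const_mul' _ _ ENNReal.ofReal_ne_top, lintegral_add_right _ hP₂,
          lintegral_add_right _ hP₁]
    _ ≤ ENNReal.ofReal L⁻¹ * (1 + 8 * 1 + 8 * 1) := by
        gcongr
        · exact (lintegral_pairs_profile_fst_le hu.norm).trans (by gcongr)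
        · exact (lintegral_pairs_profile_snd_le hu.norm).trans (by gcongr)
    _ = ENNReal.ofReal (17 / L) := by
        rw [show (1 + 8 * 1 + 8 * 1 : ℝ≥0∞) = ENNReal.ofReal 17 by norm_num,
          ← ENNReal.ofReal_mul (by positivity [hL]), ← div_eq_inv_mul]

end Incomparable

section Comparable

/-- The center of `[k 2^j, (k + 1) 2^j)`. -/
def cellCenter (j k : ℤ) : ℝ := (k + 1 / 2) * (2 : ℝ) ^ j

/-- The product `|c + c³|^{1/6} |τ|^{1/2}` for the dyadic interval `τ = [k 2^j, (k + 1) 2^j)` with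
center `c`. -/
def cellScale (j k : ℤ) : ℝ := wt (cellCenter j k) * √((2 : ℝ) ^ j)

theorem cellScale_nonneg (j k : ℤ) : 0 ≤ cellScale j k := by
  unfold cellScale
  positivity [wt_nonneg (cellCenter j k)]

/-- The extensions of the dyadic pieces of `u` are bounded by `A`, relative to `cellScale`. -/
def DyadicBound (u : ℝ → ℂ) (A : ℝ) : Prop :=
  ∀ j k p, ‖curveExt ((cell j k).indicator u) p‖ₑ ≤ ENNReal.ofReal (A * cellScale j k)

theorem DyadicBound.mono {u : ℝ → ℂ} {A B : ℝ} (h : DyadicBound u A) (hAB : A ≤ B) :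
    DyadicBound u B := fun j k p =>
  (h j k p).trans (ENNReal.ofReal_le_ofReal
    (mul_le_mul_of_nonneg_right hAB (cellScale_nonneg j k)))

theorem wt_mul_indicator (S : Set ℝ) (u : ℝ → ℂ) :
    (fun ξ => (wt ξ : ℂ) * S.indicator u ξ) = S.indicator fun ξ => (wt ξ : ℂ) * u ξ :=
  funext fun _ => (Set.indicator_mul_right S (fun ξ => (wt ξ : ℂ)) u).symm

theorem integrable_wt_mul_indicator {u : ℝ → ℂ} (hi : Integrable fun ξ => (wt ξ : ℂ) * u ξ)
    {S : Set ℝ} (hS : MeasurableSet S) : Integrable fun ξ => (wt ξ : ℂ) * S.indicator u ξ := by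
  rw [wt_mul_indicator]
  exact hi.indicator hS

theorem curveExt_add {u v : ℝ → ℂ} (hu : Integrable fun ξ => (wt ξ : ℂ) * u ξ)
    (hv : Integrable fun ξ => (wt ξ : ℂ) * v ξ) : curveExt (u + v) = curveExt u + curveExt v := by
  unfold curveExt
  rw [← oscInt_add measurable_curve hu hv]
  congr 1 with ξ
  exact mul_add _ _ _

theorem cell_subset_Ici {j k : ℤ} (hk : 0 ≤ k) : cell j k ⊆ Set.Ici 0 := fun _ hξ =>
  le_trans (mul_nonneg (Int.cast_nonneg hk) (by positivity)) hξ.1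

theorem cell_subset_Iio {j k : ℤ} (hk : k < 0) : cell j k ⊆ Set.Iio 0 := fun _ hξ =>
  hξ.2.trans_le (mul_nonpos_of_nonpos_of_nonneg (by exact_mod_cast hk) (by positivity))

theorem cellCenter_pos {j k : ℤ} (hk : 0 ≤ k) : 0 < cellCenter j k := by
  have : (0 : ℝ) ≤ k := Int.cast_nonneg hk
  unfold cellCenter
  positivity

theorem wt_cellCenter_le {j k l : ℤ} (hk : 0 ≤ k) (hkl : k ≤ l) :
    wt (cellCenter j k) ≤ wt (cellCenter j l) := by
  refine wt_le_wt (abs_le_abs_of_nonneg (cellCenter_pos hk).le ?_)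
  unfold cellCenter
  gcongr

theorem wt_le_of_mem_cell {j k : ℤ} {ξ : ℝ} (hξ : ξ ∈ cell j k) :
    wt ξ ≤ 2 * wt (cellCenter j k) := by
  have h : (0 : ℝ) < 2 ^ j := by positivity
  obtain ⟨hlow, hupp⟩ := id hξ
  refine wt_le_two_mul ?_
  rcases le_or_gt 0 k with hk | hk
  · have : (0 : ℝ) ≤ k := Int.cast_nonneg hk
    rw [abs_of_nonneg (cell_subset_Ici hk hξ), abs_of_pos (cellCenter_pos hk), cellCenter]
    nlinarith
  · have hk1 : (k : ℝ) + 1 ≤ 0 := by exact_mod_cast hk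
    have hc : cellCenter j k < 0 := mul_neg_of_neg_of_pos (by linarith) h
    rw [abs_of_neg (cell_subset_Iio hk hξ), abs_of_neg hc, cellCenter]
    nlinarith

theorem wt_cellCenter_le_of_mem_cell {j k : ℤ} (hk : 1 ≤ k) {ξ : ℝ} (hξ : ξ ∈ cell j k) :
    wt (cellCenter j k) ≤ 2 * wt ξ := by
  have hk1 : (1 : ℝ) ≤ k := by exact_mod_cast hk
  have h : (0 : ℝ) < 2 ^ j := by positivity
  refine wt_le_two_mul ?_
  rw [abs_of_nonneg (Set.mem_Ici.1 (cell_subset_Ici (by lia) hξ)), abs_of_pos (cellCenter_pos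
    (by lia)), cellCenter]
  nlinarith [hξ.1]

theorem enorm_curveExt_cell_le (u : ℝ → ℂ) (j k : ℤ) (p : Plane) :
    ‖curveExt ((cell j k).indicator u) p‖ₑ ≤
      ENNReal.ofReal (2 * wt (cellCenter j k)) * ∫⁻ ξ in cell j k, ‖u ξ‖ₑ := by
  rw [curveExt_indicator (measurableSet_cell j k), ← lintegral_const_mul' _ _ ENNReal.ofReal_ne_top]
  refine (enorm_oscInt_le _ _ _).trans (setLIntegral_mono' (measurableSet_cell j k) fun ξ hξ => ?_)
  rw [enorm_mul, ← ofReal_norm (wt ξ : ℂ), Complex.norm_real, Real.norm_of_nonneg (wt_nonneg _)]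
  gcongr
  exact wt_le_of_mem_cell hξ

theorem ofReal_two_mul_wt_mul (j k : ℤ) (c : ℝ) :
    ENNReal.ofReal (2 * wt (cellCenter j k)) * ENNReal.ofReal (c * √((2 : ℝ) ^ j)) =
      ENNReal.ofReal (2 * c * cellScale j k) := by
  rw [← ENNReal.ofReal_mul (by positivity [wt_nonneg (cellCenter j k)]), cellScale]
  congr 1
  ring

theorem dyadicBound_of_lintegral_sq_le {u : ℝ → ℂ} (hu : Measurable u) {M : ℝ} (hM : 0 ≤ M)
    (hu2 : ∫⁻ ξ, ‖u ξ‖ₑ ^ 2 ≤ ENNReal.ofReal (M ^ 2)) : DyadicBound u (2 * M) := by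
  intro j k p
  have hcell : ∫⁻ ξ in cell j k, ‖u ξ‖ₑ ≤ ENNReal.ofReal (M * √((2 : ℝ) ^ j)) := by
    refine (ENNReal.pow_le_pow_left_iff two_ne_zero).1 ?_
    calc (∫⁻ ξ in cell j k, ‖u ξ‖ₑ) ^ 2 = (∫⁻ ξ in cell j k, ‖u ξ‖ₑ * 1) ^ 2 := by
          simp only [mul_one]
      _ ≤ (∫⁻ ξ in cell j k, ‖u ξ‖ₑ ^ 2) * ∫⁻ ξ in cell j k, 1 ^ 2 :=
          sq_lintegral_mul_le (by fun_prop) (by fun_prop)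
      _ ≤ ENNReal.ofReal (M ^ 2) * ENNReal.ofReal ((2 : ℝ) ^ j) := by
          rw [one_pow, setLIntegral_one, volume_cell]
          gcongr
          exact (setLIntegral_le_lintegral _ _).trans hu2
      _ = ENNReal.ofReal (M * √((2 : ℝ) ^ j)) ^ 2 := by
          rw [← ENNReal.ofReal_pow (by positivity), mul_pow, Real.sq_sqrt (by positivity),
            ENNReal.ofReal_mul (by positivity)]
  calc ‖curveExt ((cell j k).indicator u) p‖ₑ
    _ ≤ ENNReal.ofReal (2 * wt (cellCenter j k)) * ENNReal.ofReal (M * √((2 : ℝ) ^ j)) :=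
      (enorm_curveExt_cell_le u j k p).trans (by gcongr)
    _ = ENNReal.ofReal (2 * M * cellScale j k) := ofReal_two_mul_wt_mul j k M

theorem norm_indicator_compl_mid_le (u : ℝ → ℂ) {K : ℝ} (hK : 0 < K) (j : ℤ) (ξ : ℝ) :
    ‖(mid u K j)ᶜ.indicator u ξ‖ ≤ (K * √((2 : ℝ) ^ j))⁻¹ + √((2 : ℝ) ^ j) / K * ‖u ξ‖ ^ 2 := by
  have hs : 0 < √((2 : ℝ) ^ j) := Real.sqrt_pos.2 (by positivity)
  have hu := norm_nonneg (u ξ)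
  by_cases h : ξ ∈ mid u K j
  · rw [Set.indicator_of_notMem (Set.notMem_compl_iff.2 h), norm_zero]
    positivity
  rw [Set.indicator_of_mem h]
  rcases not_and_or.1 h with hsmall | hlarge
  · have : ‖u ξ‖ ≤ (K * √((2 : ℝ) ^ j))⁻¹ := by
      rw [mul_inv, ← div_eq_mul_inv, le_div_iff₀ hs]
      exact (not_le.1 hsmall).le
    linarith [show 0 ≤ √((2 : ℝ) ^ j) / K * ‖u ξ‖ ^ 2 by positivity]
  · have : ‖u ξ‖ ≤ √((2 : ℝ) ^ j) / K * ‖u ξ‖ ^ 2 := by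
      rw [div_mul_eq_mul_div, le_div_iff₀ hK]
      nlinarith [not_le.1 hlarge]
    linarith [show 0 ≤ (K * √((2 : ℝ) ^ j))⁻¹ by positivity]

theorem enorm_curveExt_compl_mid_le {u : ℝ → ℂ} (hu1 : ∫⁻ ξ, ‖u ξ‖ₑ ^ 2 ≤ 1) {K : ℝ} (hK : 0 < K)
    (j k : ℤ) (p : Plane) :
    ‖curveExt ((cell j k).indicator ((mid u K j)ᶜ.indicator u)) p‖ₑ ≤
      ENNReal.ofReal (4 / K * cellScale j k) := by
  set s : ℝ := √((2 : ℝ) ^ j) with hs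
  have hs0 : 0 < s := Real.sqrt_pos.2 (by positivity)
  have hcell : ∫⁻ ξ in cell j k, ‖(mid u K j)ᶜ.indicator u ξ‖ₑ ≤ ENNReal.ofReal (2 / K * s) := by
    calc ∫⁻ ξ in cell j k, ‖(mid u K j)ᶜ.indicator u ξ‖ₑ
      _ ≤ ∫⁻ ξ in cell j k, (ENNReal.ofReal (K * s)⁻¹ + ENNReal.ofReal (s / K) * ‖u ξ‖ₑ ^ 2) := by
        refine lintegral_mono fun ξ => ?_
        rw [← ofReal_norm, ← ofReal_norm_sq, ← ENNReal.ofReal_mul (by positivity),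
          ← ENNReal.ofReal_add (by positivity) (by positivity)]
        exact ENNReal.ofReal_le_ofReal (norm_indicator_compl_mid_le u hK j ξ)
      _ ≤ ENNReal.ofReal (K * s)⁻¹ * ENNReal.ofReal ((2 : ℝ) ^ j) +
            ENNReal.ofReal (s / K) * 1 := by
        rw [lintegral_add_left measurable_const, lintegral_const_mul' _ _ ENNReal.ofReal_ne_top,
          setLIntegral_const, volume_cell]
        gcongr
        exact (setLIntegral_le_lintegral _ _).trans hu1
      _ = ENNReal.ofReal (2 / K * s) := by
        rw [← Real.sq_sqrt (show (0 : ℝ) ≤ 2 ^ j by positivity), ← hs, mul_one,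
          ← ENNReal.ofReal_mul (by positivity),
          ← ENNReal.ofReal_add (by positivity) (by positivity)]
        congr 1
        field_simp
        norm_num
  calc ‖curveExt ((cell j k).indicator ((mid u K j)ᶜ.indicator u)) p‖ₑ
    _ ≤ ENNReal.ofReal (2 * wt (cellCenter j k)) * ENNReal.ofReal (2 / K * s) :=
      (enorm_curveExt_cell_le _ j k p).trans (by gcongr)
    _ = ENNReal.ofReal (4 / K * cellScale j k) := by
      rw [ofReal_two_mul_wt_mul]
      congr 2
      ring

theorem enorm_curveExt_mid_le {u : ℝ → ℂ} (hu : Measurable u)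
    (hi : Integrable fun ξ => (wt ξ : ℂ) * u ξ) (hu1 : ∫⁻ ξ, ‖u ξ‖ₑ ^ 2 ≤ 1)
    {K : ℝ} (hK : 0 < K) {A : ℝ} (hA0 : 0 ≤ A) (hA : DyadicBound u A) (j k : ℤ) (p : Plane) :
    ‖curveExt ((cell j k).indicator ((mid u K j).indicator u)) p‖ₑ ≤
      ENNReal.ofReal ((A + 4 / K) * cellScale j k) := by
  have hM := measurableSet_mid hu K j
  have hC := measurableSet_cell j k
  have hscale := cellScale_nonneg j k
  have hsum : curveExt ((cell j k).indicator u) =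
      curveExt ((cell j k).indicator ((mid u K j).indicator u)) +
      curveExt ((cell j k).indicator ((mid u K j)ᶜ.indicator u)) := by
    rw [← curveExt_add (integrable_wt_mul_indicator (integrable_wt_mul_indicator hi hM) hC)
      (integrable_wt_mul_indicator (integrable_wt_mul_indicator hi hM.compl) hC),
      ← Set.indicator_add', Set.indicator_self_add_compl]
  rw [eq_sub_of_add_eq hsum.symm, add_mul, ENNReal.ofReal_add (by positivity) (by positivity)]
  exact (enorm_sub_le).trans
    (add_le_add (hA j k p) (enorm_curveExt_compl_mid_le hu1 hK j k p))

theorem sub_lt_of_mem_mid {u : ℝ → ℂ} {K : ℝ} (hK : 0 < K) {n : ℕ} (hn : K ^ 4 < 2 ^ n) {ξ : ℝ}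
    {i j : ℤ} (hi : ξ ∈ mid u K i) (hj : ξ ∈ mid u K j) : j - i < n := by
  have hlow : 1 ≤ ‖u ξ‖ * √((2 : ℝ) ^ i) * K := (inv_le_iff_one_le_mul₀ hK).1 hi.1
  have hsqrt : √((2 : ℝ) ^ j) ≤ K ^ 2 * √((2 : ℝ) ^ i) := by
    calc √((2 : ℝ) ^ j) = 1 * √((2 : ℝ) ^ j) := (one_mul _).symm
      _ ≤ (‖u ξ‖ * √((2 : ℝ) ^ i) * K) * √((2 : ℝ) ^ j) := by gcongr
      _ = (‖u ξ‖ * √((2 : ℝ) ^ j)) * (√((2 : ℝ) ^ i) * K) := by ring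
      _ ≤ K * (√((2 : ℝ) ^ i) * K) := by
          gcongr
          exact hj.2
      _ = K ^ 2 * √((2 : ℝ) ^ i) := by ring
  have hpow : (2 : ℝ) ^ j < 2 ^ (n + i) := by
    calc (2 : ℝ) ^ j = √((2 : ℝ) ^ j) ^ 2 := (Real.sq_sqrt (by positivity)).symm
      _ ≤ (K ^ 2 * √((2 : ℝ) ^ i)) ^ 2 := by gcongr
      _ = K ^ 4 * (2 : ℝ) ^ i := by
          rw [mul_pow, Real.sq_sqrt (by positivity)]
          ring
      _ < 2 ^ n * (2 : ℝ) ^ i := by gcongr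
      _ = (2 : ℝ) ^ (n + i) := by rw [zpow_add₀ two_ne_zero, zpow_natCast]
  rw [sub_lt_iff_lt_add]
  exact (zpow_lt_zpow_iff_right₀ one_lt_two).1 hpow

theorem tsum_indicator_mid_le (u : ℝ → ℂ) {K : ℝ} (hK : 0 < K) {n : ℕ} (hn : K ^ 4 < 2 ^ n)
    (ξ : ℝ) : ∑' j, (mid u K j).indicator (fun _ => (1 : ℝ≥0∞)) ξ ≤ 2 * n := by
  by_cases hne : ∃ i, ξ ∈ mid u K i
  · obtain ⟨i, hi⟩ := hne
    have hsupp : ∀ j ∉ Finset.Ico (i - n) (i + n),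
        (mid u K j).indicator (fun _ => (1 : ℝ≥0∞)) ξ = 0 := by
      refine fun _ hj => Set.indicator_of_notMem (fun hjm => hj ?_) _
      have := sub_lt_of_mem_mid hK hn hi hjm
      have := sub_lt_of_mem_mid hK hn hjm hi
      rw [Finset.mem_Ico]
      lia
    calc ∑' j, (mid u K j).indicator (fun _ => (1 : ℝ≥0∞)) ξ
      _ ≤ ∑ _j ∈ Finset.Ico (i - n) (i + n), (1 : ℝ≥0∞) := by
        rw [tsum_eq_sum hsupp]
        exact Finset.sum_le_sum fun _ _ => Set.indicator_le_self' (fun _ _ => zero_le) ξ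
      _ = 2 * n := by
        rw [Finset.sum_const, Int.card_Ico, show (i + n - (i - n)).toNat = 2 * n by lia]
        simp
  · simp [Set.indicator_of_notMem (not_exists.1 hne _)]

theorem tsum_lintegral_cell_le (j : ℤ) (F : ℝ → ℝ≥0∞) :
    ∑' k, ∫⁻ ξ in cell j k, F ξ ≤ ∫⁻ ξ, F ξ := by
  have hdisj : Pairwise (Function.onFun Disjoint (cell j)) := fun k k' hkk' =>
    Set.disjoint_left.2 fun ξ hξ hξ' => hkk' ((mem_cell_iff.1 hξ).symm.trans (mem_cell_iff.1 hξ'))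
  rw [← lintegral_iUnion (measurableSet_cell j) hdisj]
  exact setLIntegral_le_lintegral _ _

/-- The mass in a dyadic interval of the part of `u` that is comparable to the inverse square root
of the length. -/
def midMass (u : ℝ → ℂ) (K : ℝ) (j k : ℤ) : ℝ≥0∞ :=
  ∫⁻ ξ in cell j k, ‖(mid u K j).indicator u ξ‖ₑ ^ 2

theorem tsum_midMass_le {u : ℝ → ℂ} (hu : Measurable u) (hu1 : ∫⁻ ξ, ‖u ξ‖ₑ ^ 2 ≤ 1)
    {K : ℝ} (hK : 0 < K) {n : ℕ} (hn : K ^ 4 < 2 ^ n) :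
    ∑' j, ∑' k, midMass u K j k ≤ 2 * n := by
  have hterm (j : ℤ) (ξ : ℝ) : ‖(mid u K j).indicator u ξ‖ₑ ^ 2 =
      (mid u K j).indicator (fun _ => (1 : ℝ≥0∞)) ξ * ‖u ξ‖ₑ ^ 2 := by
    by_cases h : ξ ∈ mid u K j <;> simp [h]
  have hmeas (j : ℤ) : Measurable fun ξ => ‖(mid u K j).indicator u ξ‖ₑ ^ 2 :=
    (hu.indicator (measurableSet_mid hu K j)).enorm.pow_const 2
  calc ∑' j, ∑' k, midMass u K j k ≤ ∑' j, ∫⁻ ξ, ‖(mid u K j).indicator u ξ‖ₑ ^ 2 :=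
        ENNReal.tsum_le_tsum fun j => tsum_lintegral_cell_le j _
    _ = ∫⁻ ξ, (∑' j, (mid u K j).indicator (fun _ => (1 : ℝ≥0∞)) ξ) * ‖u ξ‖ₑ ^ 2 := by
        rw [← lintegral_tsum fun j => (hmeas j).aemeasurable]
        simp only [hterm, ENNReal.tsum_mul_right]
    _ ≤ ∫⁻ ξ, 2 * n * ‖u ξ‖ₑ ^ 2 := by
        gcongr with ξ
        exact tsum_indicator_mid_le u hK hn ξ
    _ ≤ 2 * n * 1 := by
        rw [lintegral_const_mul' _ _ (by finiteness)]
        gcongr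
    _ = 2 * n := mul_one _

theorem tsum_whitney_midMass_le {u : ℝ → ℂ} (hu : Measurable u) (hu1 : ∫⁻ ξ, ‖u ξ‖ₑ ^ 2 ≤ 1)
    {K : ℝ} (hK : 0 < K) {n : ℕ} (hn : K ^ 4 < 2 ^ n) :
    ∑' i : ℤ × ℤ × Bool, (midMass u K i.1 i.2.1 + midMass u K i.1 (i.2.1 + offset i.2.2)) ≤
      8 * n := by
  have hshift (j c : ℤ) : ∑' k, midMass u K j (k + c) = ∑' k, midMass u K j k :=
    (Equiv.addRight c).tsum_eq (midMass u K j)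
  calc ∑' i : ℤ × ℤ × Bool, (midMass u K i.1 i.2.1 + midMass u K i.1 (i.2.1 + offset i.2.2))
    _ = ∑' j, 4 * ∑' k, midMass u K j k := by
      rw [ENNReal.tsum_prod (f := fun j (q : ℤ × Bool) =>
        midMass u K j q.1 + midMass u K j (q.1 + offset q.2))]
      congr 1 with j
      rw [ENNReal.tsum_prod (f := fun k b => midMass u K j k + midMass u K j (k + offset b))]
      simp only [tsum_bool, ENNReal.tsum_add, hshift]
      ring
    _ ≤ 4 * (2 * n) := by
      rw [ENNReal.tsum_mul_left]
      gcongr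
      exact tsum_midMass_le hu hu1 hK hn
    _ = 8 * n := by ring

theorem midMass_ne_top {u : ℝ → ℂ} (hu1 : ∫⁻ ξ, ‖u ξ‖ₑ ^ 2 ≤ 1) (K : ℝ) (j k : ℤ) :
    midMass u K j k ≠ ∞ := by
  refine ne_top_of_le_ne_top ENNReal.one_ne_top (le_trans ?_ hu1)
  refine (setLIntegral_le_lintegral _ _).trans (lintegral_mono fun ξ => ?_)
  gcongr
  exact enorm_indicator_le_enorm_self u ξ

theorem midMass_of_neg {u : ℝ → ℂ} (hu0 : ∀ ξ ≤ 0, u ξ = 0) (K : ℝ) {j k : ℤ} (hk : k < 0) :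
    midMass u K j k = 0 := by
  refine setLIntegral_eq_zero (measurableSet_cell j k) fun ξ hξ => ?_
  simp [Set.indicator, hu0 ξ (cell_subset_Iio hk hξ).le]

theorem indicator_midPairs_pairDensity {u : ℝ → ℂ} {K : ℝ} {i : ℤ × ℤ × Bool} {z : ℝ × ℝ}
    (hz : z ∈ whitney i) : (midPairs u K).indicator (pairDensity u) z =
      pairDensity ((mid u K i.1).indicator u) z := by
  by_cases h : z ∈ midPairs u K
  · rw [Set.indicator_of_mem h]
    rw [mem_midPairs_iff hz] at h
    simp [pairDensity, Set.indicator_of_mem h.1, Set.indicator_of_mem h.2]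
  · rw [Set.indicator_of_notMem h]
    rw [mem_midPairs_iff hz, Set.mem_prod, not_and_or] at h
    rcases h with h | h <;> simp [pairDensity, Set.indicator_of_notMem h]

theorem lt_of_mem_whitney {i : ℤ × ℤ × Bool} {z : ℝ × ℝ} (hz : z ∈ whitney i) : z.1 < z.2 := by
  have h : (0 : ℝ) < 2 ^ i.1 := by positivity
  linarith [(sub_mem_Icc_of_mem_whitney hz).1]

theorem oscInt_whitney {u : ℝ → ℂ} (hu0 : ∀ ξ ≤ 0, u ξ = 0) (K : ℝ) {i : ℤ × ℤ × Bool}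
    (he : i.2.2 = true → Even i.2.1) (p : Plane) :
    oscInt ((volume.restrict pairs).restrict (whitney i)) curveSum
        ((midPairs u K).indicator (pairDensity u)) p =
      curveExt ((cell i.1 i.2.1).indicator ((mid u K i.1).indicator u)) p *
      curveExt ((cell i.1 (i.2.1 + offset i.2.2)).indicator ((mid u K i.1).indicator u)) p := by
  have hW := measurableSet_whitney i
  rw [← oscInt_curveSum_prod (measurableSet_cell _ _) (measurableSet_cell _ _), ← whitney_eq he,
    Measure.restrict_restrict hW]
  unfold oscInt
  calc ∫ z in whitney i ∩ pairs, Complex.exp (Complex.I * (inner ℝ p (curveSum z) : ℝ)) *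
        (midPairs u K).indicator (pairDensity u) z
    _ = ∫ z in whitney i ∩ pairs, Complex.exp (Complex.I * (inner ℝ p (curveSum z) : ℝ)) *
        pairDensity ((mid u K i.1).indicator u) z :=
      setIntegral_congr_fun (hW.inter measurableSet_pairs) fun z hz => by
        simp only [indicator_midPairs_pairDensity hz.1]
    _ = _ := by
      refine (setIntegral_eq_of_subset_of_forall_sdiff_eq_zero hW Set.inter_subset_left
        fun z hz => ?_).symm
      have hfst : z.1 ≤ 0 := not_lt.1 fun h => hz.2 ⟨hz.1, h, lt_of_mem_whitney hz.1⟩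
      simp [pairDensity, Set.indicator, hu0 _ hfst]

theorem enorm_oscInt_whitney_le {u : ℝ → ℂ} (hu : Measurable u) (hu0 : ∀ ξ ≤ 0, u ξ = 0)
    (hi : Integrable fun ξ => (wt ξ : ℂ) * u ξ) (hu1 : ∫⁻ ξ, ‖u ξ‖ₑ ^ 2 ≤ 1)
    {K : ℝ} (hK : 0 < K) {A : ℝ} (hA0 : 0 ≤ A) (hA : DyadicBound u A) (i : ℤ × ℤ × Bool)
    (p : Plane) :
    ‖oscInt ((volume.restrict pairs).restrict (whitney i)) curveSum
        ((midPairs u K).indicator (pairDensity u)) p‖ₑ ≤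
      ENNReal.ofReal ((A + 4 / K) * cellScale i.1 i.2.1 *
        ((A + 4 / K) * cellScale i.1 (i.2.1 + offset i.2.2))) := by
  by_cases he : i.2.2 = true → Even i.2.1
  · rw [oscInt_whitney hu0 K he, enorm_mul,
      ENNReal.ofReal_mul (by positivity [cellScale_nonneg i.1 i.2.1])]
    gcongr <;> exact enorm_curveExt_mid_le hu hi hu1 hK hA0 hA _ _ p
  · simp [whitney_eq_empty he, oscInt]

theorem le_add_offset (k : ℤ) (b : Bool) : k + 2 ≤ k + offset b := by
  cases b <;> simp [offset]

theorem enorm_pairDensity_sq_div_jac_le {j k : ℤ} {b : Bool} {z : ℝ × ℝ}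
    (hz : z ∈ whitney (j, k, b)) (hzp : z ∈ pairs) (g : ℝ → ℂ) :
    ‖pairDensity g z‖ₑ ^ 2 / ENNReal.ofReal (jac z) ≤
      ENNReal.ofReal (4 / ((2 : ℝ) ^ j * wt (cellCenter j (k + offset b)) ^ 2)) *
        (‖g z.1‖ₑ ^ 2 * ‖g z.2‖ₑ ^ 2) := by
  have hk : 0 ≤ k := not_lt.1 fun h => hzp.1.not_gt (cell_subset_Iio h hz.1.1)
  have hl := le_add_offset k b
  have hcenter := wt_pos (cellCenter_pos (j := j) (k := k + offset b) (by lia))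
  have hwt := wt_cellCenter_le_of_mem_cell (by lia) hz.1.2
  have hW : 0 < wt z.2 := wt_pos (hzp.1.trans hzp.2)
  have hjac : (2 : ℝ) ^ j * wt z.2 ^ 6 ≤ jac z :=
    (mul_le_mul_of_nonneg_right (sub_mem_Icc_of_mem_whitney hz).1 (by positivity)).trans
      (mul_wt_pow_six_le_jac hzp)
  rw [← ofReal_norm_sq, ← ofReal_norm_sq, ← ofReal_norm_sq, ← ENNReal.ofReal_mul (by positivity),
    ← ENNReal.ofReal_mul (by positivity), ← ENNReal.ofReal_div_of_pos (jac_pos hzp)]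
  refine ENNReal.ofReal_le_ofReal ?_
  calc ‖pairDensity g z‖ ^ 2 / jac z
    _ ≤ (wt z.2 ^ 2 * (‖g z.1‖ * ‖g z.2‖)) ^ 2 / ((2 : ℝ) ^ j * wt z.2 ^ 6) := by
      gcongr
      exact norm_pairDensity_le hzp g
    _ = 4 / ((2 : ℝ) ^ j * (2 * wt z.2) ^ 2) * (‖g z.1‖ ^ 2 * ‖g z.2‖ ^ 2) := by
      field_simp
      norm_num
    _ ≤ _ := by gcongr

theorem lintegral_whitney_le {u : ℝ → ℂ} (hu : Measurable u) (hu1 : ∫⁻ ξ, ‖u ξ‖ₑ ^ 2 ≤ 1) (K : ℝ)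
    (i : ℤ × ℤ × Bool) :
    ∫⁻ z in whitney i, ‖(midPairs u K).indicator (pairDensity u) z‖ₑ ^ 2 /
        ENNReal.ofReal (jac z) ∂(volume.restrict pairs) ≤
      ENNReal.ofReal (4 / ((2 : ℝ) ^ i.1 * wt (cellCenter i.1 (i.2.1 + offset i.2.2)) ^ 2) *
        ((midMass u K i.1 i.2.1).toReal * (midMass u K i.1 (i.2.1 + offset i.2.2)).toReal)) := by
  by_cases he : i.2.2 = true → Even i.2.1
  swap
  · simp [whitney_eq_empty he]
  have hW := measurableSet_whitney i
  set g := (mid u K i.1).indicator u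
  set c := ENNReal.ofReal (4 / ((2 : ℝ) ^ i.1 * wt (cellCenter i.1 (i.2.1 + offset i.2.2)) ^ 2))
  have hgm : Measurable g := hu.indicator (measurableSet_mid hu K i.1)
  calc ∫⁻ z in whitney i, ‖(midPairs u K).indicator (pairDensity u) z‖ₑ ^ 2 /
        ENNReal.ofReal (jac z) ∂(volume.restrict pairs)
    _ ≤ ∫⁻ z in whitney i ∩ pairs, c * (‖g z.1‖ₑ ^ 2 * ‖g z.2‖ₑ ^ 2) := by
      rw [Measure.restrict_restrict hW]
      refine setLIntegral_mono' (hW.inter measurableSet_pairs) fun z hz => ?_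
      rw [indicator_midPairs_pairDensity hz.1]
      exact enorm_pairDensity_sq_div_jac_le hz.1 hz.2 g
    _ ≤ ∫⁻ z in whitney i, c * (‖g z.1‖ₑ ^ 2 * ‖g z.2‖ₑ ^ 2) :=
      lintegral_mono_set Set.inter_subset_left
    _ = c * (midMass u K i.1 i.2.1 * midMass u K i.1 (i.2.1 + offset i.2.2)) := by
      rw [whitney_eq he, lintegral_const_mul' _ _ ENNReal.ofReal_ne_top, Measure.volume_eq_prod,
        ← Measure.prod_restrict, lintegral_prod_mul (f := fun ξ => ‖g ξ‖ₑ ^ 2)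
          (g := fun ξ => ‖g ξ‖ₑ ^ 2) (by fun_prop) (by fun_prop)]
      rfl
    _ = _ := by
      rw [ENNReal.ofReal_mul (by positivity), ENNReal.ofReal_mul (by positivity),
        ENNReal.ofReal_toReal (midMass_ne_top hu1 K _ _),
        ENNReal.ofReal_toReal (midMass_ne_top hu1 K _ _)]

theorem sqrt_mul_scale_mass_le {B s w w' m m' : ℝ} (hB : 0 ≤ B) (hs : 0 < s)
    (hw' : 0 < w') (hww' : w ≤ w') (hm : 0 ≤ m) (hm' : 0 ≤ m') :
    √(B * (w * √s) * (B * (w' * √s)) * (4 / (s * w' ^ 2) * (m * m'))) ≤ B * (m + m') := by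
  refine Real.sqrt_le_iff.2 ⟨by positivity, ?_⟩
  calc B * (w * √s) * (B * (w' * √s)) * (4 / (s * w' ^ 2) * (m * m'))
    _ = B ^ 2 * (4 * (m * m')) * (w / w') := by
      rw [show B * (w * √s) * (B * (w' * √s)) = B ^ 2 * (w * w') * √s ^ 2 by ring,
        Real.sq_sqrt hs.le]
      field_simp
    _ ≤ B ^ 2 * (4 * (m * m')) * 1 := by
      gcongr
      exact (div_le_one hw').2 hww'
    _ ≤ (B * (m + m')) ^ 2 := by nlinarith [mul_nonneg (sq_nonneg B) (sq_nonneg (m - m'))]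

theorem ofReal_sqrt_scale_midMass_le {u : ℝ → ℂ} (hu0 : ∀ ξ ≤ 0, u ξ = 0)
    (hu1 : ∫⁻ ξ, ‖u ξ‖ₑ ^ 2 ≤ 1) (K : ℝ) {B : ℝ} (hB : 0 ≤ B) (j k : ℤ) (b : Bool) :
    ENNReal.ofReal √(B * cellScale j k * (B * cellScale j (k + offset b)) *
        (4 / ((2 : ℝ) ^ j * wt (cellCenter j (k + offset b)) ^ 2) *
          ((midMass u K j k).toReal * (midMass u K j (k + offset b)).toReal))) ≤
      ENNReal.ofReal B * (midMass u K j k + midMass u K j (k + offset b)) := by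
  rcases lt_or_ge k 0 with hk | hk
  · simp [midMass_of_neg hu0 K hk]
  have hl := le_add_offset k b
  calc _ ≤ ENNReal.ofReal
          (B * ((midMass u K j k).toReal + (midMass u K j (k + offset b)).toReal)) :=
        ENNReal.ofReal_le_ofReal (sqrt_mul_scale_mass_le hB (by positivity)
          (wt_pos (cellCenter_pos (by lia))) (wt_cellCenter_le hk (by lia))
          ENNReal.toReal_nonneg ENNReal.toReal_nonneg)
    _ = ENNReal.ofReal B * (midMass u K j k + midMass u K j (k + offset b)) := by
        rw [ENNReal.ofReal_mul hB, ENNReal.ofReal_add (by positivity) (by positivity),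
          ENNReal.ofReal_toReal (midMass_ne_top hu1 K _ _),
          ENNReal.ofReal_toReal (midMass_ne_top hu1 K _ _)]

/-- The extension operator is almost orthogonal across the Whitney squares, because only boundedly
many scales meet any one frequency in `mid`. -/
theorem lintegral_oscInt_midPairs_le {u : ℝ → ℂ} (hu : Measurable u) (hu0 : ∀ ξ ≤ 0, u ξ = 0)
    (hi : Integrable fun ξ => (wt ξ : ℂ) * u ξ) (hu1 : ∫⁻ ξ, ‖u ξ‖ₑ ^ 2 ≤ 1)
    {K : ℝ} (hK : 0 < K) {n : ℕ} (hn : K ^ 4 < 2 ^ n) (hn0 : 0 < n) {A : ℝ} (hA0 : 0 ≤ A)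
    (hA : DyadicBound u A) :
    ∫⁻ p, ‖oscInt (volume.restrict pairs) curveSum
        ((midPairs u K).indicator (pairDensity u)) p‖ₑ ^ 3 ≤
      ENNReal.ofReal
        (24 * (2 * Real.pi) ^ Module.finrank ℝ Plane * ((A + 4 / K) * (8 * n)) ^ 2) := by
  have hint : Integrable (pairDensity u) := hi.mul_prod hi
  have hcover : ∀ᵐ z ∂volume.restrict pairs, z ∈ ⋃ i, whitney i :=
    (ae_restrict_mem measurableSet_pairs).mono fun z hz => Set.mem_iUnion.2 (exists_mem_whitney hz)
  have hB : 0 < A + 4 / K := by positivity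
  refine lintegral_oscInt_cube_le_partition isDominatedParam_curveSum
    (hint.indicator (measurableSet_midPairs hu K)).integrableOn measurableSet_whitney
    pairwise_disjoint_whitney hcover
    (fun i => by
      positivity [cellScale_nonneg i.1 i.2.1, cellScale_nonneg i.1 (i.2.1 + offset i.2.2)])
    (fun i => by positivity)
    (enorm_oscInt_whitney_le hu hu0 hi hu1 hK hA0 hA) (lintegral_whitney_le hu hu1 K)
    (by positivity) ?_
  calc _ ≤ ∑' i : ℤ × ℤ × Bool, ENNReal.ofReal (A + 4 / K) *
          (midMass u K i.1 i.2.1 + midMass u K i.1 (i.2.1 + offset i.2.2)) :=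
        ENNReal.tsum_le_tsum fun i => ofReal_sqrt_scale_midMass_le hu0 hu1 K hB.le _ _ _
    _ ≤ ENNReal.ofReal (A + 4 / K) * (8 * n) := by
        rw [ENNReal.tsum_mul_left]
        gcongr
        exact tsum_whitney_midMass_le hu hu1 hK hn
    _ = ENNReal.ofReal ((A + 4 / K) * (8 * n)) := by
        rw [ENNReal.ofReal_mul hB.le, ENNReal.ofReal_mul (by norm_num), ENNReal.ofReal_ofNat,
          ENNReal.ofReal_natCast]

end Comparable

section SixthPower

theorem enorm_add_pow_le (x y : ℂ) (n : ℕ) :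
    ‖x + y‖ₑ ^ (n + 1) ≤ 2 ^ n * (‖x‖ₑ ^ (n + 1) + ‖y‖ₑ ^ (n + 1)) := by
  refine (pow_le_pow_left' (enorm_add_le x y) _).trans ?_
  have h := ENNReal.rpow_add_le_mul_rpow_add_rpow ‖x‖ₑ ‖y‖ₑ (p := (n + 1 : ℕ)) (by simp)
  rw [Nat.cast_succ, add_sub_cancel_right, ← Nat.cast_succ] at h
  simpa only [ENNReal.rpow_natCast] using h

/-- The constant of the `L⁶` bound for normalized densities. -/
def extConst : ℝ := 32 * (24 * (2 * Real.pi) ^ Module.finrank ℝ Plane) * (4896 ^ 2 + 17 ^ 2)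

theorem extConst_pos : 0 < extConst := by
  unfold extConst
  positivity

theorem enorm_curveExt_pow_six_le {u : ℝ → ℂ} (hu : Measurable u) (hu0 : ∀ ξ ≤ 0, u ξ = 0)
    (hi : Integrable fun ξ => (wt ξ : ℂ) * u ξ) (K : ℝ) (p : Plane) :
    ‖curveExt u p‖ₑ ^ 6 ≤
      32 * ‖oscInt (volume.restrict pairs) curveSum
        ((midPairs u K).indicator (pairDensity u)) p‖ₑ ^ 3 +
      32 * ‖oscInt (volume.restrict pairs) curveSum
        ((midPairs u K)ᶜ.indicator (pairDensity u)) p‖ₑ ^ 3 := by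
  have hint : Integrable (pairDensity u) := hi.mul_prod hi
  have hP := measurableSet_midPairs hu K
  have hsplit := oscInt_add measurable_curveSum (hint.indicator hP).integrableOn
    (hint.indicator hP.compl).integrableOn (μ := volume.restrict pairs)
  rw [Set.indicator_self_add_compl] at hsplit
  calc ‖curveExt u p‖ₑ ^ 6 = ‖curveExt u p ^ 2‖ₑ ^ 3 := by rw [enorm_pow, ← pow_mul]
    _ = 2 ^ 3 * ‖oscInt (volume.restrict pairs) curveSum (pairDensity u) p‖ₑ ^ 3 := by
      rw [curveExt_sq hu0 hi, enorm_mul, mul_pow, ← ofReal_norm (2 : ℂ), Complex.norm_ofNat,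
        ENNReal.ofReal_ofNat]
    _ ≤ 2 ^ 3 * (2 ^ 2 * (_ + _)) := by
      rw [hsplit]
      gcongr
      exact enorm_add_pow_le _ _ 2
    _ = _ := by ring

theorem mainTerm_le (m : ℕ) : (32 / ((2 : ℝ) ^ m) ^ 4 + 4 / ((2 : ℝ) ^ m) ^ 4) *
    (8 * ((16 * m + 1 : ℕ) : ℝ)) ≤ 4896 / 2 ^ m := by
  have hL : (1 : ℝ) ≤ 2 ^ m := one_le_pow₀ one_le_two
  have hm : (m : ℝ) ≤ 2 ^ m := by exact_mod_cast Nat.lt_two_pow_self.le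
  push_cast
  generalize (2 : ℝ) ^ m = L at hL hm ⊢
  calc (32 / L ^ 4 + 4 / L ^ 4) * (8 * (16 * (m : ℝ) + 1))
    _ ≤ (32 / L ^ 4 + 4 / L ^ 4) * (8 * (16 * L + L)) := by gcongr
    _ = 4896 / L ^ 3 := by
      field_simp
      norm_num
    _ ≤ 4896 / L := by
      gcongr
      exact le_self_pow₀ hL three_ne_zero

theorem lintegral_curveExt_pow_six_le_of_normalized {u : ℝ → ℂ} (hu : Measurable u)
    (hu0 : ∀ ξ ≤ 0, u ξ = 0) (hi : Integrable fun ξ => (wt ξ : ℂ) * u ξ)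
    (hu1 : ∫⁻ ξ, ‖u ξ‖ₑ ^ 2 ≤ 1) {m : ℕ} (hm : 1 ≤ m)
    (hA : DyadicBound u (32 / ((2 : ℝ) ^ m) ^ 4)) :
    ∫⁻ p, ‖curveExt u p‖ₑ ^ 6 ≤ ENNReal.ofReal (extConst / ((2 : ℝ) ^ m) ^ 2) := by
  set L : ℝ := 2 ^ m with hL
  have hL2 : 2 ≤ L := le_self_pow₀ one_le_two (by lia)
  have hL0 : 0 < L := two_pos.trans_le hL2
  have hn : (L ^ 4) ^ 4 < 2 ^ (16 * m + 1) := by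
    rw [hL, ← pow_mul, ← pow_mul]
    exact pow_lt_pow_right₀ one_lt_two (by lia)
  have hint : Integrable (pairDensity u) := hi.mul_prod hi
  have hP := measurableSet_midPairs hu (L ^ 4)
  have hrestInt : Integrable ((midPairs u (L ^ 4))ᶜ.indicator (pairDensity u))
      (volume.restrict pairs) := (hint.indicator hP.compl).integrableOn
  have hmain := lintegral_oscInt_midPairs_le hu hu0 hi hu1 (pow_pos hL0 4) hn (by lia)
    (by positivity) hA
  have hrest := lintegral_oscInt_cube_le_hausdorffYoung isDominatedParam_curveSum hrestInt
    ((measurable_pairDensity hu).indicator hP.compl) (div_pos (by norm_num) hL0)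
    (lintegral_compl_midPairs_le hu hu1 hL2)
  have hmeas := (continuous_oscInt measurable_curveSum hrestInt).measurable
  calc ∫⁻ p, ‖curveExt u p‖ₑ ^ 6
    _ ≤ 32 * (∫⁻ p, ‖oscInt (volume.restrict pairs) curveSum
          ((midPairs u (L ^ 4)).indicator (pairDensity u)) p‖ₑ ^ 3) +
        32 * ∫⁻ p, ‖oscInt (volume.restrict pairs) curveSum
          ((midPairs u (L ^ 4))ᶜ.indicator (pairDensity u)) p‖ₑ ^ 3 := by
      refine (lintegral_mono (enorm_curveExt_pow_six_le hu hu0 hi (L ^ 4))).trans_eq ?_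
      rw [lintegral_add_right _ (by fun_prop), lintegral_const_mul' _ _ (by finiteness),
        lintegral_const_mul' _ _ (by finiteness)]
    _ ≤ ENNReal.ofReal 32 * ENNReal.ofReal
          (24 * (2 * Real.pi) ^ Module.finrank ℝ Plane * (4896 / L) ^ 2) +
        ENNReal.ofReal 32 * ENNReal.ofReal
          (24 * (2 * Real.pi) ^ Module.finrank ℝ Plane * (17 / L) ^ 2) := by
      rw [ENNReal.ofReal_ofNat]
      grw [hmain, hrest, mainTerm_le]
    _ = ENNReal.ofReal (extConst / L ^ 2) := by
      rw [← ENNReal.ofReal_mul (by norm_num), ← ENNReal.ofReal_mul (by norm_num),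
        ← ENNReal.ofReal_add (by positivity) (by positivity), extConst]
      congr 1
      ring

theorem exists_min_two_le_div_pow {A : ℝ} (hA : 0 < A) :
    ∃ m : ℕ, 1 ≤ m ∧ min A 2 ≤ 32 / ((2 : ℝ) ^ m) ^ 4 ∧ 1 / ((2 : ℝ) ^ m) ^ 2 ≤ √A := by
  obtain ⟨n, hlow, hupp⟩ := exists_nat_pow_near_of_lt_one (x := min A 2 / 2) (y := 1 / 16)
    (by positivity) (by linarith [min_le_right A 2]) (by norm_num) (by norm_num)
  have hpow : ((2 : ℝ) ^ (n + 1)) ^ 4 = 16 ^ (n + 1) := by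
    rw [pow_right_comm]
    norm_num
  rw [one_div, inv_pow] at hlow hupp
  refine ⟨n + 1, by lia, ?_, Real.le_sqrt_of_sq_le ?_⟩
  · rw [hpow, pow_succ, show (32 : ℝ) / (16 ^ n * 16) = 2 * (16 ^ n)⁻¹ by field_simp; norm_num]
    linarith
  · rw [one_div, inv_pow, ← pow_mul, hpow]
    linarith [min_le_left A 2]

theorem curveExt_const_mul (c : ℂ) (u : ℝ → ℂ) (p : Plane) :
    curveExt (fun ξ => c * u ξ) p = c * curveExt u p := by
  unfold curveExt oscInt
  rw [← integral_const_mul]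
  congr 1 with ξ
  ring

theorem DyadicBound.const_mul {u : ℝ → ℂ} {A : ℝ} (h : DyadicBound u A) (c : ℂ) :
    DyadicBound (fun ξ => c * u ξ) (‖c‖ * A) := by
  intro j k p
  have hcell : (cell j k).indicator (fun ξ => c * u ξ) = fun ξ => c * (cell j k).indicator u ξ :=
    funext fun _ => Set.indicator_const_mul _ _ _ _
  rw [hcell, curveExt_const_mul, enorm_mul, mul_assoc, ENNReal.ofReal_mul (norm_nonneg c),
    ofReal_norm]
  gcongr
  exact h j k p

theorem lintegral_curveExt_pow_six_le_of_lintegral_le_one {u : ℝ → ℂ} (hu : Measurable u)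
    (hu0 : ∀ ξ ≤ 0, u ξ = 0) (hi : Integrable fun ξ => (wt ξ : ℂ) * u ξ)
    (hu1 : ∫⁻ ξ, ‖u ξ‖ₑ ^ 2 ≤ 1) {A : ℝ} (hA0 : 0 < A) (hA : DyadicBound u A) :
    ∫⁻ p, ‖curveExt u p‖ₑ ^ 6 ≤ ENNReal.ofReal (extConst * √A) := by
  obtain ⟨m, hm, hAm, hmA⟩ := exists_min_two_le_div_pow hA0
  have htriv : DyadicBound u 2 := by
    simpa using dyadicBound_of_lintegral_sq_le hu zero_le_one (by simpa using hu1)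
  have hmin : DyadicBound u (min A 2) := by
    rcases min_choice A 2 with h | h <;> rwa [h]
  refine (lintegral_curveExt_pow_six_le_of_normalized hu hu0 hi hu1 hm (hmin.mono hAm)).trans
    (ENNReal.ofReal_le_ofReal ?_)
  rw [div_eq_mul_one_div]
  exact mul_le_mul_of_nonneg_left hmA extConst_pos.le

theorem lintegral_curveExt_pow_six_le_of_pos {u : ℝ → ℂ} (hu : Measurable u)
    (hu0 : ∀ ξ ≤ 0, u ξ = 0) (hi : Integrable fun ξ => (wt ξ : ℂ) * u ξ) {M : ℝ} (hM : 0 < M)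
    (hu1 : ∫⁻ ξ, ‖u ξ‖ₑ ^ 2 ≤ ENNReal.ofReal (M ^ 2)) {A : ℝ} (hA0 : 0 < A)
    (hA : DyadicBound u A) :
    ∫⁻ p, ‖curveExt u p‖ₑ ^ 6 ≤ ENNReal.ofReal (extConst * (M ^ 6 * √(A / M))) := by
  set c : ℂ := ((M⁻¹ : ℝ) : ℂ) with hc
  have hcn : ‖c‖ = M⁻¹ := by rw [hc, Complex.norm_real, Real.norm_of_nonneg (by positivity)]
  have hce : ‖c‖ₑ = ENNReal.ofReal M⁻¹ := by rw [← ofReal_norm, hcn]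
  have hci : Integrable fun ξ => (wt ξ : ℂ) * (c * u ξ) := by
    simpa only [mul_left_comm] using hi.const_mul c
  have hc1 : ∫⁻ ξ, ‖c * u ξ‖ₑ ^ 2 ≤ 1 := by
    simp only [enorm_mul, mul_pow]
    rw [lintegral_const_mul' _ _ (by finiteness), hce]
    calc _ ≤ ENNReal.ofReal M⁻¹ ^ 2 * ENNReal.ofReal (M ^ 2) := by gcongr
      _ = 1 := by
        rw [← ENNReal.ofReal_pow (by positivity), ← ENNReal.ofReal_mul (by positivity), ← mul_pow,
          inv_mul_cancel₀ hM.ne', one_pow, ENNReal.ofReal_one]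
  have hcA : DyadicBound (fun ξ => c * u ξ) (A / M) := by
    simpa only [hcn, inv_mul_eq_div] using hA.const_mul c
  have hnorm := lintegral_curveExt_pow_six_le_of_lintegral_le_one (by fun_prop)
    (fun ξ hξ => by rw [hu0 ξ hξ, mul_zero]) hci hc1 (by positivity) hcA
  have hscale (p : Plane) : ‖curveExt u p‖ₑ =
      ENNReal.ofReal M * ‖curveExt (fun ξ => c * u ξ) p‖ₑ := by
    rw [curveExt_const_mul, enorm_mul, hce, ← mul_assoc, ← ENNReal.ofReal_mul hM.le,
      mul_inv_cancel₀ hM.ne', ENNReal.ofReal_one, one_mul]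
  simp_rw [hscale, mul_pow]
  rw [lintegral_const_mul' _ _ (by finiteness), mul_left_comm, ENNReal.ofReal_mul (by positivity),
    ENNReal.ofReal_pow hM.le]
  gcongr

theorem curveExt_congr {u v : ℝ → ℂ} (h : u =ᵐ[volume] v) : curveExt u = curveExt v :=
  oscInt_congr (h.mono fun ξ hξ => by simp only [hξ])

theorem curveExt_comp_neg (u : ℝ → ℂ) (p : Plane) :
    curveExt (fun ξ => u (-ξ)) p = curveExt u (-p) := by
  have hodd (ξ : ℝ) : curve (-ξ) = -curve ξ := by
    simp only [curve, ← WithLp.toLp_neg, Prod.neg_mk]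
    congr 2
    ring
  unfold curveExt oscInt
  rw [← integral_neg_eq_self]
  simp only [neg_neg, wt_neg, hodd, inner_neg_right, inner_neg_left]

theorem neg_cell_ae_eq (j k : ℤ) : -cell j k =ᵐ[volume] cell j (-k - 1) := by
  have hleft : ((-k - 1 : ℤ) : ℝ) * 2 ^ j = -((k + 1) * 2 ^ j) := by
    push_cast
    ring
  have hright : (((-k - 1 : ℤ) : ℝ) + 1) * 2 ^ j = -(k * 2 ^ j) := by
    push_cast
    ring
  rw [cell, cell, Set.neg_Ico, hleft, hright]
  exact Ico_ae_eq_Ioc.symm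

theorem cellScale_neg (j k : ℤ) : cellScale j (-k - 1) = cellScale j k := by
  have hcenter : cellCenter j (-k - 1) = -cellCenter j k := by
    unfold cellCenter
    push_cast
    ring
  rw [cellScale, cellScale, hcenter, wt_neg]

theorem DyadicBound.comp_neg {u : ℝ → ℂ} {A : ℝ} (h : DyadicBound u A) :
    DyadicBound (fun ξ => u (-ξ)) A := by
  intro j k p
  have hreflect : (cell j k).indicator (fun ξ => u (-ξ)) =
      fun ξ => (-cell j k).indicator u (-ξ) := by
    funext ξ
    by_cases hξ : ξ ∈ cell j k <;> simp [hξ]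
  rw [hreflect, curveExt_comp_neg,
    curveExt_congr (indicator_ae_eq_of_ae_eq_set (neg_cell_ae_eq j k)), ← cellScale_neg]
  exact h j (-k - 1) (-p)

theorem DyadicBound.indicator_Ioi {u : ℝ → ℂ} {A : ℝ} (h : DyadicBound u A) :
    DyadicBound ((Set.Ioi 0).indicator u) A := by
  intro j k p
  rcases lt_or_ge k 0 with hk | hk
  · have hdisj : cell j k ∩ Set.Ioi 0 = ∅ :=
      (Set.Iio_disjoint_Ioi_same.mono_left (cell_subset_Iio hk)).inter_eq
    simp [Set.indicator_indicator, hdisj, curveExt, oscInt]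
  · have hcell : (cell j k ∩ Set.Ioi 0 : Set ℝ) =ᵐ[volume] cell j k := by
      refine ((ae_eq_refl _).inter Ioi_ae_eq_Ici).trans (Eq.eventuallyEq ?_)
      exact Set.inter_eq_left.2 (cell_subset_Ici hk)
    rw [Set.indicator_indicator, curveExt_congr (indicator_ae_eq_of_ae_eq_set hcell)]
    exact h j k p

theorem lintegral_curveExt_Ioi_pow_six_le {u : ℝ → ℂ} (hu : Measurable u)
    (hi : Integrable fun ξ => (wt ξ : ℂ) * u ξ) {M : ℝ} (hM : 0 < M)
    (hu1 : ∫⁻ ξ, ‖u ξ‖ₑ ^ 2 ≤ ENNReal.ofReal (M ^ 2)) {A : ℝ} (hA0 : 0 < A)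
    (hA : DyadicBound u A) :
    ∫⁻ p, ‖curveExt ((Set.Ioi 0).indicator u) p‖ₑ ^ 6 ≤
      ENNReal.ofReal (extConst * (M ^ 6 * √(A / M))) := by
  refine lintegral_curveExt_pow_six_le_of_pos (hu.indicator measurableSet_Ioi)
    (fun ξ hξ => Set.indicator_of_notMem (by simpa using hξ) _)
    (integrable_wt_mul_indicator hi measurableSet_Ioi) hM
    ((lintegral_mono fun ξ => ?_).trans hu1) hA0 hA.indicator_Ioi
  gcongr
  exact enorm_indicator_le_enorm_self u ξ

theorem curveExt_eq_add_Ioi {u : ℝ → ℂ} (hi : Integrable fun ξ => (wt ξ : ℂ) * u ξ) (p : Plane) :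
    curveExt u p = curveExt ((Set.Ioi 0).indicator u) p +
      curveExt ((Set.Ioi 0).indicator fun ξ => u (-ξ)) (-p) := by
  have hreflect : (fun ξ => (Set.Ioi 0).indicator (fun ξ => u (-ξ)) (-ξ)) =
      (Set.Iio 0).indicator u := by
    funext ξ
    by_cases hξ : ξ < 0 <;> simp [hξ]
  have hcompl : (Set.Iio 0).indicator u =ᵐ[volume] (Set.Ioi 0)ᶜ.indicator u := by
    rw [Set.compl_Ioi]
    exact indicator_ae_eq_of_ae_eq_set Iio_ae_eq_Iic
  rw [← curveExt_comp_neg, hreflect, curveExt_congr hcompl, ← Pi.add_apply, ← curveExt_add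
    (integrable_wt_mul_indicator hi measurableSet_Ioi)
    (integrable_wt_mul_indicator hi measurableSet_Ioi.compl), Set.indicator_self_add_compl]

theorem continuous_curveExt {u : ℝ → ℂ} (hi : Integrable fun ξ => (wt ξ : ℂ) * u ξ) :
    Continuous (curveExt u) :=
  continuous_oscInt measurable_curve hi

theorem lintegral_curveExt_pow_six_le {u : ℝ → ℂ} (hu : Measurable u)
    (hi : Integrable fun ξ => (wt ξ : ℂ) * u ξ) {M : ℝ} (hM : 0 < M)
    (hu1 : ∫⁻ ξ, ‖u ξ‖ₑ ^ 2 ≤ ENNReal.ofReal (M ^ 2)) {A : ℝ} (hA0 : 0 < A)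
    (hA : DyadicBound u A) :
    ∫⁻ p, ‖curveExt u p‖ₑ ^ 6 ≤ ENNReal.ofReal (64 * extConst * (M ^ 6 * √(A / M))) := by
  set v : ℝ → ℂ := fun ξ => u (-ξ)
  have hvi : Integrable fun ξ => (wt ξ : ℂ) * v ξ := by
    simpa only [wt_neg] using hi.comp_neg
  have hv1 : ∫⁻ ξ, ‖v ξ‖ₑ ^ 2 ≤ ENNReal.ofReal (M ^ 2) :=
    (lintegral_neg_eq_self fun ξ => ‖u ξ‖ₑ ^ 2).trans_le hu1
  have hpos := lintegral_curveExt_Ioi_pow_six_le hu hi hM hu1 hA0 hA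
  have hneg : ∫⁻ p, ‖curveExt ((Set.Ioi 0).indicator v) p‖ₑ ^ 6 ≤
      ENNReal.ofReal (extConst * (M ^ 6 * √(A / M))) :=
    lintegral_curveExt_Ioi_pow_six_le (hu.comp measurable_neg) hvi hM hv1 hA0 hA.comp_neg
  have hmeas : Measurable (curveExt ((Set.Ioi 0).indicator u)) :=
    (continuous_curveExt (integrable_wt_mul_indicator hi measurableSet_Ioi)).measurable
  calc ∫⁻ p, ‖curveExt u p‖ₑ ^ 6
    _ ≤ ∫⁻ p, 2 ^ 5 * (‖curveExt ((Set.Ioi 0).indicator u) p‖ₑ ^ 6 +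
          ‖curveExt ((Set.Ioi 0).indicator v) (-p)‖ₑ ^ 6) := by
      gcongr with p
      rw [curveExt_eq_add_Ioi hi]
      exact enorm_add_pow_le _ _ 5
    _ = 2 ^ 5 * (∫⁻ p, ‖curveExt ((Set.Ioi 0).indicator u) p‖ₑ ^ 6) +
          2 ^ 5 * ∫⁻ p, ‖curveExt ((Set.Ioi 0).indicator v) p‖ₑ ^ 6 := by
      rw [lintegral_const_mul' _ _ (by finiteness), lintegral_add_left (by fun_prop), mul_add,
        lintegral_neg_eq_self fun p => ‖curveExt ((Set.Ioi 0).indicator v) p‖ₑ ^ 6]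
    _ ≤ 2 ^ 5 * ENNReal.ofReal (extConst * (M ^ 6 * √(A / M))) +
          2 ^ 5 * ENNReal.ofReal (extConst * (M ^ 6 * √(A / M))) := by gcongr
    _ = ENNReal.ofReal (64 * extConst * (M ^ 6 * √(A / M))) := by
      rw [mul_assoc 64, ENNReal.ofReal_mul (p := 64) (by norm_num), ENNReal.ofReal_ofNat]
      ring

theorem eLpNorm_six_le {α : Type*} [MeasurableSpace α] {μ : Measure α} {F : α → ℂ} {c : ℝ}
    (hc : 0 ≤ c) (h : ∫⁻ p, ‖F p‖ₑ ^ 6 ∂μ ≤ ENNReal.ofReal (c ^ 6)) :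
    eLpNorm F 6 μ ≤ ENNReal.ofReal c := by
  have h6 : eLpNorm F 6 μ ^ 6 = ∫⁻ p, ‖F p‖ₑ ^ 6 ∂μ := by
    simpa using eLpNorm_nnreal_pow_eq_lintegral (f := F) (μ := μ) (p := 6) (by norm_num)
  rw [← ENNReal.pow_le_pow_left_iff (n := 6) (by norm_num), ← ENNReal.ofReal_pow hc, h6]
  exact h

theorem rpow_mul_rpow_pow_six {C A M : ℝ} (hC : 0 ≤ C) (hA : 0 ≤ A) (hM : 0 < M) :
    (C ^ (1 / 6 : ℝ) * (A ^ (1 / 12 : ℝ) * M ^ (1 - 1 / 12 : ℝ))) ^ 6 =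
      C * (M ^ 6 * √(A / M)) := by
  have hpow (x : ℝ) (hx : 0 ≤ x) (r : ℝ) : (x ^ r) ^ 6 = x ^ (r * 6) := by
    rw [← Real.rpow_natCast, ← Real.rpow_mul hx, Nat.cast_ofNat]
  rw [mul_pow, mul_pow, hpow C hC, hpow A hA, hpow M hM.le, Real.sqrt_eq_rpow,
    Real.div_rpow hA hM.le, mul_div_left_comm, ← Real.rpow_natCast M 6, ← Real.rpow_sub hM]
  norm_num

theorem eLpNorm_curveExt_le_of_pos {u : ℝ → ℂ} (hu : Measurable u)
    (hi : Integrable fun ξ => (wt ξ : ℂ) * u ξ) {M : ℝ} (hM : 0 < M)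
    (hu1 : ∫⁻ ξ, ‖u ξ‖ₑ ^ 2 ≤ ENNReal.ofReal (M ^ 2)) {A : ℝ} (hA0 : 0 < A)
    (hA : DyadicBound u A) :
    eLpNorm (curveExt u) 6 volume ≤ ENNReal.ofReal
      ((64 * extConst) ^ (1 / 6 : ℝ) * (A ^ (1 / 12 : ℝ) * M ^ (1 - 1 / 12 : ℝ))) := by
  have hC : 0 ≤ 64 * extConst := mul_nonneg (by norm_num) extConst_pos.le
  refine eLpNorm_six_le (by positivity) ?_
  rw [rpow_mul_rpow_pow_six hC hA0.le hM]
  exact lintegral_curveExt_pow_six_le hu hi hM hu1 hA0 hA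

theorem lintegral_enorm_sq_eq {α : Type*} [MeasurableSpace α] {μ : Measure α} {F : α → ℂ}
    (hF : MemLp F 2 μ) :
    ∫⁻ x, ‖F x‖ₑ ^ 2 ∂μ = ENNReal.ofReal ((eLpNorm F 2 μ).toReal ^ 2) := by
  rw [ENNReal.ofReal_pow ENNReal.toReal_nonneg, ENNReal.ofReal_toReal hF.eLpNorm_ne_top]
  simpa using (eLpNorm_nnreal_pow_eq_lintegral (f := F) (μ := μ) (p := 2) two_ne_zero).symm

/-- The constant of the `L⁶` bound for the extension operator. -/
def curveExtConst : ℝ := (64 * extConst) ^ (1 / 6 : ℝ)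

theorem curveExtConst_nonneg : 0 ≤ curveExtConst := by
  have := extConst_pos
  unfold curveExtConst
  positivity

theorem eLpNorm_curveExt_le {u : ℝ → ℂ} (hu : Measurable u)
    (hi : Integrable fun ξ => (wt ξ : ℂ) * u ξ) (hu2 : MemLp u 2) {A : ℝ} (hA0 : 0 ≤ A)
    (hA : DyadicBound u A) :
    eLpNorm (curveExt u) 6 volume ≤ ENNReal.ofReal curveExtConst *
      ENNReal.ofReal A ^ (1 / 12 : ℝ) * eLpNorm u 2 volume ^ (1 - 1 / 12 : ℝ) := by
  have hu1 := lintegral_enorm_sq_eq hu2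
  rw [← ENNReal.ofReal_toReal hu2.eLpNorm_ne_top]
  set M := (eLpNorm u 2 volume).toReal
  have hM : 0 ≤ M := ENNReal.toReal_nonneg
  have hcont : Continuous fun ε : ℝ => ENNReal.ofReal
      (curveExtConst * ((A + ε) ^ (1 / 12 : ℝ) * (M + ε) ^ (1 - 1 / 12 : ℝ))) :=
    ENNReal.continuous_ofReal.comp (continuous_const.mul
      (((continuous_const.add continuous_id).rpow_const fun _ => Or.inr (by norm_num)).mul
        ((continuous_const.add continuous_id).rpow_const fun _ => Or.inr (by norm_num))))
  have hε (ε : ℝ) (h : 0 < ε) : eLpNorm (curveExt u) 6 volume ≤ ENNReal.ofReal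
      (curveExtConst * ((A + ε) ^ (1 / 12 : ℝ) * (M + ε) ^ (1 - 1 / 12 : ℝ))) := by
    refine eLpNorm_curveExt_le_of_pos hu hi (by positivity) (hu1.trans_le ?_) (by positivity)
      (hA.mono (by linarith))
    gcongr
    linarith
  refine (ge_of_tendsto ((hcont.tendsto 0).mono_left nhdsWithin_le_nhds)
    (eventually_nhdsWithin_of_forall (s := Set.Ioi 0) hε)).trans_eq ?_
  rw [add_zero, add_zero, ENNReal.ofReal_mul curveExtConst_nonneg,
    ENNReal.ofReal_mul (by positivity), ENNReal.ofReal_rpow_of_nonneg hA0 (by norm_num),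
    ENNReal.ofReal_rpow_of_nonneg hM (by norm_num), mul_assoc]

/-- The constant of the `L² → L⁶` bound for the extension operator. -/
def strichartzConst : ℝ := curveExtConst * 2 ^ (1 / 12 : ℝ)

theorem dyadicBound_of_memLp {u : ℝ → ℂ} (hu : Measurable u) (hu2 : MemLp u 2) :
    DyadicBound u (2 * (eLpNorm u 2 volume).toReal) :=
  dyadicBound_of_lintegral_sq_le hu ENNReal.toReal_nonneg (lintegral_enorm_sq_eq hu2).le

theorem eLpNorm_curveExt_le_strichartz {u : ℝ → ℂ} (hu : Measurable u)
    (hi : Integrable fun ξ => (wt ξ : ℂ) * u ξ) (hu2 : MemLp u 2) :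
    eLpNorm (curveExt u) 6 volume ≤
      ENNReal.ofReal strichartzConst * eLpNorm u 2 volume := by
  refine (eLpNorm_curveExt_le hu hi hu2 (by positivity) (dyadicBound_of_memLp hu hu2)).trans_eq ?_
  rw [ENNReal.ofReal_mul zero_le_two, ENNReal.ofReal_toReal hu2.eLpNorm_ne_top,
    ENNReal.mul_rpow_of_nonneg _ _ (by norm_num), ENNReal.ofReal_rpow_of_pos two_pos,
    strichartzConst, ENNReal.ofReal_mul curveExtConst_nonneg, mul_assoc, mul_assoc, mul_assoc,
    ← ENNReal.rpow_add_of_nonneg _ _ (by norm_num) (by norm_num), add_sub_cancel, ENNReal.rpow_one]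

end SixthPower

section Extension

theorem measurable_hat (f : L2) : Measurable (hat f) :=
  (Lp.stronglyMeasurable (𝓕 f : L2)).measurable.comp (measurable_id.div_const _)

theorem eLpNorm_hat (f : L2) :
    eLpNorm (hat f) 2 volume = ENNReal.ofReal √(2 * Real.pi) * eLpNorm f 2 volume := by
  have hpi : (0 : ℝ) < 2 * Real.pi := by positivity
  have hcomp : hat f = (𝓕 f : L2) ∘ fun ξ => (2 * Real.pi)⁻¹ * ξ := by
    funext ξ
    rw [hat, div_eq_inv_mul, Function.comp_apply]
  have hfourier : eLpNorm (𝓕 f : L2) 2 volume = eLpNorm f 2 volume := by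
    rw [← Lp.enorm_def, ← Lp.enorm_def, ← ofReal_norm, ← ofReal_norm, Lp.norm_fourier_eq]
  rw [hcomp, ← eLpNorm_map_measure (Lp.stronglyMeasurable _).aestronglyMeasurable (by fun_prop),
    Real.map_volume_mul_left (inv_ne_zero hpi.ne'), inv_inv, abs_of_pos hpi,
    eLpNorm_smul_measure_of_ne_top ENNReal.ofNat_ne_top, hfourier, smul_eq_mul,
    ENNReal.ofReal_rpow_of_pos hpi, Real.sqrt_eq_rpow]
  norm_num

theorem memLp_hat (f : L2) : MemLp (hat f) 2 := by
  refine ⟨(measurable_hat f).aestronglyMeasurable, ?_⟩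
  rw [eLpNorm_hat]
  exact ENNReal.mul_lt_top ENNReal.ofReal_lt_top (Lp.eLpNorm_lt_top f)

theorem integrable_wt_mul_indicator_Ico {u : ℝ → ℂ} (hu2 : MemLp u 2) (a b : ℝ) :
    Integrable fun ξ => (wt ξ : ℂ) * (Set.Ico a b).indicator u ξ := by
  rw [wt_mul_indicator, integrable_indicator_iff measurableSet_Ico]
  have hint : Integrable u (volume.restrict (Set.Ico a b)) :=
    (hu2.restrict _).integrable one_le_two
  refine hint.bdd_mul (c := wt (max |a| |b|)) (by fun_prop) ?_
  filter_upwards [ae_restrict_mem measurableSet_Ico] with ξ hξ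
  rw [Complex.norm_real, Real.norm_of_nonneg (wt_nonneg _)]
  exact wt_le_wt ((abs_le_max_abs_abs hξ.1 hξ.2.le).trans (le_abs_self _))

theorem extIntegral_freqCut (a b : ℝ) (f : L2) :
    extIntegral (freqCut a b f) = fun p =>
      (1 / (2 * Real.pi) : ℂ) * curveExt ((Set.Ico a b).indicator (hat f)) (WithLp.toLp 2 p) := by
  funext p
  rw [extIntegral_eq, curveExt_congr (hat_freqCut a b f)]

theorem eLpNorm_mul_comp_toLp {G : Plane → ℂ} (hG : Continuous G) (q : ℝ≥0∞) :
    eLpNorm (fun p : ℝ × ℝ => (1 / (2 * Real.pi) : ℂ) * G (WithLp.toLp 2 p)) q volume =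
      (ENNReal.ofReal (2 * Real.pi))⁻¹ * eLpNorm G q volume := by
  have henorm : ‖(1 / (2 * Real.pi) : ℂ)‖ₑ = (ENNReal.ofReal (2 * Real.pi))⁻¹ := by
    rw [← ENNReal.ofReal_inv_of_pos (by positivity), ← ofReal_norm]
    simp [abs_of_pos Real.pi_pos]
  rw [← henorm, ← eLpNorm_comp_measurePreserving hG.aestronglyMeasurable
    (WithLp.volume_preserving_toLp ℝ ℝ), ← eLpNorm_const_smul]
  rfl

theorem continuous_curveExt_indicator_Ico {u : ℝ → ℂ} (hu2 : MemLp u 2) (a b : ℝ) :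
    Continuous (curveExt ((Set.Ico a b).indicator u)) :=
  continuous_curveExt (integrable_wt_mul_indicator_Ico hu2 a b)

theorem eLpNorm_extIntegral_freqCut (a b : ℝ) (f : L2) (q : ℝ≥0∞) :
    eLpNorm (extIntegral (freqCut a b f)) q volume = (ENNReal.ofReal (2 * Real.pi))⁻¹ *
      eLpNorm (curveExt ((Set.Ico a b).indicator (hat f))) q volume := by
  rw [extIntegral_freqCut]
  exact eLpNorm_mul_comp_toLp (continuous_curveExt_indicator_Ico (memLp_hat f) a b) q

theorem cellCenter_ne_zero (j k : ℤ) : cellCenter j k ≠ 0 := by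
  refine mul_ne_zero (fun h => ?_) (by positivity)
  have hodd : ((2 * k + 1 : ℤ) : ℝ) = 0 := by
    push_cast
    linarith
  have : 2 * k + 1 = 0 := by exact_mod_cast hodd
  omega

theorem cellScale_pos (j k : ℤ) : 0 < cellScale j k := by
  have hwt : 0 < wt (cellCenter j k) := by
    rcases lt_or_gt_of_ne (cellCenter_ne_zero j k) with hneg | hpos
    · rw [← wt_neg]
      exact wt_pos (neg_pos.2 hneg)
    · exact wt_pos hpos
  exact mul_pos hwt (by positivity)

theorem dyadicInterval_weight_eq (τ : DyadicInterval) :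
    |τ.center + τ.center ^ 3| ^ (-(1 / 6) : ℝ) * τ.length ^ (-(1 / 2) : ℝ) =
      (cellScale τ.j τ.k)⁻¹ := by
  have hcenter : τ.center = cellCenter τ.j τ.k := by
    simp only [DyadicInterval.center, DyadicInterval.left, DyadicInterval.right, cellCenter]
    ring
  have hlength : τ.length = (2 : ℝ) ^ τ.j := by
    simp only [DyadicInterval.length, DyadicInterval.left, DyadicInterval.right]
    ring
  rw [hcenter, hlength, Real.rpow_neg (abs_nonneg _), Real.rpow_neg (by positivity), ← mul_inv,
    ← Real.sqrt_eq_rpow]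
  rfl

theorem eLpNorm_top_le_iff {X E : Type*} [TopologicalSpace X] [MeasurableSpace X]
    [NormedAddCommGroup E] {μ : Measure X} [μ.IsOpenPosMeasure] {F : X → E} (hF : Continuous F)
    {b : ℝ≥0∞} : eLpNorm F ∞ μ ≤ b ↔ ∀ x, ‖F x‖ₑ ≤ b := by
  rw [eLpNorm_exponent_top]
  refine ⟨fun h => ?_, fun h => eLpNormEssSup_le_of_ae_enorm_bound (ae_of_all _ h)⟩
  have hae : ∀ᵐ x ∂μ, ‖F x‖ₑ ≤ b := by
    filter_upwards [ae_le_eLpNormEssSup (f := F) (μ := μ)] with x hx using hx.trans h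
  have hclosed : IsClosed {x | ‖F x‖ₑ ≤ b} := isClosed_le hF.enorm continuous_const
  exact Set.eq_univ_iff_forall.1
    (hclosed.closure_eq.symm.trans (Measure.dense_of_ae hae).closure_eq)

theorem ofReal_two_pi_ne_zero : ENNReal.ofReal (2 * Real.pi) ≠ 0 :=
  (ENNReal.ofReal_pos.2 Real.two_pi_pos).ne'

theorem dyadicSup_le_iff (f : L2) (A : ℝ) :
    dyadicSup f ≤ (ENNReal.ofReal (2 * Real.pi))⁻¹ * ENNReal.ofReal A ↔
      DyadicBound (hat f) A := by
  have hterm (τ : DyadicInterval) : (ENNReal.ofReal (cellScale τ.j τ.k)⁻¹ *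
      eLpNorm (extIntegral (piece f τ)) ∞ volume ≤
        (ENNReal.ofReal (2 * Real.pi))⁻¹ * ENNReal.ofReal A) ↔
      ∀ p, ‖curveExt ((cell τ.j τ.k).indicator (hat f)) p‖ₑ ≤
        ENNReal.ofReal (A * cellScale τ.j τ.k) := by
    have hs := cellScale_pos τ.j τ.k
    rw [← eLpNorm_top_le_iff (μ := volume)
      (continuous_curveExt (u := (cell τ.j τ.k).indicator (hat f))
        (integrable_wt_mul_indicator_Ico (memLp_hat f) _ _)),
      piece, eLpNorm_extIntegral_freqCut, mul_left_comm,
      ENNReal.mul_le_mul_iff_right (ENNReal.inv_ne_zero.2 ENNReal.ofReal_ne_top)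
        (ENNReal.inv_ne_top.2 ofReal_two_pi_ne_zero),
      ENNReal.ofReal_inv_of_pos hs, ENNReal.inv_mul_le_iff (by simpa using hs) (by simp),
      mul_comm A, ENNReal.ofReal_mul hs.le]
    rfl
  simp only [dyadicSup, iSup_le_iff, dyadicInterval_weight_eq, hterm]
  exact ⟨fun h j k => h ⟨k, j⟩, fun h τ => h τ.j τ.k⟩

theorem dyadicSup_ne_top (f : L2) : dyadicSup f ≠ ∞ :=
  ne_top_of_le_ne_top (by finiteness [ofReal_two_pi_ne_zero]) ((dyadicSup_le_iff f _).2
    (dyadicBound_of_memLp (measurable_hat f) (memLp_hat f)))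

theorem dyadicBound_hat (f : L2) :
    DyadicBound (hat f) (2 * Real.pi * (dyadicSup f).toReal) := by
  rw [← dyadicSup_le_iff, ENNReal.ofReal_mul (p := 2 * Real.pi) (by positivity),
    ENNReal.ofReal_toReal (dyadicSup_ne_top f), ← mul_assoc,
    ENNReal.inv_mul_cancel ofReal_two_pi_ne_zero ENNReal.ofReal_ne_top, one_mul]

theorem mem_Ico_two_zpow_iff (m : ℤ) (x : ℝ) :
    x ∈ Set.Ico (-(2 : ℝ) ^ m) ((2 : ℝ) ^ m) ↔
      ⌊x / (2 : ℝ) ^ m⌋ = -1 ∨ ⌊x / (2 : ℝ) ^ m⌋ = 0 := by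
  have h0 : (0 : ℝ) < 2 ^ m := by positivity
  have hunion : Set.Ico (-(2 : ℝ) ^ m) ((2 : ℝ) ^ m) = cell m (-1) ∪ cell m 0 := by
    simp only [cell, Int.cast_neg, Int.cast_one, Int.cast_zero, neg_add_cancel, zero_mul, zero_add,
      neg_one_mul, one_mul]
    exact (Set.Ico_union_Ico_eq_Ico (by linarith) h0.le).symm
  rw [hunion, Set.mem_union, mem_cell_iff, mem_cell_iff]

theorem cell_inter_Ico_of_le {j m : ℤ} (hjm : j ≤ m) (k : ℤ) :
    cell j k ∩ Set.Ico (-(2 : ℝ) ^ m) ((2 : ℝ) ^ m) = ∅ ∨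
      cell j k ∩ Set.Ico (-(2 : ℝ) ^ m) ((2 : ℝ) ^ m) = cell j k := by
  obtain ⟨n, rfl⟩ := Int.le.dest hjm
  have hmem {x : ℝ} (hx : x ∈ cell j k) :
      x ∈ Set.Ico (-(2 : ℝ) ^ (j + n : ℤ)) ((2 : ℝ) ^ (j + n : ℤ)) ↔
        k / 2 ^ n = -1 ∨ k / 2 ^ n = 0 := by
    rw [mem_Ico_two_zpow_iff, floor_div_zpow_add, mem_cell_iff.1 hx]
  by_cases hk : k / 2 ^ n = -1 ∨ k / 2 ^ n = 0
  · exact Or.inr (Set.inter_eq_left.2 fun x hx => (hmem hx).2 hk)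
  · exact Or.inl (Set.eq_empty_of_forall_notMem fun x hx => hk ((hmem hx.1).1 hx.2))

theorem cell_inter_Ico_of_ge {j m : ℤ} (hmj : m ≤ j) (k : ℤ) :
    cell j k ∩ Set.Ico (-(2 : ℝ) ^ m) ((2 : ℝ) ^ m) = ∅ ∨
      cell j k ∩ Set.Ico (-(2 : ℝ) ^ m) ((2 : ℝ) ^ m) = cell m k := by
  obtain ⟨n, rfl⟩ := Int.le.dest hmj
  have hdiv {q : ℤ} (hq : q = -1 ∨ q = 0) : q / 2 ^ n = q := by
    rcases hq with rfl | rfl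
    · exact Int.ediv_eq_neg_one_of_neg_of_le (by norm_num) (by simpa using one_le_pow₀ one_le_two)
    · exact Int.zero_ediv _
  have hmem (x : ℝ) : x ∈ cell (m + n) k ∩ Set.Ico (-(2 : ℝ) ^ m) ((2 : ℝ) ^ m) ↔
      x ∈ cell m k ∧ (k = -1 ∨ k = 0) := by
    rw [Set.mem_inter_iff, mem_cell_iff, mem_cell_iff, mem_Ico_two_zpow_iff, floor_div_zpow_add]
    constructor
    · rintro ⟨hx, hm⟩
      rw [hdiv hm] at hx
      exact ⟨hx, hx ▸ hm⟩
    · rintro ⟨rfl, hk⟩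
      exact ⟨hdiv hk, hk⟩
  by_cases hk : k = -1 ∨ k = 0
  · exact Or.inr (Set.ext fun x => (hmem x).trans (and_iff_left hk))
  · exact Or.inl (Set.eq_empty_of_forall_notMem fun x hx => hk ((hmem x).1 hx).2)

theorem cellScale_le_cellScale {i j : ℤ} (hij : i ≤ j) (k : ℤ) :
    cellScale i k ≤ cellScale j k := by
  have hpow : (2 : ℝ) ^ i ≤ 2 ^ j := zpow_le_zpow_right₀ one_le_two hij
  have hwt : wt (cellCenter i k) ≤ wt (cellCenter j k) := by
    refine wt_le_wt ?_
    rw [cellCenter, cellCenter, abs_mul, abs_mul, abs_of_pos (zpow_pos two_pos i : (0 : ℝ) < 2 ^ i),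
      abs_of_pos (zpow_pos two_pos j : (0 : ℝ) < 2 ^ j)]
    gcongr
  exact mul_le_mul hwt (Real.sqrt_le_sqrt hpow) (Real.sqrt_nonneg _) (wt_nonneg _)

theorem DyadicBound.indicator_Ico {u : ℝ → ℂ} {A : ℝ} (hA0 : 0 ≤ A) (h : DyadicBound u A)
    (m : ℤ) : DyadicBound ((Set.Ico (-(2 : ℝ) ^ m) ((2 : ℝ) ^ m)).indicator u) A := by
  intro j k p
  have hempty : ‖curveExt ((∅ : Set ℝ).indicator u) p‖ₑ ≤ ENNReal.ofReal (A * cellScale j k) := by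
    simp [curveExt, oscInt]
  rw [Set.indicator_indicator]
  rcases le_total j m with hjm | hmj
  · rcases cell_inter_Ico_of_le hjm k with hcell | hcell <;> rw [hcell]
    · exact hempty
    · exact h j k p
  · rcases cell_inter_Ico_of_ge hmj k with hcell | hcell <;> rw [hcell]
    · exact hempty
    · refine (h m k p).trans (ENNReal.ofReal_le_ofReal ?_)
      exact mul_le_mul_of_nonneg_left (cellScale_le_cellScale hmj k) hA0

theorem tendsto_eLpNorm_indicator_sub_of_aecover {α ι E : Type*} [MeasurableSpace α]
    [NormedAddCommGroup E] {μ : Measure α} {l : Filter ι} [l.IsCountablyGenerated] {φ : ι → Set α}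
    (hφ : AECover μ l φ) {u : α → E} {p : ℝ≥0∞} (hp0 : p ≠ 0) (hp : p ≠ ∞) (hu : MemLp u p μ) :
    Tendsto (fun i => eLpNorm ((φ i).indicator u - u) p μ) l (𝓝 0) := by
  have hp' : 0 < p.toReal := ENNReal.toReal_pos hp0 hp
  have hlim : Tendsto (fun i => ∫⁻ x, ‖((φ i).indicator u - u) x‖ₑ ^ p.toReal ∂μ) l
      (𝓝 (∫⁻ _, 0 ∂μ)) := by
    refine tendsto_lintegral_filter_of_dominated_convergence' (fun x => ‖u x‖ₑ ^ p.toReal)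
      (.of_forall fun i => ?_) (.of_forall fun i => .of_forall fun x => ?_)
      (lintegral_rpow_enorm_lt_top_of_eLpNorm_lt_top hp0 hp hu.2).ne ?_
    · exact ((hu.1.indicator (hφ.measurableSet i)).sub hu.1).enorm.pow_const _
    · by_cases hx : x ∈ φ i <;> simp [hx, hp']
    · filter_upwards [hφ.ae_eventually_mem] with x hx
      refine tendsto_const_nhds.congr' (hx.mono fun i hi => ?_)
      simp [hi, hp']
  simp only [eLpNorm_eq_lintegral_rpow_enorm_toReal hp0 hp]
  simpa [hp'] using hlim.ennrpow_const (1 / p.toReal)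

theorem integrable_wt_mul_sub {u v : ℝ → ℂ} (hu : Integrable fun ξ => (wt ξ : ℂ) * u ξ)
    (hv : Integrable fun ξ => (wt ξ : ℂ) * v ξ) : Integrable fun ξ => (wt ξ : ℂ) * (u - v) ξ :=
  (hu.sub hv).congr (.of_forall fun ξ => (mul_sub _ (u ξ) (v ξ)).symm)

theorem curveExt_sub {u v : ℝ → ℂ} (hu : Integrable fun ξ => (wt ξ : ℂ) * u ξ)
    (hv : Integrable fun ξ => (wt ξ : ℂ) * v ξ) : curveExt (u - v) = curveExt u - curveExt v := by
  rw [eq_sub_iff_add_eq, ← curveExt_add (integrable_wt_mul_sub hu hv) hv, sub_add_cancel]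

theorem one_le_ofReal_two_pi : 1 ≤ ENNReal.ofReal (2 * Real.pi) :=
  ENNReal.one_le_ofReal.2 (by linarith [Real.pi_gt_three])

theorem eLpNorm_extIntegral_freqCut_sub_le (f : L2) (R S : ℝ) :
    eLpNorm (extIntegral (freqCut (-R) R f) - extIntegral (freqCut (-S) S f)) 6 volume ≤
      ENNReal.ofReal strichartzConst * eLpNorm
        ((Set.Ico (-R) R).indicator (hat f) - (Set.Ico (-S) S).indicator (hat f)) 2 volume := by
  have hi (R : ℝ) := integrable_wt_mul_indicator_Ico (memLp_hat f) (-R) R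
  have hm (R : ℝ) := (measurable_hat f).indicator (measurableSet_Ico (a := -R) (b := R))
  have hL (R : ℝ) := (memLp_hat f).indicator (measurableSet_Ico (a := -R) (b := R))
  have huv := integrable_wt_mul_sub (hi R) (hi S)
  have hsub : extIntegral (freqCut (-R) R f) - extIntegral (freqCut (-S) S f) = fun p =>
      (1 / (2 * Real.pi) : ℂ) * curveExt ((Set.Ico (-R) R).indicator (hat f) -
        (Set.Ico (-S) S).indicator (hat f)) (WithLp.toLp 2 p) := by
    rw [curveExt_sub (hi R) (hi S), extIntegral_freqCut, extIntegral_freqCut]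
    funext p
    exact (mul_sub _ _ _).symm
  rw [hsub, eLpNorm_mul_comp_toLp (continuous_curveExt huv)]
  exact (mul_le_of_le_one_left' (ENNReal.inv_le_one.2 one_le_ofReal_two_pi)).trans
    (eLpNorm_curveExt_le_strichartz ((hm R).sub (hm S)) huv ((hL R).sub (hL S)))

theorem memLp_extIntegral_freqCut (a b : ℝ) (f : L2) :
    MemLp (extIntegral (freqCut a b f)) 6 volume := by
  have hi := integrable_wt_mul_indicator_Ico (memLp_hat f) a b
  have hL := (memLp_hat f).indicator (measurableSet_Ico (a := a) (b := b))
  constructor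
  · rw [extIntegral_freqCut]
    exact (((continuous_curveExt hi).comp (WithLp.prod_continuous_toLp 2 ℝ ℝ)).const_mul
      _).aestronglyMeasurable
  · rw [eLpNorm_extIntegral_freqCut]
    refine ENNReal.mul_lt_top (by finiteness [ofReal_two_pi_ne_zero]) ?_
    exact (eLpNorm_curveExt_le_strichartz ((measurable_hat f).indicator measurableSet_Ico) hi
      hL).trans_lt (ENNReal.mul_lt_top ENNReal.ofReal_lt_top hL.2)

theorem exists_isExtension (f : L2) : ∃ F, IsExtension f F := by
  have : Fact ((1 : ℝ≥0∞) ≤ 6) := ⟨by norm_num⟩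
  have hlim : Tendsto (fun R : ℝ => ENNReal.ofReal strichartzConst *
      eLpNorm ((Set.Ico (-R) R).indicator (hat f) - hat f) 2 volume) atTop (𝓝 0) := by
    simpa using ENNReal.Tendsto.const_mul (tendsto_eLpNorm_indicator_sub_of_aecover
      (aecover_Ico tendsto_neg_atTop_atBot tendsto_id) two_ne_zero ENNReal.ofNat_ne_top
      (memLp_hat f)) (Or.inr ENNReal.ofReal_ne_top)
  have hm (R : ℝ) := ((memLp_hat f).indicator (measurableSet_Ico (a := -R) (b := R))).sub
    (memLp_hat f)
  have hcauchy : CauchySeq fun R : ℝ => (memLp_extIntegral_freqCut (-R) R f).toLp _ := by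
    refine EMetric.cauchySeq_iff.2 fun ε hε => ?_
    obtain ⟨R₀, hR₀⟩ := eventually_atTop.1
      (hlim.eventually_lt_const (ENNReal.half_pos hε.ne'))
    refine ⟨R₀, fun R hR S hS => ?_⟩
    rw [Lp.edist_toLp_toLp]
    refine (eLpNorm_extIntegral_freqCut_sub_le f R S).trans_lt ?_
    rw [← sub_sub_sub_cancel_right _ _ (hat f), ← ENNReal.add_halves ε]
    refine lt_of_le_of_lt ?_ (ENNReal.add_lt_add (hR₀ R hR) (hR₀ S hS))
    rw [← mul_add]
    gcongr
    exact eLpNorm_sub_le (hm R).1 (hm S).1 one_le_two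
  obtain ⟨F, hF⟩ := cauchySeq_tendsto_of_complete hcauchy
  refine ⟨F, Lp.memLp F, ?_⟩
  rwa [← Lp.toLp_coeFn F (Lp.memLp F), Lp.tendsto_Lp_iff_tendsto_eLpNorm''] at hF

theorem eLpNorm_le_of_tendsto_eLpNorm_sub {α ι E : Type*} [MeasurableSpace α]
    [NormedAddCommGroup E] {μ : Measure α} {l : Filter ι} [l.NeBot] {p : ℝ≥0∞} (hp : 1 ≤ p)
    {G : ι → α → E} {F : α → E} (hG : ∀ i, AEStronglyMeasurable (G i) μ)
    (hF : AEStronglyMeasurable F μ) (hlim : Tendsto (fun i => eLpNorm (G i - F) p μ) l (𝓝 0))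
    {b : ℝ≥0∞} (hb : ∀ i, eLpNorm (G i) p μ ≤ b) : eLpNorm F p μ ≤ b := by
  have hlim' : Tendsto (fun i => eLpNorm (G i - F) p μ + b) l (𝓝 b) := by
    simpa using hlim.add_const b
  refine ge_of_tendsto' hlim' fun i => ?_
  calc eLpNorm F p μ = eLpNorm ((F - G i) + G i) p μ := by rw [sub_add_cancel]
    _ ≤ eLpNorm (F - G i) p μ + eLpNorm (G i) p μ := eLpNorm_add_le (hF.sub (hG i)) (hG i) hp
    _ ≤ eLpNorm (G i - F) p μ + b := by
      rw [eLpNorm_sub_comm]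
      gcongr
      exact hb i

/-- The constant of the refined Strichartz estimate. -/
def refinedConst : ℝ≥0∞ :=
  ENNReal.ofReal curveExtConst * (ENNReal.ofReal (2 * Real.pi)) ^ (1 / 12 : ℝ) *
    ENNReal.ofReal √(2 * Real.pi) ^ (1 - 1 / 12 : ℝ)

theorem refinedConst_ne_top : refinedConst ≠ ∞ := by
  have (x r : ℝ) (hr : 0 ≤ r) : ENNReal.ofReal x ^ r ≠ ∞ :=
    ENNReal.rpow_ne_top_of_nonneg hr ENNReal.ofReal_ne_top
  exact ENNReal.mul_ne_top (ENNReal.mul_ne_top ENNReal.ofReal_ne_top (this _ _ (by norm_num)))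
    (this _ _ (by norm_num))

theorem eLpNorm_extIntegral_freqCut_two_zpow_le (f : L2) (m : ℤ) :
    eLpNorm (extIntegral (freqCut (-2 ^ m) (2 ^ m) f)) 6 volume ≤
      refinedConst * dyadicSup f ^ (1 / 12 : ℝ) * eLpNorm f 2 volume ^ (1 - 1 / 12 : ℝ) := by
  have hA0 : 0 ≤ 2 * Real.pi * (dyadicSup f).toReal := by positivity
  rw [eLpNorm_extIntegral_freqCut]
  calc (ENNReal.ofReal (2 * Real.pi))⁻¹ *
        eLpNorm (curveExt ((Set.Ico (-2 ^ m) (2 ^ m)).indicator (hat f))) 6 volume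
    _ ≤ eLpNorm (curveExt ((Set.Ico (-2 ^ m) (2 ^ m)).indicator (hat f))) 6 volume :=
      mul_le_of_le_one_left' (ENNReal.inv_le_one.2 one_le_ofReal_two_pi)
    _ ≤ ENNReal.ofReal curveExtConst *
          ENNReal.ofReal (2 * Real.pi * (dyadicSup f).toReal) ^ (1 / 12 : ℝ) *
          eLpNorm ((Set.Ico (-2 ^ m) (2 ^ m)).indicator (hat f)) 2 volume ^ (1 - 1 / 12 : ℝ) :=
      eLpNorm_curveExt_le ((measurable_hat f).indicator measurableSet_Ico)
        (integrable_wt_mul_indicator_Ico (memLp_hat f) _ _)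
        ((memLp_hat f).indicator measurableSet_Ico) hA0 ((dyadicBound_hat f).indicator_Ico hA0 m)
    _ ≤ ENNReal.ofReal curveExtConst *
          (ENNReal.ofReal (2 * Real.pi) * dyadicSup f) ^ (1 / 12 : ℝ) *
          (ENNReal.ofReal √(2 * Real.pi) * eLpNorm f 2 volume) ^ (1 - 1 / 12 : ℝ) := by
      rw [← eLpNorm_hat, ENNReal.ofReal_mul (p := 2 * Real.pi) (by positivity),
        ENNReal.ofReal_toReal (dyadicSup_ne_top f)]
      gcongr
      exact eLpNorm_indicator_le _
    _ = refinedConst * dyadicSup f ^ (1 / 12 : ℝ) * eLpNorm f 2 volume ^ (1 - 1 / 12 : ℝ) := by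
      rw [ENNReal.mul_rpow_of_nonneg _ _ (by norm_num),
        ENNReal.mul_rpow_of_nonneg _ _ (by norm_num), refinedConst]
      ring

theorem eLpNorm_le_refined {f : L2} {F : ℝ × ℝ → ℂ} (hF : IsExtension f F) :
    eLpNorm F 6 volume ≤
      refinedConst * dyadicSup f ^ (1 / 12 : ℝ) * eLpNorm f 2 volume ^ (1 - 1 / 12 : ℝ) := by
  have hpow : Tendsto (fun m : ℕ => (2 : ℝ) ^ (m : ℤ)) atTop atTop := by
    simpa only [zpow_natCast] using tendsto_pow_atTop_atTop_of_one_lt one_lt_two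
  exact eLpNorm_le_of_tendsto_eLpNorm_sub (by norm_num)
    (fun m => (memLp_extIntegral_freqCut _ _ f).aestronglyMeasurable) hF.1.aestronglyMeasurable
    (hF.2.comp hpow) fun m => eLpNorm_extIntegral_freqCut_two_zpow_le f m

end Extension

end RefinedStrichartz

end

theorem propositionP :
    ∃ θ : ℝ, 0 < θ ∧ θ < 1 ∧ ∃ C : ℝ≥0, ∀ f : RefinedStrichartz.L2,
      ∃ F : ℝ × ℝ → ℂ, RefinedStrichartz.IsExtension f F ∧
        eLpNorm F 6 volume ≤
          C * RefinedStrichartz.dyadicSup f ^ θ * eLpNorm f 2 volume ^ (1 - θ) := by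
  refine ⟨1 / 12, by norm_num, by norm_num, RefinedStrichartz.refinedConst.toNNReal, fun f => ?_⟩
  obtain ⟨F, hF⟩ := RefinedStrichartz.exists_isExtension f
  refine ⟨F, hF, ?_⟩
  rw [ENNReal.coe_toNNReal RefinedStrichartz.refinedConst_ne_top]
  exact RefinedStrichartz.eLpNorm_le_refined hF
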